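/- Let $m\ge 3$ and $N>2m$ be integers. A solution is a function $u\in C^\infty(\mathbb R^N)$ with $(-\Delta)^m u=e^u$ in $\mathbb R^N$. It is called stable if for every $\varphi\in C_c^\infty(\mathbb R^N)$ $$\int_{\mathbb R^N}|\Delta^{m/2}\varphi|^2\,dx-\int_{\mathbb R^N}e^u\varphi^2\,dx\ge 0\quad (m\text{ even}),\qquad \int_{\mathbb R^N}|\nabla(\Delta^{(m-1)/2}\varphi)|^2\,dx-\int_{\mathbb R^N}e^u\varphi^2\,dx\ge 0\quad (m\text{ odd}).$$ (i) There exists a stable solution $u$ that is not radially symmetric about any point of $\mathbb R^N$. (ii) Suppose moreover that $m$ is even (so $m\ge 4$). There is a (unique) function $\Phi:\mathbb R^{m-2}\to(-\infty,0)$, depending on $m$ and $N$, such that for all $a_1,\dots,a_{m-2},a_{m-1}\in\mathbb R$, a solution $u$ on $\mathbb R^N$ which is radial about the origin and satisfies $u(0)=0$ and $\Delta^k u(0)=a_k$ for $1\le k\le m-1$ exists if and only if $a_{m-1}\le\Phi(a_1,\dots,a_{m-2})$. There exist $a_1,\dots,a_{m-2}\in\mathbb R$ such that for $a_{m-1}=\Phi(a_1,\dots,a_{m-2})$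 there is a stable radial solution $u$ with $u(0)=0$ and $\Delta^k u(0)=a_k$ for $1\le k\le m-1$. -/

import Mathlib

open MeasureTheory

noncomputable section

namespace Polyharmonic

/-- Euclidean space `ℝ^N`. -/
abbrev Space (N : ℕ) : Type := EuclideanSpace ℝ (Fin N)

/-- The iterated Laplacian `Δ^k u`. -/
def iterLap {N : ℕ} (k : ℕ) (u : Space N → ℝ) : Space N → ℝ :=
  (fun v : Space N → ℝ => (Laplacian.laplacian v : Space N → ℝ))^[k] u

/-- `u` is a smooth entire solution of `(-Δ)^m u = e^u` in `ℝ^N`. -/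
def IsEntireSolution {N : ℕ} (m : ℕ) (u : Space N → ℝ) : Prop :=
  ContDiff ℝ ((⊤ : ℕ∞) : WithTop ℕ∞) u ∧
    ∀ x, (-1 : ℝ) ^ m * iterLap m u x = Real.exp (u x)

/-- The quadratic form `∫ |Δ^{m/2} φ|²` for even `m` and `∫ |∇ Δ^{(m-1)/2} φ|²` for odd `m`. -/
def energy {N : ℕ} (m : ℕ) (φ : Space N → ℝ) : ℝ :=
  if Even m then ∫ x, |iterLap (m / 2) φ x| ^ 2
  else ∫ x, ‖gradient (iterLap ((m - 1) / 2) φ) x‖ ^ 2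

/-- `u` is stable in `ℝ^N`: the second variation is non-negative on all test functions
`φ ∈ C_c^∞(ℝ^N)`. -/
def IsStable {N : ℕ} (m : ℕ) (u : Space N → ℝ) : Prop :=
  ∀ φ : Space N → ℝ, ContDiff ℝ ((⊤ : ℕ∞) : WithTop ℕ∞) φ → HasCompactSupport φ →
    0 ≤ energy m φ - ∫ x, Real.exp (u x) * φ x ^ 2

/-- `u` is radially symmetric about the point `x₀`. -/
def IsRadialAbout {N : ℕ} (x₀ : Space N) (u : Space N → ℝ) : Prop :=
  ∃ f : ℝ → ℝ, ∀ x, u x = f ‖x - x₀‖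

/-- `u` is a globally defined radial solution of `(-Δ)^m u = e^u` with initial values
`u(0) = 0`, `Δ^k u(0) = a_k` for `1 ≤ k ≤ m - 2` and `Δ^{m-1} u(0) = β`.
The vector `a` is indexed from `0`: its entry `i` is `a_{i+1}`. (The odd radial derivatives of
a smooth radial function vanish at the origin by themselves.) -/
def IsGlobalRadialSolution {N : ℕ} (m : ℕ) (a : Fin (m - 2) → ℝ) (β : ℝ)
    (u : Space N → ℝ) : Prop :=
  IsEntireSolution m u ∧ IsRadialAbout 0 u ∧ u 0 = 0 ∧
    (∀ i : Fin (m - 2), iterLap ((i : ℕ) + 1) u 0 = a i) ∧ iterLap (m - 1) u 0 = β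

/-- `Φ` is the threshold function of global existence in `ℝ^N`: it is negative, and the radial
solution with initial values `0, a_1, …, a_{m-2}, β` is global if and only if
`β ≤ Φ(a_1, …, a_{m-2})`. This determines `Φ`. -/
def IsExistenceThreshold (N m : ℕ) (Φ : (Fin (m - 2) → ℝ) → ℝ) : Prop :=
  (∀ a, Φ a < 0) ∧
    ∀ a β, (∃ u : Space N → ℝ, IsGlobalRadialSolution m a β u) ↔ β ≤ Φ a

end Polyharmonic

end

noncomputable section

namespace Polyharmonic

open scoped ENNReal

variable {N : ℕ}

/-! Both halves rest on one stability criterion. Iterating a weighted Hardy inequality gives, for `2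
* m < N`, a Rellich inequality `∫ φ² (ε + |x|²)⁻ᵐ ≤ C · energy m φ` with `C` independent of `ε`
(`hardy_rellich`). Hence any solution with `e^u ≤ c (ε + |x|²)⁻ᵐ`, for a suitable small `c`, is
stable (`exists_isStable_of_le_wt`). It remains to construct solutions lying under such a weight.

Threshold, `m` even. The equation is then `Δ^m u = e^u`, and for radial functions it is equivalent
to an integral equation obtained by iterating the radial inverse Laplacian `K` (`IsProfile`,
`exists_isProfile`). Both `K` and `exp` are order preserving, so sub- and supersolution arguments
apply although `m > 1`. Picard iterates increase, and a supersolution bounds them. The set of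
admissible `Δ^{m-1} u(0)` is downward closed by comparison, nonempty by an explicit logarithmic
supersolution, and bounded above by `0`: otherwise `Δ^{m-1} u` becomes positive, all lower
Laplacians and `u` itself tend to infinity, and exponential growth forces blow-up
(`IsProfile.top_nonpos`, `IsProfile.top_neg`). The same blow-up mechanism gives a local upper bound
uniform in the data (`IsProfile.local_bound`), so the supremum is attained. Thus `Φ` is this
supremum. For stability at the threshold, take `a_1` very negative and the other prescribed data
zero. Since `Δ^{m-1} u ≤ 0` persists on the threshold solution, `u` lies below a steep negative
quadratic and the criterion applies.

Nonradial solution, any `m ≥ 2`. Write `u = v + log (δ κ) - ∑ x_i² / (4 b_i)` with unequal `b_i`.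
The polynomial is killed by `Δ^m`, so `v` solves `(-Δ)^m v = δ κ e^{-∑ x_i² / (4 b_i)} e^v`. With
`v` the Fourier transform of a positive measure `ν`, this reads `ν = δ |ξ|^{-2m} (exp_*(ν) * γ)`,
where `γ` is a Gaussian measure and `exp_*` the convolution exponential. The symbol is locally
integrable because `2 * m < N`, and for small `δ` monotone iteration from `0` stays in the positive
measures of exponential moment at most one (`exists_fourier_fixed_point`). So `v` is smooth with
`|v| ≤ 1`: it cannot hide the anisotropy of the quadratic form, and Gaussian decay with small `δ`
gives stability. -/

/-! ### Coordinate derivatives, iterated Laplacians and integration by parts. -/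

/-- The partial derivative of `f` in the `i`-th coordinate direction. -/
def pd (i : Fin N) (f : Space N → ℝ) : Space N → ℝ :=
  fun x => fderiv ℝ f x (EuclideanSpace.single i 1)

theorem contDiff_pd {n : WithTop ℕ∞} {k : WithTop ℕ∞} {f : Space N → ℝ} (hf : ContDiff ℝ k f)
    (h : n + 1 ≤ k) (i : Fin N) : ContDiff ℝ n (pd i f) :=
  (hf.fderiv_right h).clm_apply contDiff_const

theorem contDiff_pd_top {f : Space N → ℝ} (hf : ContDiff ℝ ((⊤ : ℕ∞) : WithTop ℕ∞) f)
    (i : Fin N) : ContDiff ℝ ((⊤ : ℕ∞) : WithTop ℕ∞) (pd i f) :=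
  contDiff_pd hf (by simp) i

theorem pd_pd_eq {f : Space N → ℝ} (hf : ContDiff ℝ 2 f) (i j : Fin N) (x : Space N) :
    pd i (pd j f) x = fderiv ℝ (fderiv ℝ f) x (EuclideanSpace.single i 1)
      (EuclideanSpace.single j 1) := by
  have h : DifferentiableAt ℝ (fderiv ℝ f) x :=
    ((hf.fderiv_right (m := 1) (by norm_num)).differentiable (by norm_num)) x
  unfold pd
  rw [fderiv_clm_apply h (differentiableAt_const _)]
  simp

theorem pd_comm {f : Space N → ℝ} (hf : ContDiff ℝ 2 f) (i j : Fin N) :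
    pd i (pd j f) = pd j (pd i f) := by
  ext x
  rw [pd_pd_eq hf, pd_pd_eq hf]
  exact (hf.contDiffAt.isSymmSndFDerivAt (by simp)) _ _

theorem laplacian_eq_sum_pd {f : Space N → ℝ} (hf : ContDiff ℝ 2 f) :
    (Laplacian.laplacian f : Space N → ℝ) = fun x => ∑ i, pd i (pd i f) x := by
  rw [InnerProductSpace.laplacian_eq_iteratedFDeriv_orthonormalBasis f
    (EuclideanSpace.basisFun (Fin N) ℝ)]
  ext x
  refine Finset.sum_congr rfl fun i _ => ?_
  rw [pd_pd_eq hf, iteratedFDeriv_two_apply]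
  simp

theorem pd_sum {ι : Type*} {s : Finset ι} {f : ι → Space N → ℝ}
    (hf : ∀ j ∈ s, Differentiable ℝ (f j)) (i : Fin N) :
    pd i (fun x => ∑ j ∈ s, f j x) = fun x => ∑ j ∈ s, pd i (f j) x := by
  ext x
  unfold pd
  rw [fderiv_fun_sum fun j hj => hf j hj x]
  simp

theorem contDiff_laplacian {n k : WithTop ℕ∞} {f : Space N → ℝ} (hf : ContDiff ℝ k f)
    (h : n + 2 ≤ k) : ContDiff ℝ n (Laplacian.laplacian f : Space N → ℝ) := by
  have h1 : n + 1 + 1 ≤ k := by rwa [add_assoc, one_add_one_eq_two]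
  rw [laplacian_eq_sum_pd (hf.of_le (le_trans le_add_self h))]
  exact ContDiff.sum fun i _ => contDiff_pd (contDiff_pd hf h1 i) le_rfl i

theorem contDiff_laplacian_top {f : Space N → ℝ} (hf : ContDiff ℝ ((⊤ : ℕ∞) : WithTop ℕ∞) f) :
    ContDiff ℝ ((⊤ : ℕ∞) : WithTop ℕ∞) (Laplacian.laplacian f : Space N → ℝ) :=
  contDiff_laplacian hf le_rfl

theorem iterLap_zero (u : Space N → ℝ) : iterLap 0 u = u := rfl

theorem iterLap_succ (k : ℕ) (u : Space N → ℝ) :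
    iterLap (k + 1) u = iterLap k (Laplacian.laplacian u : Space N → ℝ) := rfl

theorem iterLap_succ' (k : ℕ) (u : Space N → ℝ) :
    iterLap (k + 1) u = (Laplacian.laplacian (iterLap k u) : Space N → ℝ) :=
  Function.iterate_succ_apply' _ _ _

theorem contDiff_iterLap {u : Space N → ℝ} (hu : ContDiff ℝ ((⊤ : ℕ∞) : WithTop ℕ∞) u) (k : ℕ) :
    ContDiff ℝ ((⊤ : ℕ∞) : WithTop ℕ∞) (iterLap k u) := by
  induction k with
  | zero => exact hu
  | succ k ih => rw [iterLap_succ']; exact contDiff_laplacian_top ih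

theorem laplacian_pd {f : Space N → ℝ} (hf : ContDiff ℝ ((⊤ : ℕ∞) : WithTop ℕ∞) f) (i : Fin N) :
    (Laplacian.laplacian (pd i f) : Space N → ℝ) = pd i (Laplacian.laplacian f) := by
  have h2 : ∀ {g : Space N → ℝ}, ContDiff ℝ ((⊤ : ℕ∞) : WithTop ℕ∞) g → ContDiff ℝ 2 g :=
    fun h => h.of_le (WithTop.coe_le_coe.2 le_top)
  rw [laplacian_eq_sum_pd (h2 (contDiff_pd_top hf i)), laplacian_eq_sum_pd (h2 hf), pd_sum]
  · ext x
    refine Finset.sum_congr rfl fun j _ => ?_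
    rw [pd_comm (h2 hf) j i, pd_comm (h2 (contDiff_pd_top hf j)) j i]
  · exact fun j _ => (contDiff_pd_top (contDiff_pd_top hf j) j).differentiable (by simp)

theorem iterLap_pd {f : Space N → ℝ} (hf : ContDiff ℝ ((⊤ : ℕ∞) : WithTop ℕ∞) f) (i : Fin N)
    (k : ℕ) : iterLap k (pd i f) = pd i (iterLap k f) := by
  induction k generalizing f with
  | zero => rfl
  | succ k ih => rw [iterLap_succ, laplacian_pd hf, ih (contDiff_laplacian_top hf), iterLap_succ]

theorem norm_gradient_sq {f : Space N → ℝ} (x : Space N) :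
    ‖gradient f x‖ ^ 2 = ∑ i, pd i f x ^ 2 := by
  rw [EuclideanSpace.norm_sq_eq]
  refine Finset.sum_congr rfl fun i _ => ?_
  have : pd i f x = gradient f x i := by
    unfold pd gradient
    rw [← InnerProductSpace.toDual_symm_apply (𝕜 := ℝ), EuclideanSpace.inner_single_right]
    simp
  rw [this, Real.norm_eq_abs, sq_abs]

theorem hasCompactSupport_pd {f : Space N → ℝ} (hf : HasCompactSupport f) (i : Fin N) :
    HasCompactSupport (pd i f) :=
  hf.fderiv_apply ℝ (EuclideanSpace.single i 1)

theorem hasCompactSupport_sq {f : Space N → ℝ} (hf : HasCompactSupport f) :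
    HasCompactSupport (fun x => f x ^ 2) :=
  hf.comp_left (g := fun t : ℝ => t ^ 2) (by simp)

theorem hasCompactSupport_laplacian {f : Space N → ℝ} (hf : ContDiff ℝ 2 f)
    (hc : HasCompactSupport f) : HasCompactSupport (Laplacian.laplacian f : Space N → ℝ) := by
  rw [laplacian_eq_sum_pd hf]
  refine HasCompactSupport.of_support_subset_isCompact hc.isCompact fun x hx => ?_
  by_contra hxs
  refine hx (Finset.sum_eq_zero fun i _ => ?_)
  have h1 : pd i (pd i f) x = 0 := by
    by_contra h
    exact hxs ((tsupport_fderiv_apply_subset ℝ (f := f) (EuclideanSpace.single i 1))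
      ((tsupport_fderiv_apply_subset ℝ (f := pd i f) (EuclideanSpace.single i 1))
        (subset_tsupport _ h)))
  exact h1

theorem hasCompactSupport_iterLap {f : Space N → ℝ}
    (hf : ContDiff ℝ ((⊤ : ℕ∞) : WithTop ℕ∞) f) (hc : HasCompactSupport f) (k : ℕ) :
    HasCompactSupport (iterLap k f) := by
  induction k with
  | zero => exact hc
  | succ k ih =>
    rw [iterLap_succ']
    exact hasCompactSupport_laplacian
      ((contDiff_iterLap hf k).of_le (WithTop.coe_le_coe.2 le_top)) ih

theorem integral_mul_pd {f g : Space N → ℝ} (hf : ContDiff ℝ 1 f) (hg : ContDiff ℝ 1 g)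
    (hc : HasCompactSupport f) (i : Fin N) :
    ∫ x, f x * pd i g x = - ∫ x, pd i f x * g x := by
  have hf' : Continuous (pd i f) := (contDiff_pd (n := 0) hf (by simp) i).continuous
  have hg' : Continuous (pd i g) := (contDiff_pd (n := 0) hg (by simp) i).continuous
  exact integral_mul_fderiv_eq_neg_fderiv_mul_of_integrable
    ((hf'.mul hg.continuous).integrable_of_hasCompactSupport
      (hasCompactSupport_pd hc i).mul_right)
    ((hf.continuous.mul hg').integrable_of_hasCompactSupport hc.mul_right)
    ((hf.continuous.mul hg.continuous).integrable_of_hasCompactSupport hc.mul_right)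
    (fun x _ => hf.differentiable (by simp) x) (fun x _ => hg.differentiable (by simp) x)

/-! ### Hardy–Rellich inequality and the stability criterion. -/

/-- The weight `(ε + |x|²)⁻ᵏ`. -/
def wt (ε : ℝ) (k : ℕ) (x : Space N) : ℝ := ((ε + ‖x‖ ^ 2) ^ k)⁻¹

theorem wt_pos {ε : ℝ} (hε : 0 < ε) (k : ℕ) (x : Space N) : 0 < wt ε k x := by
  unfold wt; positivity

theorem contDiff_wt {ε : ℝ} (hε : 0 < ε) (k : ℕ) {n : WithTop ℕ∞} :
    ContDiff ℝ n (wt ε k : Space N → ℝ) := by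
  refine ContDiff.inv ((contDiff_const.add (contDiff_norm_sq ℝ)).pow k) fun x => ?_
  positivity

theorem pd_coord_mul_wt {ε : ℝ} (hε : 0 < ε) (k : ℕ) (i : Fin N) (x : Space N) :
    pd i (fun y => y i * wt ε k y) x =
      wt ε k x - 2 * k * x i ^ 2 * wt ε (k + 1) x := by
  have hpos : ε + ‖x‖ ^ 2 ≠ 0 := by positivity
  have h1 : HasFDerivAt (fun y : Space N => y i) (EuclideanSpace.proj i : Space N →L[ℝ] ℝ) x :=
    (EuclideanSpace.proj i : Space N →L[ℝ] ℝ).hasFDerivAt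
  have h2 : HasFDerivAt (fun y : Space N => ε + ‖y‖ ^ 2) (2 • innerSL ℝ x) x :=
    (hasStrictFDerivAt_norm_sq x).hasFDerivAt.const_add ε
  have h3 := (hasDerivAt_inv (pow_ne_zero k hpos)).comp_hasFDerivAt x (h2.pow k)
  have h4 := h1.mul h3
  have h5 : pd i (fun y => y i * wt ε k y) x = _ :=
    congrArg (fun L => L (EuclideanSpace.single i 1)) h4.fderiv
  rw [h5]
  unfold wt
  rcases k with _ | k
  · simp
  · simp [EuclideanSpace.inner_single_right]
    field_simp
    ring

/-- The divergence of `x (ε + |x|²)⁻ᵏ` loses only `2k |x|² (ε + |x|²)⁻ᵏ⁻¹`, and `|x|² ≤ ε + |x|²`.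
Regularising by `ε` keeps the field smooth at the origin without spoiling the constant. -/
theorem sum_pd_coord_mul_wt {ε : ℝ} (hε : 0 < ε) (k : ℕ) (x : Space N) :
    ((N : ℝ) - 2 * k) * wt ε k x ≤ ∑ i, pd i (fun y => y i * wt ε k y) x := by
  have h : ∑ i, pd i (fun y => y i * wt ε k y) x =
      N * wt ε k x - 2 * k * (‖x‖ ^ 2 * wt ε (k + 1) x) := by
    simp_rw [pd_coord_mul_wt hε]
    rw [Finset.sum_sub_distrib, ← Finset.sum_mul, ← Finset.mul_sum, EuclideanSpace.norm_sq_eq]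
    simp
    ring
  have h2 : ‖x‖ ^ 2 * wt ε (k + 1) x ≤ wt ε k x := by
    unfold wt
    have : 0 < ε + ‖x‖ ^ 2 := by positivity
    rw [pow_succ (ε + ‖x‖ ^ 2), mul_inv, mul_left_comm]
    refine mul_le_of_le_one_right (by positivity) ?_
    rw [← div_eq_mul_inv, div_le_one this]
    linarith
  rw [h]
  nlinarith [mul_le_mul_of_nonneg_left h2 (by positivity : (0 : ℝ) ≤ 2 * k)]

/-- Test `φ²` against the divergence of `x (ε + |x|²)⁻ᵏ⁻¹`, integrate by parts and absorb half of
the result by Young's inequality. -/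
theorem hardy_weighted {ε : ℝ} (hε : 0 < ε) {k : ℕ} (hk : 2 * (k + 1) < N) {φ : Space N → ℝ}
    (hφ : ContDiff ℝ ((⊤ : ℕ∞) : WithTop ℕ∞) φ) (hc : HasCompactSupport φ) :
    ∫ x, φ x ^ 2 * wt ε (k + 1) x ≤
      4 / ((N : ℝ) - 2 * (k + 1)) ^ 2 * ∑ i, ∫ x, pd i φ x ^ 2 * wt ε k x := by
  set θ : ℝ := (N : ℝ) - 2 * (k + 1) with hθ
  have hθ0 : 0 < θ := by
    have : (2 * (k + 1) : ℝ) < N := by exact_mod_cast hk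
    linarith
  have hφ1 : ContDiff ℝ 1 φ := hφ.of_le (by simp)
  have hpd : ∀ i, Continuous (pd i φ) := fun i => (contDiff_pd_top hφ i).continuous
  have hpdc : ∀ i, HasCompactSupport (pd i φ) := fun i => hasCompactSupport_pd hc i
  have hw : ∀ j, Continuous (wt ε j : Space N → ℝ) := fun j =>
    (contDiff_wt (n := 0) hε j).continuous
  have hg : ∀ i : Fin N, ContDiff ℝ 1 (fun y : Space N => y i * wt ε (k + 1) y) := fun i =>
    (EuclideanSpace.proj i : Space N →L[ℝ] ℝ).contDiff.mul (contDiff_wt hε _)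
  have hg' : ∀ i : Fin N, Continuous (pd i (fun y : Space N => y i * wt ε (k + 1) y)) := fun i =>
    (contDiff_pd (n := 0) (hg i) (by simp) i).continuous
  have hsq : ContDiff ℝ 1 (fun x => φ x ^ 2) := hφ1.pow 2
  have hsqc : HasCompactSupport (fun x => φ x ^ 2) := hasCompactSupport_sq hc
  have hpsq : ∀ i x, pd i (fun x => φ x ^ 2) x = 2 * φ x * pd i φ x := by
    intro i x
    unfold pd
    rw [((hφ1.differentiable (by simp) x).hasFDerivAt.pow 2).fderiv]
    simp
  have hparts : ∀ i : Fin N, ∫ x, φ x ^ 2 * pd i (fun y : Space N => y i * wt ε (k + 1) y) x =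
      - ∫ x, 2 * φ x * pd i φ x * (x i * wt ε (k + 1) x) := by
    intro i
    rw [integral_mul_pd hsq (hg i) hsqc i]
    simp_rw [hpsq]
  have i1 : ∀ i : Fin N,
      Integrable (fun x => φ x ^ 2 * pd i (fun y : Space N => y i * wt ε (k + 1) y) x) := fun i =>
    (hsq.continuous.mul (hg' i)).integrable_of_hasCompactSupport hsqc.mul_right
  have i2 : ∀ i : Fin N,
      Integrable (fun x => 2 * φ x * pd i φ x * (x i * wt ε (k + 1) x)) := fun i =>
    (((continuous_const.mul hφ1.continuous).mul (hpd i)).mul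
      (hg i).continuous).integrable_of_hasCompactSupport
      ((hpdc i).mul_left.mul_right)
  have i3 : Integrable (fun x => φ x ^ 2 * wt ε (k + 1) x) :=
    (hsq.continuous.mul (hw _)).integrable_of_hasCompactSupport hsqc.mul_right
  have i4 : ∀ i : Fin N, Integrable (fun x => pd i φ x ^ 2 * wt ε k x) := fun i =>
    (((hpd i).pow 2).mul (hw _)).integrable_of_hasCompactSupport
      (hasCompactSupport_sq (hpdc i)).mul_right
  have key : ∀ x, θ * (φ x ^ 2 * wt ε (k + 1) x) ≤
      ∑ i, φ x ^ 2 * pd i (fun y : Space N => y i * wt ε (k + 1) y) x := by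
    intro x
    rw [← Finset.mul_sum]
    have := sum_pd_coord_mul_wt hε (k + 1) x
    push_cast at this
    nlinarith [mul_le_mul_of_nonneg_left this (sq_nonneg (φ x))]
  have key2 : ∀ x, ∑ i, - (2 * φ x * pd i φ x * (x i * wt ε (k + 1) x)) ≤
      θ / 2 * (φ x ^ 2 * wt ε (k + 1) x) + 2 / θ * ∑ i, pd i φ x ^ 2 * wt ε k x := by
    intro x
    have hp : 0 < ε + ‖x‖ ^ 2 := by positivity
    set s := ε + ‖x‖ ^ 2 with hs
    have h1 : wt ε (k + 1) x = wt ε k x * s⁻¹ := by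
      unfold wt; rw [pow_succ, mul_inv]
    -- Completing a square with weights `θ / 2` and `2 / θ`, so that after summation exactly half of
    -- the divergence term is absorbed.
    have h2 : ∀ i, - (2 * φ x * pd i φ x * (x i * wt ε (k + 1) x)) ≤
        (θ / 2 * φ x ^ 2 * wt ε k x * (s⁻¹) ^ 2) * x i ^ 2 + 2 / θ * (pd i φ x ^ 2 * wt ε k x) := by
      intro i
      have hw0 := (wt_pos hε k x).le
      have : 0 ≤ wt ε k x * (θ / 2 * (φ x * x i * s⁻¹ + 2 / θ * pd i φ x) ^ 2) := by positivity
      have e : wt ε k x * (θ / 2 * (φ x * x i * s⁻¹ + 2 / θ * pd i φ x) ^ 2) =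
        (θ / 2 * φ x ^ 2 * wt ε k x * (s⁻¹) ^ 2) * x i ^ 2 + 2 / θ * (pd i φ x ^ 2 * wt ε k x) +
          (2 * φ x * pd i φ x * (x i * (wt ε k x * s⁻¹))) := by
        field_simp
        ring
      rw [h1]
      linarith
    refine (Finset.sum_le_sum fun i _ => h2 i).trans ?_
    rw [Finset.sum_add_distrib, ← Finset.mul_sum, ← Finset.mul_sum]
    refine add_le_add_left ?_ _
    have h3 : ∑ i, x i ^ 2 = ‖x‖ ^ 2 := by
      rw [EuclideanSpace.norm_sq_eq]; simp
    rw [h3, h1]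
    have h4 : s⁻¹ * ‖x‖ ^ 2 ≤ 1 := by
      rw [inv_mul_le_one₀ hp]; linarith
    have h5 : 0 ≤ θ / 2 * φ x ^ 2 * wt ε k x * s⁻¹ := by
      have := (wt_pos hε k x).le
      positivity
    nlinarith [mul_le_mul_of_nonneg_left h4 h5]
  have h1 := integral_mono (i3.const_mul θ) (integrable_finsetSum _ fun i _ => i1 i) key
  have h2 := integral_mono (integrable_finsetSum _ fun i _ => (i2 i).neg)
    ((i3.const_mul (θ / 2)).add ((integrable_finsetSum Finset.univ fun i _ => i4 i).const_mul
      (2 / θ))) key2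
  rw [integral_const_mul, integral_finsetSum _ fun i _ => i1 i] at h1
  erw [integral_finsetSum _ fun i _ => (i2 i).neg,
    integral_add (i3.const_mul (θ / 2)) ((integrable_finsetSum Finset.univ
      fun i _ => i4 i).const_mul (2 / θ)), integral_const_mul, integral_const_mul,
      integral_finsetSum _ fun i _ => i4 i] at h2
  simp_rw [hparts] at h1
  simp_rw [Pi.neg_apply, integral_neg] at h2
  have h3 := h1.trans h2
  rw [div_mul_eq_mul_div, le_div_iff₀ (by positivity)]
  have h4 : θ / 2 * ∫ x, φ x ^ 2 * wt ε (k + 1) x ≤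
      2 / θ * ∑ i, ∫ x, pd i φ x ^ 2 * wt ε k x := by linarith
  have h5 := mul_le_mul_of_nonneg_left h4 (by positivity : 0 ≤ 2 * θ)
  have h6 : 2 * θ * (2 / θ * ∑ i, ∫ x, pd i φ x ^ 2 * wt ε k x) =
      4 * ∑ i, ∫ x, pd i φ x ^ 2 * wt ε k x := by
    field_simp; ring
  nlinarith

/-- From even to odd order this is the definition of the gradient; from odd to even it is `∫ |D²ψ|²
= ∫ (Δψ)²`. It lets the Rellich induction pass through both parities by applying the hypothesis to
the partial derivatives of `φ`. -/
theorem sum_energy_pd (m : ℕ) {φ : Space N → ℝ} (hφ : ContDiff ℝ ((⊤ : ℕ∞) : WithTop ℕ∞) φ)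
    (hc : HasCompactSupport φ) : ∑ i, energy m (pd i φ) = energy (m + 1) φ := by
  have int_sq : ∀ {f : Space N → ℝ}, Continuous f → HasCompactSupport f →
      Integrable (fun x => f x ^ 2) := fun hf hc =>
    (hf.pow 2).integrable_of_hasCompactSupport (hasCompactSupport_sq hc)
  rcases Nat.even_or_odd' m with ⟨k, rfl | rfl⟩
  · have e1 : ¬ Even (2 * k + 1) := by simp
    have e2 : 2 * k / 2 = k := by omega
    have hk := contDiff_iterLap hφ k
    have hkc := hasCompactSupport_iterLap hφ hc k
    simp only [energy, even_two_mul, if_true, if_neg e1, Nat.add_sub_cancel, e2, sq_abs,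
      norm_gradient_sq, iterLap_pd hφ]
    rw [integral_finsetSum]
    exact fun i _ => int_sq (contDiff_pd_top hk i).continuous (hasCompactSupport_pd hkc i)
  · have e1 : ¬ Even (2 * k + 1) := by simp
    have e2 : 2 * k / 2 = k := by omega
    have e3 : (2 * k + 1 + 1) / 2 = k + 1 := by omega
    have e4 : Even (2 * k + 1 + 1) := ⟨k + 1, by ring⟩
    have hk := contDiff_iterLap hφ k
    have hkc := hasCompactSupport_iterLap hφ hc k
    simp only [energy, if_neg e1, Nat.add_sub_cancel, e2, e3, if_pos e4, sq_abs,
      norm_gradient_sq, iterLap_pd hφ, iterLap_succ']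
    set ψ := iterLap k φ
    have h2 : ∀ {g : Space N → ℝ}, ContDiff ℝ ((⊤ : ℕ∞) : WithTop ℕ∞) g → ContDiff ℝ 2 g :=
      fun h => h.of_le (WithTop.coe_le_coe.2 le_top)
    have h1 : ∀ {g : Space N → ℝ}, ContDiff ℝ ((⊤ : ℕ∞) : WithTop ℕ∞) g → ContDiff ℝ 1 g :=
      fun h => h.of_le (by simp)
    have c2 : ∀ i j, ContDiff ℝ ((⊤ : ℕ∞) : WithTop ℕ∞) (pd i (pd j ψ)) := fun i j =>
      contDiff_pd_top (contDiff_pd_top hk j) i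
    have s2 : ∀ i j, HasCompactSupport (pd i (pd j ψ)) := fun i j =>
      hasCompactSupport_pd (hasCompactSupport_pd hkc j) i
    -- Two integrations by parts, one in each direction; commuting the third derivatives matches
    -- them.
    have swap : ∀ i j, ∫ x, pd j (pd i ψ) x ^ 2 = ∫ x, pd i (pd i ψ) x * pd j (pd j ψ) x := by
      intro i j
      have a := integral_mul_pd (h1 (c2 j i)) (h1 (contDiff_pd_top hk i)) (s2 j i) j
      have b := integral_mul_pd (h1 (c2 j j)) (h1 (contDiff_pd_top hk i)) (s2 j j) i
      have c : pd j (pd j (pd i ψ)) = pd i (pd j (pd j ψ)) := by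
        rw [pd_comm (h2 hk) j i, pd_comm (h2 (contDiff_pd_top hk j)) j i]
      simp_rw [pow_two]
      rw [a, c, ← b]
      simp_rw [mul_comm]
    simp_rw [laplacian_eq_sum_pd (h2 hk), pow_two, Finset.sum_mul_sum, ← pow_two]
    have L : ∀ i, ∫ x, ∑ j, pd j (pd i ψ) x ^ 2 = ∑ j, ∫ x, pd j (pd i ψ) x ^ 2 := fun i =>
      integral_finsetSum _ fun j _ => int_sq (c2 j i).continuous (s2 j i)
    have I : ∀ i j, Integrable (fun x => pd i (pd i ψ) x * pd j (pd j ψ) x) := fun i j =>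
      ((c2 i i).continuous.mul (c2 j j).continuous).integrable_of_hasCompactSupport
        (s2 i i).mul_right
    rw [integral_finsetSum _ fun i _ => integrable_finsetSum _ fun j _ => I i j]
    refine Finset.sum_congr rfl fun i _ => ?_
    rw [L i, integral_finsetSum _ fun j _ => I i j]
    exact Finset.sum_congr rfl fun j _ => swap i j

theorem hardy_rellich (m : ℕ) (hm : 2 * m < N) : ∃ C : ℝ, 0 < C ∧ ∀ ε : ℝ, 0 < ε →
    ∀ φ : Space N → ℝ, ContDiff ℝ ((⊤ : ℕ∞) : WithTop ℕ∞) φ → HasCompactSupport φ →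
      ∫ x, φ x ^ 2 * wt ε m x ≤ C * energy m φ := by
  induction m with
  | zero => exact ⟨1, one_pos, fun ε _ φ _ _ => by simp [wt, energy, iterLap_zero]⟩
  | succ m ih =>
    obtain ⟨C, hC, h⟩ := ih (by omega)
    have hθ : 0 < (N : ℝ) - 2 * (m + 1) := by
      have : (2 * (m + 1) : ℝ) < N := by exact_mod_cast hm
      linarith
    refine ⟨4 / ((N : ℝ) - 2 * (m + 1)) ^ 2 * C, by positivity, fun ε hε φ hφ hc => ?_⟩
    refine (hardy_weighted hε hm hφ hc).trans ?_
    rw [mul_assoc, ← sum_energy_pd m hφ hc]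
    have h1 : ∑ i, ∫ x, pd i φ x ^ 2 * wt ε m x ≤ C * ∑ i, energy m (pd i φ) := by
      rw [Finset.mul_sum]
      exact Finset.sum_le_sum fun i _ => h ε hε _ (contDiff_pd_top hφ i) (hasCompactSupport_pd hc i)
    exact mul_le_mul_of_nonneg_left h1 (by positivity)

/-- A solution whose exponential is dominated by a small multiple of a Hardy weight is stable. -/
theorem exists_isStable_of_le_wt (m : ℕ) (hm : 2 * m < N) : ∃ c : ℝ, 0 < c ∧
    ∀ (ε : ℝ) (u : Space N → ℝ), 0 < ε → Continuous u →
      (∀ x, Real.exp (u x) ≤ c * wt ε m x) → IsStable m u := by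
  obtain ⟨C, hC, h⟩ := hardy_rellich m hm
  refine ⟨C⁻¹, by positivity, fun ε u hε hu hle φ hφ hc => ?_⟩
  have hsqc : HasCompactSupport (fun x => φ x ^ 2) := hasCompactSupport_sq hc
  have h1 := h ε hε φ hφ hc
  have h2 : ∫ x, Real.exp (u x) * φ x ^ 2 ≤ ∫ x, C⁻¹ * (φ x ^ 2 * wt ε m x) := by
    refine integral_mono ?_ ?_ fun x => ?_
    · exact ((Real.continuous_exp.comp hu).mul
        (hφ.continuous.pow 2)).integrable_of_hasCompactSupport hsqc.mul_left
    · exact (((hφ.continuous.pow 2).mul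
        (contDiff_wt (n := 0) hε m).continuous).integrable_of_hasCompactSupport
          hsqc.mul_right).const_mul _
    · have := mul_le_mul_of_nonneg_right (hle x) (sq_nonneg (φ x))
      dsimp only
      linarith
  rw [integral_const_mul] at h2
  have h3 : C⁻¹ * ∫ x, φ x ^ 2 * wt ε m x ≤ energy m φ := by
    rw [inv_mul_le_iff₀ hC]; exact h1
  linarith

/-! ### The radial inverse Laplacian. -/

/-- Differentiating under the integral replaces `F` by `fderiv ℝ F` and `j` by `j + 1`; the
arbitrary exponent and target space are what the induction on `n` needs. -/
theorem contDiff_integral_ray {E : Type} [NormedAddCommGroup E] [NormedSpace ℝ E]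
    [FiniteDimensional ℝ E] (n : ℕ) : ∀ (j : ℕ) {G : Type} [NormedAddCommGroup G]
    [NormedSpace ℝ G] [CompleteSpace G] {F : E → G}, ContDiff ℝ n F →
    ContDiff ℝ n (fun x => ∫ τ in (0 : ℝ)..1, τ ^ j • F (τ • x)) := by
  have : ProperSpace E := FiniteDimensional.proper ℝ E
  induction n with
  | zero =>
    intro j G _ _ _ F hF
    rw [Nat.cast_zero, contDiff_zero] at hF ⊢
    exact intervalIntegral.continuous_parametric_intervalIntegral_of_continuous'
      (by fun_prop) 0 1
  | succ n ih =>
    intro j G _ _ _ F hF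
    have hF' : ContDiff ℝ n (fderiv ℝ F) := hF.fderiv_right (by norm_cast)
    have hd : Differentiable ℝ F := hF.differentiable (by simp)
    have hcF := hF.continuous
    have hcF' := hF'.continuous
    rw [Nat.cast_succ, contDiff_succ_iff_hasFDerivAt]
    refine ⟨fun x => ∫ τ in (0 : ℝ)..1, τ ^ (j + 1) • fderiv ℝ F (τ • x), ih (j + 1) hF', ?_⟩
    intro x
    obtain ⟨C, hC⟩ := (isCompact_closedBall (0 : E) (‖x‖ + 1)).exists_bound_of_continuousOn
      hcF'.continuousOn
    refine intervalIntegral.hasFDerivAt_integral_of_dominated_of_fderiv_le (𝕜 := ℝ)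
      (F := fun y τ => τ ^ j • F (τ • y)) (F' := fun y τ => τ ^ (j + 1) • fderiv ℝ F (τ • y))
      (bound := fun _ => C) (Metric.ball_mem_nhds x one_pos) ?_ ?_ ?_ ?_ ?_ ?_
    · exact Filter.Eventually.of_forall fun y =>
        (Continuous.aestronglyMeasurable (by fun_prop))
    · exact Continuous.intervalIntegrable (by fun_prop) _ _
    · exact Continuous.aestronglyMeasurable (by fun_prop)
    · refine Filter.Eventually.of_forall fun τ hτ y hy => ?_
      rw [Set.uIoc_of_le zero_le_one] at hτ
      have h1 : ‖τ • y‖ ≤ ‖x‖ + 1 := by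
        rw [norm_smul, Real.norm_of_nonneg hτ.1.le]
        have := norm_lt_of_mem_ball hy
        nlinarith [norm_nonneg y, hτ.1, hτ.2]
      have h2 := hC (τ • y) (by simpa using h1)
      rw [norm_smul, norm_pow, Real.norm_of_nonneg hτ.1.le]
      calc τ ^ (j + 1) * ‖fderiv ℝ F (τ • y)‖ ≤ 1 * C :=
            mul_le_mul (pow_le_one₀ hτ.1.le hτ.2) h2 (norm_nonneg _) zero_le_one
        _ = C := one_mul C
    · exact intervalIntegrable_const
    · refine Filter.Eventually.of_forall fun τ _ y _ => ?_
      have h1 : HasFDerivAt (fun y : E => τ • y) (τ • ContinuousLinearMap.id ℝ E) y :=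
        (ContinuousLinearMap.id ℝ E).hasFDerivAt.const_smul τ
      have h2 := ((hd (τ • y)).hasFDerivAt.comp y h1).const_smul (τ ^ j)
      have h3 : τ ^ (j + 1) • fderiv ℝ F (τ • y) =
          τ ^ j • (fderiv ℝ F (τ • y)).comp (τ • ContinuousLinearMap.id ℝ E) := by
        ext v
        simp [pow_succ, mul_smul]
      exact h3 ▸ h2

/-- The weighted average `∫₀¹ τ^{N-1} f(τ s) dτ` of a radial profile. -/
def av (N : ℕ) (f : ℝ → ℝ) (s : ℝ) : ℝ := ∫ τ in (0 : ℝ)..1, τ ^ (N - 1) * f (τ * s)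

/-- The radial inverse Laplacian in dimension `N`, acting on profiles and vanishing at `0`. -/
def invLap (N : ℕ) (f : ℝ → ℝ) (r : ℝ) : ℝ := (1 / 2) * ∫ q in (0 : ℝ)..r ^ 2, av N f (√q)

theorem continuous_av_param {X : Type*} [TopologicalSpace X] {F : X → ℝ → ℝ}
    (hF : Continuous (fun p : X × ℝ => F p.1 p.2)) :
    Continuous (fun p : X × ℝ => av N (F p.1) p.2) := by
  unfold av
  refine intervalIntegral.continuous_parametric_intervalIntegral_of_continuous' ?_ 0 1
  exact (continuous_snd.pow _).mul
    (hF.comp (f := fun q : (X × ℝ) × ℝ => (q.1.1, q.2 * q.1.2)) (by fun_prop))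

theorem continuous_invLap_param {X : Type*} [TopologicalSpace X] {F : X → ℝ → ℝ}
    (hF : Continuous (fun p : X × ℝ => F p.1 p.2)) :
    Continuous (fun p : X × ℝ => invLap N (F p.1) p.2) := by
  unfold invLap
  refine continuous_const.mul ?_
  refine intervalIntegral.continuous_parametric_intervalIntegral_of_continuous
    (f := fun (p : X × ℝ) q => av N (F p.1) (√q)) ?_ (by fun_prop)
  exact (continuous_av_param hF).comp
    (f := fun q : (X × ℝ) × ℝ => (q.1.1, √q.2)) (by fun_prop)

theorem continuous_av {f : ℝ → ℝ} (hf : Continuous f) : Continuous (av N f) :=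
  (continuous_av_param (N := N) (X := Unit) (F := fun _ => f) (by fun_prop)).comp
    (f := fun r : ℝ => ((), r)) (by fun_prop)

theorem continuous_invLap {f : ℝ → ℝ} (hf : Continuous f) : Continuous (invLap N f) :=
  (continuous_invLap_param (N := N) (X := Unit) (F := fun _ => f) (by fun_prop)).comp
    (f := fun r : ℝ => ((), r)) (by fun_prop)

theorem av_integrable {f : ℝ → ℝ} (hf : Continuous f) (s a b : ℝ) :
    IntervalIntegrable (fun τ => τ ^ (N - 1) * f (τ * s)) volume a b :=
  Continuous.intervalIntegrable (by fun_prop) _ _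

theorem av_sqrt_integrable {f : ℝ → ℝ} (hf : Continuous f) (a b : ℝ) :
    IntervalIntegrable (fun q => av N f (√q)) volume a b :=
  ((continuous_av hf).comp Real.continuous_sqrt).intervalIntegrable _ _

@[simp] theorem invLap_zero_right (f : ℝ → ℝ) : invLap N f 0 = 0 := by simp [invLap]

theorem invLap_abs (f : ℝ → ℝ) (r : ℝ) : invLap N f |r| = invLap N f r := by simp [invLap]

theorem av_mono {f g : ℝ → ℝ} (hf : Continuous f) (hg : Continuous g) {s : ℝ} (hs : 0 ≤ s)
    (h : ∀ t, 0 ≤ t → t ≤ s → f t ≤ g t) : av N f s ≤ av N g s := by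
  refine intervalIntegral.integral_mono_on zero_le_one (av_integrable hf s 0 1)
    (av_integrable hg s 0 1) fun τ hτ => ?_
  exact mul_le_mul_of_nonneg_left
    (h _ (mul_nonneg hτ.1 hs) (mul_le_of_le_one_left hs hτ.2)) (pow_nonneg hτ.1 _)

theorem invLap_mono_on {f g : ℝ → ℝ} (hf : Continuous f) (hg : Continuous g) {R : ℝ}
    (h : ∀ t, |t| ≤ R → f t ≤ g t) {r : ℝ} (hr : |r| ≤ R) : invLap N f r ≤ invLap N g r := by
  unfold invLap
  refine mul_le_mul_of_nonneg_left ?_ (by norm_num)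
  refine intervalIntegral.integral_mono_on (sq_nonneg r) (av_sqrt_integrable hf _ _)
    (av_sqrt_integrable hg _ _) fun q hq => ?_
  refine av_mono hf hg (Real.sqrt_nonneg q) fun t ht0 ht => h t ?_
  rw [abs_of_nonneg ht0]
  refine ht.trans (le_trans ?_ hr)
  rw [← Real.sqrt_sq_eq_abs]
  exact Real.sqrt_le_sqrt hq.2

theorem invLap_mono {f g : ℝ → ℝ} (hf : Continuous f) (hg : Continuous g) (h : ∀ t, f t ≤ g t)
    (r : ℝ) : invLap N f r ≤ invLap N g r :=
  invLap_mono_on hf hg (fun t _ => h t) le_rfl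

theorem av_const (hN : 0 < N) (c s : ℝ) : av N (fun _ => c) s = c / N := by
  have h : N - 1 + 1 = N := by omega
  have h' : ((N - 1 : ℕ) : ℝ) + 1 = N := by exact_mod_cast h
  simp [av, integral_pow, h', h, hN.ne']
  field_simp

theorem invLap_const (hN : 0 < N) (c r : ℝ) :
    invLap N (fun _ => c) r = c / (2 * N) * r ^ 2 := by
  simp only [invLap, av_const hN, intervalIntegral.integral_const]
  simp
  field_simp

theorem invLap_add {f g : ℝ → ℝ} (hf : Continuous f) (hg : Continuous g) (r : ℝ) :
    invLap N (fun t => f t + g t) r = invLap N f r + invLap N g r := by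
  have h : ∀ s, av N (fun t => f t + g t) s = av N f s + av N g s := fun s => by
    unfold av
    rw [← intervalIntegral.integral_add (av_integrable hf s 0 1) (av_integrable hg s 0 1)]
    simp_rw [mul_add]
  unfold invLap
  simp_rw [h]
  rw [intervalIntegral.integral_add (av_sqrt_integrable hf _ _) (av_sqrt_integrable hg _ _),
    mul_add]

theorem invLap_const_mul (c : ℝ) (f : ℝ → ℝ) (r : ℝ) :
    invLap N (fun t => c * f t) r = c * invLap N f r := by
  have h : ∀ s, av N (fun t => c * f t) s = c * av N f s := fun s => by
    unfold av
    rw [← intervalIntegral.integral_const_mul]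
    simp_rw [mul_left_comm]
  unfold invLap
  simp_rw [h]
  rw [intervalIntegral.integral_const_mul, mul_left_comm]

theorem pow_mul_av (hN : 0 < N) (f : ℝ → ℝ) (s : ℝ) :
    s ^ N * av N f s = ∫ t in (0 : ℝ)..s, t ^ (N - 1) * f t := by
  obtain ⟨n, rfl⟩ : ∃ n, N = n + 1 := ⟨N - 1, by omega⟩
  have h := intervalIntegral.mul_integral_comp_mul_right (a := 0) (b := 1)
    (f := fun t => t ^ n * f t) s
  simp only [Nat.add_sub_cancel, zero_mul, one_mul, av] at h ⊢
  rw [← h, pow_succ, mul_assoc, mul_left_comm, ← intervalIntegral.integral_const_mul]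
  congr 1
  refine intervalIntegral.integral_congr fun τ _ => ?_
  ring

theorem hasDerivAt_invLap {f : ℝ → ℝ} (hf : Continuous f) (r : ℝ) :
    HasDerivAt (invLap N f) (r * av N f |r|) r := by
  have hc : Continuous fun q => av N f (√q) := (continuous_av hf).comp Real.continuous_sqrt
  have h1 : HasDerivAt (fun u => ∫ q in (0 : ℝ)..u, av N f (√q)) (av N f (√(r ^ 2))) (r ^ 2) :=
    intervalIntegral.integral_hasDerivAt_right (hc.intervalIntegrable _ _)
      (hc.stronglyMeasurableAtFilter _ _) hc.continuousAt
  have h0 : HasDerivAt (fun t : ℝ => t ^ 2) (2 * r) r := by simpa using hasDerivAt_pow 2 r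
  have h2 := (HasDerivAt.comp (h := fun t : ℝ => t ^ 2) r h1 h0).const_mul (1 / 2)
  rw [Real.sqrt_sq_eq_abs] at h2
  have h3 : 1 / 2 * (av N f |r| * (2 * r)) = r * av N f |r| := by ring
  exact h3 ▸ h2

/-- `invLap` is an integral up to `r ^ 2`, so only the smooth function `‖y‖ ^ 2` is differentiated
and the origin needs no separate treatment. -/
theorem hasFDerivAt_invLap_norm {f : ℝ → ℝ} (hf : Continuous f) (x : Space N) :
    HasFDerivAt (fun y : Space N => invLap N f ‖y‖) (av N f ‖x‖ • innerSL ℝ x) x := by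
  have hc : Continuous fun q => av N f (√q) := (continuous_av hf).comp Real.continuous_sqrt
  have h1 : HasDerivAt (fun u => ∫ q in (0 : ℝ)..u, av N f (√q)) (av N f (√(‖x‖ ^ 2)))
      (‖x‖ ^ 2) :=
    intervalIntegral.integral_hasDerivAt_right (hc.intervalIntegrable _ _)
      (hc.stronglyMeasurableAtFilter _ _) hc.continuousAt
  have h2 := (h1.comp_hasFDerivAt x (hasStrictFDerivAt_norm_sq x).hasFDerivAt).const_mul (1 / 2)
  rw [Real.sqrt_sq (norm_nonneg x)] at h2
  have h3 : av N f ‖x‖ • innerSL ℝ x = (1 / 2 : ℝ) • av N f ‖x‖ • 2 • innerSL ℝ x := by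
    ext v
    simp
    ring
  exact h3 ▸ h2

theorem av_norm (f : ℝ → ℝ) (x : Space N) :
    av N f ‖x‖ = ∫ τ in (0 : ℝ)..1, τ ^ (N - 1) • (fun y : Space N => f ‖y‖) (τ • x) := by
  refine intervalIntegral.integral_congr fun τ hτ => ?_
  rw [Set.uIcc_of_le zero_le_one] at hτ
  simp [norm_smul, abs_of_nonneg hτ.1]

theorem contDiff_av_norm {f : ℝ → ℝ} {n : ℕ} (hf : ContDiff ℝ n (fun x : Space N => f ‖x‖)) :
    ContDiff ℝ n (fun x : Space N => av N f ‖x‖) := by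
  simp_rw [av_norm]
  exact contDiff_integral_ray n (N - 1) hf

/-- The gradient is `av N f ‖x‖ • x`, and the average is as smooth as `f ‖x‖`; this gain of one
derivative drives the later bootstrap. -/
theorem contDiff_invLap_norm {f : ℝ → ℝ} (hc : Continuous f) {n : ℕ}
    (hf : ContDiff ℝ n (fun x : Space N => f ‖x‖)) :
    ContDiff ℝ (n + 1) (fun x : Space N => invLap N f ‖x‖) := by
  rw [contDiff_succ_iff_hasFDerivAt]
  exact ⟨_, (contDiff_av_norm hf).smul (innerSL ℝ : Space N →L[ℝ] _).contDiff,
    hasFDerivAt_invLap_norm hc⟩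

/-- With `A x = av N f ‖x‖`, the divergence of `A x • x` is `N A + x · ∇A`, which is the derivative
of `s ^ N * A (s x)` at `s = 1`. That function is also `∫₀ˢ t^{N-1} f (t ‖x‖) dt`, with derivative
`f ‖x‖`. -/
theorem laplacian_invLap_norm (hN : 0 < N) {f : ℝ → ℝ} (hc : Continuous f)
    (hf : ContDiff ℝ 1 (fun x : Space N => f ‖x‖)) (x : Space N) :
    (Laplacian.laplacian (fun y : Space N => invLap N f ‖y‖) : Space N → ℝ) x = f ‖x‖ := by
  have hf' : ContDiff ℝ (1 : ℕ) (fun x : Space N => f ‖x‖) := by exact_mod_cast hf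
  have h2 : ContDiff ℝ 2 (fun x : Space N => invLap N f ‖x‖) := by
    have := contDiff_invLap_norm hc hf'
    rwa [Nat.cast_one, one_add_one_eq_two] at this
  have hA : ContDiff ℝ 1 (fun x : Space N => av N f ‖x‖) := by
    exact_mod_cast contDiff_av_norm hf'
  have hAd := hA.differentiable (by simp)
  have hpd : ∀ i, pd i (fun y : Space N => invLap N f ‖y‖) = fun y => av N f ‖y‖ * y i := by
    intro i
    ext y
    unfold pd
    rw [(hasFDerivAt_invLap_norm hc y).fderiv]
    simp [EuclideanSpace.inner_single_right]
  have hpd2 : ∀ i, pd i (fun y : Space N => av N f ‖y‖ * y i) x =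
      av N f ‖x‖ + x i * fderiv ℝ (fun y : Space N => av N f ‖y‖) x
        (EuclideanSpace.single i 1) := by
    intro i
    have h1 : HasFDerivAt (fun y : Space N => y i) (EuclideanSpace.proj i : Space N →L[ℝ] ℝ) x :=
      (EuclideanSpace.proj i : Space N →L[ℝ] ℝ).hasFDerivAt
    have h5 : pd i (fun y => av N f ‖y‖ * y i) x = _ :=
      congrArg (fun L => L (EuclideanSpace.single i 1)) ((hAd x).hasFDerivAt.mul h1).fderiv
    rw [h5]
    simp
  rw [laplacian_eq_sum_pd h2]
  simp only [hpd, hpd2, Finset.sum_add_distrib, Finset.sum_const, Finset.card_univ,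
    Fintype.card_fin, nsmul_eq_mul]
  have hx : ∑ i, x i * fderiv ℝ (fun y : Space N => av N f ‖y‖) x (EuclideanSpace.single i 1) =
      fderiv ℝ (fun y : Space N => av N f ‖y‖) x x := by
    generalize fderiv ℝ (fun y : Space N => av N f ‖y‖) x = L
    conv_rhs => rw [← (EuclideanSpace.basisFun (Fin N) ℝ).sum_repr x]
    rw [map_sum]
    simp
  rw [hx]
  have hd1 : HasDerivAt (fun s : ℝ => s ^ N * av N f ‖s • x‖)
      (N * av N f ‖x‖ + fderiv ℝ (fun y : Space N => av N f ‖y‖) x x) 1 := by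
    have hline : HasDerivAt (fun s : ℝ => s • x) x 1 := by
      simpa using (hasDerivAt_id (1 : ℝ)).smul_const x
    have h3 := (hAd ((1 : ℝ) • x)).hasFDerivAt.comp_hasDerivAt (1 : ℝ) hline
    have h4 := (hasDerivAt_pow N (1 : ℝ)).mul h3
    simp only [one_pow, mul_one, one_smul, one_mul, Function.comp_apply] at h4
    exact h4
  have hd2 : HasDerivAt (fun s : ℝ => s ^ N * av N f ‖s • x‖) (f ‖x‖) 1 := by
    have hcont : Continuous fun t : ℝ => t ^ (N - 1) * f (t * ‖x‖) := by fun_prop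
    have h1 : HasDerivAt (fun s : ℝ => ∫ t in (0 : ℝ)..s, t ^ (N - 1) * f (t * ‖x‖))
        (1 ^ (N - 1) * f (1 * ‖x‖)) 1 :=
      intervalIntegral.integral_hasDerivAt_right (hcont.intervalIntegrable _ _)
        (hcont.stronglyMeasurableAtFilter _ _) hcont.continuousAt
    simp only [one_pow, one_mul] at h1
    refine h1.congr_of_eventuallyEq ?_
    filter_upwards [lt_mem_nhds (zero_lt_one (α := ℝ))] with s hs
    have h2 := pow_mul_av hN (fun t => f (t * ‖x‖)) s
    rw [← h2]
    congr 1
    unfold av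
    refine intervalIntegral.integral_congr fun τ _ => ?_
    simp only [norm_smul, Real.norm_of_nonneg hs.le]
    ring_nf
  exact hd1.unique hd2

/-! ### Iterated inverse Laplacians and the integral equation. -/

/-- `a 0 + K (a 1 + K (⋯ K (a (m-1) + K g)))` where `K` is the radial inverse Laplacian. -/
def nest (N : ℕ) : ℕ → (ℕ → ℝ) → (ℝ → ℝ) → ℝ → ℝ
  | 0, _, g => g
  | m + 1, a, g => fun r => a 0 + invLap N (nest N m (fun k => a (k + 1)) g) r

theorem nest_succ (m : ℕ) (a : ℕ → ℝ) (g : ℝ → ℝ) (r : ℝ) :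
    nest N (m + 1) a g r = a 0 + invLap N (nest N m (fun k => a (k + 1)) g) r := rfl

/-- Joint continuity in data and radius is used to let the top datum tend to the threshold in a
fixed Picard iterate. -/
theorem continuous_nest_param {X : Type*} [TopologicalSpace X] (m : ℕ) {a : X → ℕ → ℝ}
    (ha : ∀ k, Continuous fun p => a p k) {g : X → ℝ → ℝ}
    (hg : Continuous (fun p : X × ℝ => g p.1 p.2)) :
    Continuous (fun p : X × ℝ => nest N m (a p.1) (g p.1) p.2) := by
  induction m generalizing a with
  | zero => exact hg
  | succ m ih =>
    exact ((ha 0).comp continuous_fst).add (continuous_invLap_param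
      (F := fun p => nest N m (fun k => a p (k + 1)) (g p))
      (ih (a := fun p k => a p (k + 1)) fun k => ha (k + 1)))

theorem continuous_nest (m : ℕ) (a : ℕ → ℝ) {g : ℝ → ℝ} (hg : Continuous g) :
    Continuous (nest N m a g) := by
  induction m generalizing a with
  | zero => exact hg
  | succ m ih => exact continuous_const.add (continuous_invLap (ih _))

theorem nest_mono_on (m : ℕ) {a b : ℕ → ℝ} (hab : ∀ k < m, a k ≤ b k) {f g : ℝ → ℝ}
    (hf : Continuous f) (hg : Continuous g) {R : ℝ} (h : ∀ t, |t| ≤ R → f t ≤ g t) :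
    ∀ r, |r| ≤ R → nest N m a f r ≤ nest N m b g r := by
  induction m generalizing a b with
  | zero => exact h
  | succ m ih =>
    intro r hr
    exact add_le_add (hab 0 (by omega)) (invLap_mono_on (continuous_nest m _ hf)
      (continuous_nest m _ hg) (ih fun k hk => hab (k + 1) (by omega)) hr)

theorem nest_mono (m : ℕ) {a b : ℕ → ℝ} (hab : ∀ k < m, a k ≤ b k) {f g : ℝ → ℝ}
    (hf : Continuous f) (hg : Continuous g) (h : ∀ t, f t ≤ g t) (r : ℝ) :
    nest N m a f r ≤ nest N m b g r :=
  nest_mono_on m hab hf hg (fun t _ => h t) r le_rfl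

theorem nest_congr (m : ℕ) {a b : ℕ → ℝ} (hab : ∀ k < m, a k = b k) (g : ℝ → ℝ) :
    nest N m a g = nest N m b g := by
  induction m generalizing a b with
  | zero => rfl
  | succ m ih =>
    ext r
    rw [nest_succ, nest_succ, hab 0 (by omega), ih fun k hk => hab (k + 1) (by omega)]

theorem nest_at_zero {m : ℕ} (hm : 0 < m) (a : ℕ → ℝ) (g : ℝ → ℝ) : nest N m a g 0 = a 0 := by
  obtain ⟨m, rfl⟩ : ∃ k, m = k + 1 := ⟨m - 1, by omega⟩
  simp [nest_succ]

theorem contDiff_nest_norm (m : ℕ) (a : ℕ → ℝ) {g : ℝ → ℝ} (hc : Continuous g) {n : ℕ}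
    (hg : ContDiff ℝ n (fun x : Space N => g ‖x‖)) :
    ContDiff ℝ n (fun x : Space N => nest N m a g ‖x‖) := by
  induction m generalizing a with
  | zero => exact hg
  | succ m ih =>
    exact contDiff_const.add ((contDiff_invLap_norm (continuous_nest m _ hc) (ih _)).of_le
      (by exact_mod_cast Nat.le_succ n))

theorem contDiff_nest_norm_succ {m : ℕ} (hm : 0 < m) (a : ℕ → ℝ) {g : ℝ → ℝ} (hc : Continuous g)
    {n : ℕ} (hg : ContDiff ℝ n (fun x : Space N => g ‖x‖)) :
    ContDiff ℝ (n + 1 : ℕ) (fun x : Space N => nest N m a g ‖x‖) := by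
  obtain ⟨m, rfl⟩ : ∃ k, m = k + 1 := ⟨m - 1, by omega⟩
  exact contDiff_const.add (contDiff_invLap_norm (continuous_nest m _ hc)
    (contDiff_nest_norm m _ hc hg))

theorem laplacian_const_add {f : Space N → ℝ} (hf : ContDiff ℝ 2 f) (c : ℝ) :
    (Laplacian.laplacian (fun x => c + f x) : Space N → ℝ) = Laplacian.laplacian f := by
  have h : ∀ i, pd i (fun x => c + f x) = pd i f := fun i => by
    ext x; simp [pd, fderiv_const_add]
  rw [laplacian_eq_sum_pd hf, laplacian_eq_sum_pd (contDiff_const.add hf)]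
  simp_rw [h]

theorem iterLap_nest_norm (hN : 0 < N) (k j : ℕ) (a : ℕ → ℝ) {g : ℝ → ℝ} (hc : Continuous g)
    (hg : ∀ n : ℕ, ContDiff ℝ n (fun x : Space N => g ‖x‖)) :
    iterLap k (fun x : Space N => nest N (k + j) a g ‖x‖) =
      fun x => nest N j (fun i => a (i + k)) g ‖x‖ := by
  induction k generalizing a with
  | zero => simp [iterLap_zero]
  | succ k ih =>
    have e : k + 1 + j = (k + j) + 1 := by omega
    have h2 : ContDiff ℝ 2 (fun x : Space N =>
        invLap N (nest N (k + j) (fun k => a (k + 1)) g) ‖x‖) := by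
      have := contDiff_invLap_norm (continuous_nest (k + j) (fun k => a (k + 1)) hc)
        (contDiff_nest_norm (k + j) (fun k => a (k + 1)) hc (hg 1))
      rwa [Nat.cast_one, one_add_one_eq_two] at this
    rw [iterLap_succ, e]
    simp_rw [nest_succ]
    rw [laplacian_const_add h2]
    have h3 : (Laplacian.laplacian (fun x : Space N =>
        invLap N (nest N (k + j) (fun k => a (k + 1)) g) ‖x‖) : Space N → ℝ) =
        fun x => nest N (k + j) (fun k => a (k + 1)) g ‖x‖ :=
      funext fun x => laplacian_invLap_norm hN (continuous_nest _ _ hc)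
        (by exact_mod_cast contDiff_nest_norm (k + j) _ hc (hg 1)) x
    rw [h3, ih]
    ext x
    simp [add_assoc]

/-- `f` is the profile of an entire radial solution of `Δ^m u = e^u` with data `Δ^k u(0) = a k`. -/
def IsProfile (N m : ℕ) (a : ℕ → ℝ) (f : ℝ → ℝ) : Prop :=
  Continuous f ∧ ∀ r, f r = nest N m a (fun t => Real.exp (f t)) r

/-- Bootstrap: `f` is a nest of `exp ∘ f`, and one application of the inverse Laplacian already
raises the regularity by one. -/
theorem IsProfile.contDiff {m : ℕ} (hm : 0 < m) {a : ℕ → ℝ} {f : ℝ → ℝ}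
    (h : IsProfile N m a f) (n : ℕ) : ContDiff ℝ n (fun x : Space N => f ‖x‖) := by
  have hfc := h.1
  induction n with
  | zero =>
    rw [Nat.cast_zero, contDiff_zero]
    exact h.1.comp continuous_norm
  | succ n ih =>
    have := contDiff_nest_norm_succ hm a (g := fun t => Real.exp (f t)) (by fun_prop) ih.exp
    simpa only [← h.2] using this

theorem IsProfile.iterLap {m : ℕ} (hm : 0 < m) (hN : 0 < N) {a : ℕ → ℝ} {f : ℝ → ℝ}
    (h : IsProfile N m a f) {k j : ℕ} (hk : k + j = m) :
    iterLap k (fun x : Space N => f ‖x‖) =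
      fun x => nest N j (fun i => a (i + k)) (fun t => Real.exp (f t)) ‖x‖ := by
  have hfc := h.1
  have := iterLap_nest_norm hN k j a (g := fun t => Real.exp (f t)) (by fun_prop)
    fun n => (h.contDiff hm n).exp
  rw [hk] at this
  simpa only [← h.2] using this

theorem IsProfile.isEntireSolution {m : ℕ} (hm : 0 < m) (hev : Even m) (hN : 0 < N) {a : ℕ → ℝ}
    {f : ℝ → ℝ} (h : IsProfile N m a f) :
    IsEntireSolution m (fun x : Space N => f ‖x‖) := by
  refine ⟨contDiff_infty.2 fun n => h.contDiff hm n, fun x => ?_⟩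
  rw [h.iterLap hm hN (add_zero m), hev.neg_one_pow, one_mul]
  rfl

theorem IsProfile.iterLap_at_zero {m : ℕ} (hN : 0 < N) {a : ℕ → ℝ}
    {f : ℝ → ℝ} (h : IsProfile N m a f) {k : ℕ} (hk : k < m) :
    Polyharmonic.iterLap k (fun x : Space N => f ‖x‖) 0 = a k := by
  rw [h.iterLap (by omega) hN (k := k) (j := m - k) (by omega)]
  simp only [norm_zero]
  rw [nest_at_zero (by omega), zero_add]

/-! ### Smooth radial solutions satisfy the integral equation. -/

theorem laplacian_radial {w : Space N → ℝ} (hw : ContDiff ℝ 2 w) {f : ℝ → ℝ}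
    (hf : ContDiff ℝ 2 f) (hr : ∀ x, w x = f ‖x‖) {x : Space N} (hx : x ≠ 0) :
    (Laplacian.laplacian w : Space N → ℝ) x =
      N * (deriv f ‖x‖ / ‖x‖) + ‖x‖ * deriv (fun r => deriv f r / r) ‖x‖ := by
  have hnx : ‖x‖ ≠ 0 := norm_ne_zero_iff.2 hx
  have hfd : Differentiable ℝ f := hf.differentiable (by simp)
  have hfd' : Differentiable ℝ (deriv f) :=
    (((contDiff_succ_iff_deriv (n := 1)).1 (by rwa [one_add_one_eq_two])).2.2).differentiable
      (by simp)
  have hnorm : ∀ y : Space N, y ≠ 0 →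
      HasFDerivAt (fun y : Space N => ‖y‖) (‖y‖⁻¹ • innerSL ℝ y) y := by
    intro y hy
    have h1 : HasFDerivAt (fun z : Space N => √(‖z‖ ^ 2))
        ((1 / (2 * √(‖y‖ ^ 2))) • (2 • innerSL ℝ y)) y :=
      (hasStrictFDerivAt_norm_sq y).hasFDerivAt.sqrt (by simpa using hy)
    simp only [Real.sqrt_sq (norm_nonneg _)] at h1
    have h2 : ‖y‖⁻¹ • innerSL ℝ y = (1 / (2 * ‖y‖)) • (2 • innerSL ℝ y) := by
      ext v
      simp
      ring
    rw [h2]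
    exact h1
  have hpd : ∀ i (y : Space N), y ≠ 0 → pd i w y = y i * (deriv f ‖y‖ / ‖y‖) := by
    intro i y hy
    have h1 := (hfd ‖y‖).hasDerivAt.comp_hasFDerivAt y (hnorm y hy)
    have h2 : w = f ∘ fun y : Space N => ‖y‖ := funext hr
    have h5 : pd i w y = _ := congrArg (fun L => L (EuclideanSpace.single i 1)) (h2 ▸ h1).fderiv
    rw [h5]
    simp [EuclideanSpace.inner_single_right]
    ring
  have hh : HasDerivAt (fun r => deriv f r / r) (deriv (fun r => deriv f r / r) ‖x‖) ‖x‖ :=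
    ((hfd' ‖x‖).div differentiableAt_id hnx).hasDerivAt
  have hpd2 : ∀ i, pd i (pd i w) x = deriv f ‖x‖ / ‖x‖ +
      x i ^ 2 * (‖x‖⁻¹ * deriv (fun r => deriv f r / r) ‖x‖) := by
    intro i
    have h1 : HasFDerivAt (fun y : Space N => y i) (EuclideanSpace.proj i : Space N →L[ℝ] ℝ) x :=
      (EuclideanSpace.proj i : Space N →L[ℝ] ℝ).hasFDerivAt
    have h2 := h1.mul (hh.comp_hasFDerivAt x (hnorm x hx))
    have h3 : pd i w =ᶠ[nhds x] fun y => y i * (deriv f ‖y‖ / ‖y‖) := by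
      filter_upwards [isOpen_ne.mem_nhds hx] with y hy using hpd i y hy
    have h5 : pd i (pd i w) x = _ := congrArg (fun L => L (EuclideanSpace.single i 1))
      (h2.congr_of_eventuallyEq h3).fderiv
    rw [h5]
    simp [EuclideanSpace.inner_single_right]
    ring
  rw [laplacian_eq_sum_pd hw]
  have hs : ∑ i, x i ^ 2 = ‖x‖ ^ 2 := by
    rw [EuclideanSpace.norm_sq_eq]; simp
  simp only [hpd2, Finset.sum_add_distrib, ← Finset.sum_mul, hs, Finset.sum_const,
    Finset.card_univ, Fintype.card_fin, nsmul_eq_mul]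
  field_simp

/-- The flux `r^{N-1} f'` has zero derivative for `r > 0` and vanishes at `0`, where `N ≥ 2` is
used. -/
theorem const_of_radial_harmonic (hN : 2 ≤ N) {w : Space N → ℝ} (hw : ContDiff ℝ 2 w) {f : ℝ → ℝ}
    (hf : ContDiff ℝ 2 f) (hr : ∀ x, w x = f ‖x‖)
    (h0 : ∀ x, (Laplacian.laplacian w : Space N → ℝ) x = 0) {r : ℝ} (hr0 : 0 ≤ r) :
    f r = f 0 := by
  have hfd : Differentiable ℝ f := hf.differentiable (by simp)
  have hfd'C : ContDiff ℝ 1 (deriv f) :=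
    ((contDiff_succ_iff_deriv (n := 1)).1 (by rwa [one_add_one_eq_two])).2.2
  have hfd' : Differentiable ℝ (deriv f) := hfd'C.differentiable (by simp)
  have hcont : Continuous fun r => r ^ (N - 1) * deriv f r := by
    have := hfd'C.continuous
    fun_prop
  have hder : ∀ r > 0, HasDerivAt (fun r => r ^ (N - 1) * deriv f r) 0 r := by
    intro r hr'
    have hh : HasDerivAt (fun r => deriv f r / r) (deriv (fun r => deriv f r / r) r) r :=
      ((hfd' r).div differentiableAt_id hr'.ne').hasDerivAt
    have h1 := (hasDerivAt_pow N r).mul hh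
    let x : Space N := EuclideanSpace.single ⟨0, by omega⟩ r
    have hx : ‖x‖ = r := by simp [x, abs_of_pos hr']
    have hl := laplacian_radial hw hf hr (x := x) (by rw [← norm_ne_zero_iff, hx]; exact hr'.ne')
    rw [h0, hx] at hl
    have h2 : N * r ^ (N - 1) * (deriv f r / r) + r ^ N * deriv (fun r => deriv f r / r) r = 0 := by
      have : r ^ N = r ^ (N - 1) * r := by rw [← pow_succ]; congr 1; omega
      rw [this]
      linear_combination (-r ^ (N - 1)) * hl
    have h3 : (fun r => r ^ (N - 1) * deriv f r) =ᶠ[nhds r] fun r => r ^ N * (deriv f r / r) := by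
      filter_upwards [lt_mem_nhds hr'] with s hs
      have : s ^ N = s ^ (N - 1) * s := by rw [← pow_succ]; congr 1; omega
      rw [this]
      have := hs.ne'
      field_simp
    have h4 := h1.congr_of_eventuallyEq h3
    simp only [h2] at h4
    exact h4
  have hz : ∀ r > 0, deriv f r = 0 := by
    intro r hr'
    obtain ⟨c, hc, he⟩ := exists_hasDerivAt_eq_slope (fun r => r ^ (N - 1) * deriv f r)
      (fun _ => 0) hr' hcont.continuousOn fun s hs => hder s hs.1
    have hp : (0 : ℝ) ^ (N - 1) = 0 := zero_pow (by omega)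
    rw [hp, zero_mul, sub_zero, sub_zero, eq_comm, div_eq_zero_iff] at he
    rcases he with he | he
    · rcases mul_eq_zero.1 he with h | h
      · exact absurd h (pow_ne_zero _ hr'.ne')
      · exact h
    · exact absurd he hr'.ne'
  rcases hr0.eq_or_lt with rfl | hr'
  · rfl
  · obtain ⟨c, hc, he⟩ := exists_deriv_eq_slope f hr' hfd.continuous.continuousOn
      hfd.differentiableOn
    rw [hz c hc.1, eq_comm, div_eq_zero_iff] at he
    rcases he with he | he <;> linarith

/-- Subtracting the radial inverse of `Δw` leaves a radial harmonic function, hence a constant. -/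
theorem radial_repr (hN : 2 ≤ N) {w : Space N → ℝ}
    (hw : ContDiff ℝ ((⊤ : ℕ∞) : WithTop ℕ∞) w) {f : ℝ → ℝ}
    (hf : ContDiff ℝ ((⊤ : ℕ∞) : WithTop ℕ∞) f) (hr : ∀ x, w x = f ‖x‖) :
    ∃ g : ℝ → ℝ, ContDiff ℝ ((⊤ : ℕ∞) : WithTop ℕ∞) g ∧
      (∀ x, (Laplacian.laplacian w : Space N → ℝ) x = g ‖x‖) ∧
      ∀ r, 0 ≤ r → f r = f 0 + invLap N g r := by
  have le2 : (2 : WithTop ℕ∞) ≤ ((⊤ : ℕ∞) : WithTop ℕ∞) := WithTop.coe_le_coe.2 le_top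
  -- Restricting to a line through the origin produces a profile of `Δw` that is smooth on all of
  -- `ℝ`.
  let e : ℝ →L[ℝ] Space N := ContinuousLinearMap.toSpanSingleton ℝ
    (EuclideanSpace.single ⟨0, by omega⟩ 1)
  have hen : ∀ r, ‖e r‖ = |r| := fun r => by simp [e, norm_smul]
  let g : ℝ → ℝ := fun r => (Laplacian.laplacian w : Space N → ℝ) (e r)
  have hlw := contDiff_laplacian_top hw
  have hg : ContDiff ℝ ((⊤ : ℕ∞) : WithTop ℕ∞) g := hlw.comp e.contDiff
  have hgr : ∀ x, (Laplacian.laplacian w : Space N → ℝ) x = g ‖x‖ := by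
    intro x
    by_cases hx : x = 0
    · subst hx
      simp [g]
    · have hx' : e ‖x‖ ≠ 0 := by
        rw [← norm_ne_zero_iff, hen]; simpa using hx
      have h1 := laplacian_radial (hw.of_le le2) (hf.of_le le2) hr hx
      have h2 := laplacian_radial (hw.of_le le2) (hf.of_le le2) hr hx'
      rw [hen, abs_norm] at h2
      exact h1.trans h2.symm
  refine ⟨g, hg, hgr, ?_⟩
  have hgn : ContDiff ℝ 1 (fun x : Space N => g ‖x‖) := by
    simp_rw [← hgr]; exact hlw.of_le (by simp)
  have hK : ContDiff ℝ 2 (fun x : Space N => invLap N g ‖x‖) := by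
    have := contDiff_invLap_norm (n := 1) hg.continuous (by exact_mod_cast hgn)
    rwa [Nat.cast_one, one_add_one_eq_two] at this
  have hK1 : ContDiff ℝ 2 (invLap N g) := by
    have := hK.comp (e.contDiff (n := 2))
    simpa [Function.comp_def, hen, invLap_abs] using this
  intro r hr0
  have hz := const_of_radial_harmonic hN (w := w - fun x => invLap N g ‖x‖)
    (f := fun r => f r - invLap N g r) ((hw.of_le le2).sub hK) ((hf.of_le le2).sub hK1)
    (fun x => by simp [hr]) (fun x => ?_) hr0
  · simp only [invLap_zero_right, sub_zero] at hz
    linarith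
  · rw [ContDiffAt.laplacian_sub (hw.of_le le2).contDiffAt hK.contDiffAt,
      laplacian_invLap_norm (by omega) hg.continuous hgn, hgr, sub_self]

theorem nest_repr (hN : 2 ≤ N) (m : ℕ) {w : Space N → ℝ}
    (hw : ContDiff ℝ ((⊤ : ℕ∞) : WithTop ℕ∞) w) {f : ℝ → ℝ}
    (hf : ContDiff ℝ ((⊤ : ℕ∞) : WithTop ℕ∞) f) (hr : ∀ x, w x = f ‖x‖) :
    ∃ g : ℝ → ℝ, Continuous g ∧ (∀ x, iterLap m w x = g ‖x‖) ∧
      ∀ r, 0 ≤ r → f r = nest N m (fun k => iterLap k w 0) g r := by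
  induction m generalizing w f with
  | zero => exact ⟨f, hf.continuous, hr, fun r _ => rfl⟩
  | succ m ih =>
    obtain ⟨g, hg, hgr, hfg⟩ := radial_repr hN hw hf hr
    obtain ⟨q, hq, hqr, hgq⟩ := ih (contDiff_laplacian_top hw) hg hgr
    refine ⟨q, hq, hqr, fun r hr0 => ?_⟩
    have h0 : iterLap 0 w 0 = f 0 := by rw [iterLap_zero, hr, norm_zero]
    have hc := continuous_nest (N := N) m
      (fun k => iterLap k (Laplacian.laplacian w : Space N → ℝ) 0) hq
    rw [nest_succ, h0, hfg r hr0]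
    congr 1
    simp only [iterLap_succ]
    unfold invLap
    congr 1
    refine intervalIntegral.integral_congr fun s _ => ?_
    refine intervalIntegral.integral_congr fun τ hτ => ?_
    rw [Set.uIcc_of_le zero_le_one] at hτ
    simp only [hgq _ (mul_nonneg hτ.1 (Real.sqrt_nonneg s))]

theorem exists_isProfile (hN : 2 ≤ N) {m : ℕ} (hm : 0 < m) (hev : Even m) {u : Space N → ℝ}
    (hu : IsEntireSolution m u) (hr : IsRadialAbout 0 u) :
    ∃ f, IsProfile N m (fun k => iterLap k u 0) f ∧ ∀ x, u x = f ‖x‖ := by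
  obtain ⟨f₀, hf₀⟩ := hr
  let e : ℝ →L[ℝ] Space N := ContinuousLinearMap.toSpanSingleton ℝ
    (EuclideanSpace.single ⟨0, by omega⟩ 1)
  have hen : ∀ r, ‖e r‖ = |r| := fun r => by simp [e, norm_smul]
  let f : ℝ → ℝ := fun r => u (e r)
  have hf : ContDiff ℝ ((⊤ : ℕ∞) : WithTop ℕ∞) f := hu.1.comp e.contDiff
  have hfr : ∀ x, u x = f ‖x‖ := fun x => by simp [f, hf₀, hen]
  have heven : ∀ r, f |r| = f r := fun r => by simp [f, hf₀, hen]
  obtain ⟨g, hg, hgr, hfg⟩ := nest_repr hN m hu.1 hf hfr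
  have hge : ∀ r, 0 ≤ r → g r = Real.exp (f r) := by
    intro r hr0
    have h1 := hu.2 (e r)
    rw [hev.neg_one_pow, one_mul, hgr, hen, abs_of_nonneg hr0] at h1
    exact h1
  refine ⟨f, ⟨hf.continuous, fun r => ?_⟩, hfr⟩
  have hcexp : Continuous fun t => Real.exp (f t) := Real.continuous_exp.comp hf.continuous
  have hge' : Continuous fun t => g |t| := hg.comp continuous_abs
  -- `g` is known to equal `exp ∘ f` only on `r ≥ 0`; this suffices because `invLap` samples its
  -- argument only at nonnegative points.
  have key : ∀ (j : ℕ) (a : ℕ → ℝ) (r : ℝ), 0 ≤ r →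
      nest N j a g r = nest N j a (fun t => Real.exp (f t)) r := by
    intro j
    induction j with
    | zero => intro a r hr0; exact hge r hr0
    | succ j ih =>
      intro a r hr0
      rw [nest_succ, nest_succ]
      congr 1
      unfold invLap
      congr 1
      refine intervalIntegral.integral_congr fun s _ => ?_
      refine intervalIntegral.integral_congr fun τ hτ => ?_
      rw [Set.uIcc_of_le zero_le_one] at hτ
      simp only [ih _ _ (mul_nonneg hτ.1 (Real.sqrt_nonneg s))]
  rw [← heven, hfg _ (abs_nonneg r), key _ _ _ (abs_nonneg r)]
  obtain ⟨m, rfl⟩ : ∃ k, m = k + 1 := ⟨m - 1, by omega⟩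
  rw [nest_succ, nest_succ, invLap_abs]

/-! ### Local bounds and passage to the limit. -/

theorem abs_av_le (hN : 0 < N) {f : ℝ → ℝ} (hf : Continuous f) {B s : ℝ} (hs : 0 ≤ s)
    (h : ∀ t, 0 ≤ t → t ≤ s → |f t| ≤ B) : |av N f s| ≤ B := by
  have hB : 0 ≤ B := (abs_nonneg _).trans (h 0 le_rfl hs)
  have hN1 : (1 : ℝ) ≤ N := by exact_mod_cast hN
  have h1 := av_mono (N := N) hf continuous_const hs fun t h0 h1 => (abs_le.1 (h t h0 h1)).2
  have h2 := av_mono (N := N) continuous_const hf hs fun t h0 h1 => (abs_le.1 (h t h0 h1)).1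
  rw [av_const hN] at h1 h2
  have h3 : B / N ≤ B := div_le_self hB hN1
  rw [neg_div] at h2
  exact abs_le.2 ⟨by linarith, by linarith⟩

/-- A modulus of continuity depending only on a bound for `f`: it makes pointwise limits continuous
in `continuous_of_tendsto_invLap`. -/
theorem abs_invLap_sub_le (hN : 0 < N) {f : ℝ → ℝ} (hf : Continuous f) {B R : ℝ}
    (h : ∀ t, |t| ≤ R → |f t| ≤ B) {r s : ℝ} (hr : |r| ≤ R) (hs : |s| ≤ R) :
    |invLap N f r - invLap N f s| ≤ 1 / 2 * (B * |r ^ 2 - s ^ 2|) := by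
  have h1 : invLap N f r - invLap N f s = 1 / 2 * ∫ q in s ^ 2..r ^ 2, av N f (√q) := by
    unfold invLap
    rw [← intervalIntegral.integral_interval_sub_left (av_sqrt_integrable hf 0 (r ^ 2))
      (av_sqrt_integrable hf 0 (s ^ 2))]
    ring
  rw [h1, abs_mul, abs_of_nonneg (by norm_num : (0 : ℝ) ≤ 1 / 2)]
  refine mul_le_mul_of_nonneg_left ?_ (by norm_num)
  rw [← Real.norm_eq_abs]
  refine intervalIntegral.norm_integral_le_of_norm_le_const fun q hq => ?_
  refine abs_av_le hN hf (Real.sqrt_nonneg q) fun t h0 ht => h t ?_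
  rw [abs_of_nonneg h0]
  refine ht.trans ?_
  have hq' : q ≤ max (s ^ 2) (r ^ 2) := by
    rw [Set.uIoc, Set.mem_Ioc] at hq; exact hq.2
  refine Real.sqrt_le_iff.2 ⟨(abs_nonneg r).trans hr, hq'.trans (max_le ?_ ?_)⟩
  · rw [← sq_abs]; exact pow_le_pow_left₀ (abs_nonneg _) hs 2
  · rw [← sq_abs]; exact pow_le_pow_left₀ (abs_nonneg _) hr 2

/-- A family of functions that is uniformly bounded on every bounded interval. -/
def LocBdd {ι : Type*} (F : ι → ℝ → ℝ) : Prop :=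
  ∀ R, ∃ B, ∀ n t, |t| ≤ R → |F n t| ≤ B

theorem LocBdd.const_add_invLap (hN : 0 < N) {ι : Type*} {F : ι → ℝ → ℝ}
    (hF : ∀ n, Continuous (F n)) (h : LocBdd F) (c : ℝ) :
    LocBdd (fun n t => c + invLap N (F n) t) := by
  intro R
  obtain ⟨B, hB⟩ := h R
  refine ⟨|c| + 1 / 2 * (|B| * R ^ 2), fun n t ht => (abs_add_le _ _).trans ?_⟩
  have h0 : |(0 : ℝ)| ≤ R := by simpa using (abs_nonneg t).trans ht
  have h1 := abs_invLap_sub_le hN (hF n) (hB n) ht h0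
  simp only [invLap_zero_right, sub_zero, ne_eq, OfNat.ofNat_ne_zero, not_false_eq_true,
    zero_pow, abs_pow, sq_abs] at h1
  have h2 : t ^ 2 ≤ R ^ 2 := by
    rw [← sq_abs]; exact pow_le_pow_left₀ (abs_nonneg _) ht 2
  have h3 : B * t ^ 2 ≤ |B| * R ^ 2 :=
    mul_le_mul (le_abs_self B) h2 (sq_nonneg _) (abs_nonneg _)
  linarith

theorem LocBdd.nest (hN : 0 < N) {ι : Type*} {F : ι → ℝ → ℝ}
    (hF : ∀ n, Continuous (F n)) (h : LocBdd F) (m : ℕ) (a : ℕ → ℝ) :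
    LocBdd (fun n => nest N m a (F n)) := by
  induction m generalizing a with
  | zero => exact h
  | succ m ih =>
    exact LocBdd.const_add_invLap hN (fun n => continuous_nest m _ (hF n)) (ih _) _

theorem tendsto_invLap (hN : 0 < N) {F : ℕ → ℝ → ℝ} {f : ℝ → ℝ} (hF : ∀ n, Continuous (F n))
    (h : LocBdd F) (hl : ∀ t, Filter.Tendsto (fun n => F n t) Filter.atTop (nhds (f t)))
    (r : ℝ) :
    Filter.Tendsto (fun n => invLap N (F n) r) Filter.atTop (nhds (invLap N f r)) := by
  obtain ⟨B, hB⟩ := h |r|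
  refine Filter.Tendsto.const_mul _ ?_
  have hsq : ∀ q ∈ Set.uIoc 0 (r ^ 2), √q ≤ |r| := fun q hq => by
    rw [Set.uIoc_of_le (sq_nonneg r)] at hq
    rw [← Real.sqrt_sq_eq_abs]
    exact Real.sqrt_le_sqrt hq.2
  refine intervalIntegral.tendsto_integral_filter_of_dominated_convergence (fun _ => B) ?_ ?_ ?_ ?_
  · exact Filter.Eventually.of_forall fun n =>
      ((continuous_av (hF n)).comp Real.continuous_sqrt).aestronglyMeasurable
  · refine Filter.Eventually.of_forall fun n => Filter.Eventually.of_forall fun q hq => ?_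
    refine abs_av_le hN (hF n) (Real.sqrt_nonneg q) fun t h0 ht => hB n t ?_
    rw [abs_of_nonneg h0]
    exact ht.trans (hsq q hq)
  · exact intervalIntegrable_const
  · refine Filter.Eventually.of_forall fun q hq => ?_
    refine intervalIntegral.tendsto_integral_filter_of_dominated_convergence
      (fun _ => B) ?_ ?_ ?_ ?_
    · exact Filter.Eventually.of_forall fun n =>
        Continuous.aestronglyMeasurable (by have := hF n; fun_prop)
    · refine Filter.Eventually.of_forall fun n => Filter.Eventually.of_forall fun τ hτ => ?_
      rw [Set.uIoc_of_le zero_le_one] at hτ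
      have h1 : |τ * √q| ≤ |r| := by
        rw [abs_of_nonneg (mul_nonneg hτ.1.le (Real.sqrt_nonneg q))]
        exact (mul_le_of_le_one_left (Real.sqrt_nonneg q) hτ.2).trans (hsq q hq)
      rw [Real.norm_eq_abs, abs_mul, abs_of_nonneg (pow_nonneg hτ.1.le _)]
      calc τ ^ (N - 1) * |F n (τ * √q)| ≤ 1 * B :=
            mul_le_mul (pow_le_one₀ hτ.1.le hτ.2) (hB n _ h1) (abs_nonneg _) zero_le_one
        _ = B := one_mul B
    · exact intervalIntegrable_const
    · exact Filter.Eventually.of_forall fun τ _ => (hl _).const_mul _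

theorem tendsto_nest (hN : 0 < N) {F : ℕ → ℝ → ℝ} {f : ℝ → ℝ} (hF : ∀ n, Continuous (F n))
    (h : LocBdd F) (hl : ∀ t, Filter.Tendsto (fun n => F n t) Filter.atTop (nhds (f t)))
    (m : ℕ) (a : ℕ → ℝ) (r : ℝ) :
    Filter.Tendsto (fun n => nest N m a (F n) r) Filter.atTop (nhds (nest N m a f r)) := by
  induction m generalizing a r with
  | zero => exact hl r
  | succ m ih =>
    exact (tendsto_invLap hN (fun n => continuous_nest m _ (hF n)) (LocBdd.nest hN hF h m _)
      (fun t => ih _ t) r).const_add _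

theorem continuous_of_tendsto_invLap (hN : 0 < N) {F : ℕ → ℝ → ℝ} {f : ℝ → ℝ}
    (hF : ∀ n, Continuous (F n)) (h : LocBdd F) (c : ℝ)
    (hl : ∀ t, Filter.Tendsto (fun n => c + invLap N (F n) t) Filter.atTop (nhds (f t))) :
    Continuous f := by
  rw [continuous_iff_continuousAt]
  intro r
  obtain ⟨B, hB⟩ := h (|r| + 1)
  have key : ∀ s, |s| ≤ |r| + 1 → |f s - f r| ≤ 1 / 2 * (B * |s ^ 2 - r ^ 2|) := by
    intro s hs
    refine le_of_tendsto ((hl s).sub (hl r)).abs (Filter.Eventually.of_forall fun n => ?_)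
    rw [add_sub_add_left_eq_sub]
    exact abs_invLap_sub_le hN (hF n) (hB n) hs (by linarith)
  rw [ContinuousAt, tendsto_iff_dist_tendsto_zero]
  refine squeeze_zero' (g := fun s => 1 / 2 * (B * |s ^ 2 - r ^ 2|))
    (Filter.Eventually.of_forall fun _ => dist_nonneg) ?_ ?_
  · have h1 : ∀ᶠ s in nhds r, |s| < |r| + 1 :=
      continuous_abs.continuousAt.eventually_lt continuousAt_const (by linarith)
    filter_upwards [h1] with s hs
    exact key s hs.le
  · have : Continuous fun s : ℝ => 1 / 2 * (B * |s ^ 2 - r ^ 2|) := by fun_prop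
    simpa using this.tendsto r

/-! ### Monotone iteration and comparison. -/

/-- Picard iterates of `f ↦ nest N m a (exp ∘ f)`. -/
def picard (N m : ℕ) (a : ℕ → ℝ) : ℕ → ℝ → ℝ
  | 0 => nest N m a (fun _ => 0)
  | j + 1 => nest N m a (fun t => Real.exp (picard N m a j t))

theorem continuous_picard (m : ℕ) (a : ℕ → ℝ) (j : ℕ) : Continuous (picard N m a j) := by
  induction j with
  | zero => exact continuous_nest m a continuous_const
  | succ j ih => exact continuous_nest m a (by fun_prop)

theorem continuous_picard_param {X : Type*} [TopologicalSpace X] (m : ℕ) {a : X → ℕ → ℝ}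
    (ha : ∀ k, Continuous fun p => a p k) (j : ℕ) :
    Continuous (fun p : X × ℝ => picard N m (a p.1) j p.2) := by
  induction j with
  | zero => exact continuous_nest_param (g := fun _ _ => 0) m ha continuous_const
  | succ j ih =>
    exact continuous_nest_param (g := fun p t => Real.exp (picard N m (a p) j t)) m ha
      (Real.continuous_exp.comp ih)

theorem picard_le_succ (m : ℕ) (a : ℕ → ℝ) (j : ℕ) (r : ℝ) :
    picard N m a j r ≤ picard N m a (j + 1) r := by
  induction j generalizing r with
  | zero =>
    have := continuous_picard (N := N) m a 0
    exact nest_mono m (fun _ _ => le_rfl) continuous_const (by fun_prop)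
      (fun t => (Real.exp_pos _).le) r
  | succ j ih =>
    have h1 := continuous_picard (N := N) m a j
    have h2 := continuous_picard (N := N) m a (j + 1)
    exact nest_mono m (fun _ _ => le_rfl) (by fun_prop) (by fun_prop)
      (fun t => Real.exp_le_exp.2 (ih t)) r

theorem picard_mono (m : ℕ) (a : ℕ → ℝ) (r : ℝ) : Monotone fun j => picard N m a j r :=
  monotone_nat_of_le_succ fun j => picard_le_succ m a j r

/-- Iteration starts from the nest of `0 ≤ exp`, and monotonicity of `nest` and `exp` keeps every
iterate below `U`. -/
theorem picard_le_supersolution (m : ℕ) (a : ℕ → ℝ) {U : ℝ → ℝ} (hU : Continuous U)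
    (h : ∀ r, nest N m a (fun t => Real.exp (U t)) r ≤ U r) (j : ℕ) (r : ℝ) :
    picard N m a j r ≤ U r := by
  induction j generalizing r with
  | zero =>
    exact (nest_mono m (fun _ _ => le_rfl) continuous_const (by fun_prop)
      (fun t => (Real.exp_pos _).le) r).trans (h r)
  | succ j ih =>
    have h1 := continuous_picard (N := N) m a j
    exact (nest_mono m (fun _ _ => le_rfl) (by fun_prop) (by fun_prop)
      (fun t => Real.exp_le_exp.2 (ih t)) r).trans (h r)

/-- The increasing bounded iterates converge pointwise; dominated convergence through each `invLap`
shows that the limit is a fixed point. -/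
theorem exists_isProfile_of_bdd (hN : 0 < N) {m : ℕ} (hm : 0 < m) (a : ℕ → ℝ)
    (h : ∀ R, ∃ B, ∀ j t, |t| ≤ R → picard N m a j t ≤ B) : ∃ f, IsProfile N m a f := by
  have hb : LocBdd (picard N m a) := by
    intro R
    obtain ⟨B, hB⟩ := h R
    obtain ⟨C, hC⟩ := (isCompact_Icc (a := -R) (b := R)).exists_bound_of_continuousOn
      (continuous_picard (N := N) m a 0).continuousOn
    refine ⟨max B C, fun j t ht => abs_le.2 ⟨?_, (hB j t ht).trans (le_max_left _ _)⟩⟩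
    have h1 := (abs_le.1 (hC t (abs_le.1 ht))).1
    have h2 := picard_mono (N := N) m a t (Nat.zero_le j)
    have h3 := le_max_right B C
    dsimp only at h2
    linarith
  have hbe : LocBdd fun j t => Real.exp (picard N m a j t) := by
    intro R
    obtain ⟨B, hB⟩ := hb R
    refine ⟨Real.exp B, fun j t ht => ?_⟩
    rw [Real.abs_exp]
    exact Real.exp_le_exp.2 (abs_le.1 (hB j t ht)).2
  have hce : ∀ j, Continuous fun t => Real.exp (picard N m a j t) := fun j =>
    Real.continuous_exp.comp (continuous_picard m a j)
  have hl : ∀ t, Filter.Tendsto (fun j => picard N m a j t) Filter.atTop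
      (nhds (⨆ j, picard N m a j t)) := by
    intro t
    obtain ⟨B, hB⟩ := h |t|
    exact tendsto_atTop_ciSup (picard_mono m a t) ⟨B, by
      rintro _ ⟨j, rfl⟩; exact hB j t le_rfl⟩
  set f : ℝ → ℝ := fun t => ⨆ j, picard N m a j t with hf
  have hfix : ∀ r, f r = nest N m a (fun t => Real.exp (f t)) r := by
    intro r
    have h1 := tendsto_nest hN hce hbe (f := fun t => Real.exp (f t))
      (fun t => (Real.continuous_exp.tendsto _).comp (hl t)) m a r
    exact tendsto_nhds_unique ((hl r).comp (Filter.tendsto_add_atTop_nat 1)) h1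
  refine ⟨f, ?_, hfix⟩
  obtain ⟨k, rfl⟩ : ∃ k, m = k + 1 := ⟨m - 1, by omega⟩
  exact continuous_of_tendsto_invLap hN
    (F := fun j => nest N k (fun i => a (i + 1)) fun t => Real.exp (picard N (k + 1) a j t))
    (fun j => continuous_nest k _ (hce j)) (LocBdd.nest hN hce hbe k _) (a 0)
    (fun t => (hl t).comp (Filter.tendsto_add_atTop_nat 1))

theorem exists_isProfile_of_supersolution (hN : 0 < N) {m : ℕ} (hm : 0 < m) (a : ℕ → ℝ)
    {U : ℝ → ℝ} (hU : Continuous U)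
    (h : ∀ r, nest N m a (fun t => Real.exp (U t)) r ≤ U r) : ∃ f, IsProfile N m a f := by
  refine exists_isProfile_of_bdd hN hm a fun R => ?_
  obtain ⟨C, hC⟩ := (isCompact_Icc (a := -R) (b := R)).exists_bound_of_continuousOn
    hU.continuousOn
  exact ⟨C, fun j t ht => (picard_le_supersolution m a hU h j t).trans
    (abs_le.1 (hC t (abs_le.1 ht))).2⟩

/-- A profile for larger data is a supersolution for smaller data. -/
theorem IsProfile.exists_of_le (hN : 0 < N) {m : ℕ} (hm : 0 < m) {a b : ℕ → ℝ} {f : ℝ → ℝ}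
    (hf : IsProfile N m b f) (hab : ∀ k < m, a k ≤ b k) : ∃ g, IsProfile N m a g := by
  refine exists_isProfile_of_supersolution hN hm a hf.1 fun r => ?_
  have := hf.1
  rw [hf.2 r]
  exact nest_mono m hab (by fun_prop) (by fun_prop) (fun t => le_rfl) r

/-! ### Existence when the top datum is very negative. -/

theorem nest_succ_right (m : ℕ) (a : ℕ → ℝ) (g : ℝ → ℝ) :
    nest N (m + 1) a g = nest N m a (fun r => a m + invLap N g r) := by
  induction m generalizing a with
  | zero => rfl
  | succ m ih =>
    ext r
    rw [nest_succ, ih, nest_succ]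

theorem nest_eq_add (m : ℕ) (a : ℕ → ℝ) {g : ℝ → ℝ} (hg : Continuous g) (r : ℝ) :
    nest N m a g r = nest N m a (fun _ => 0) r + nest N m (fun _ => 0) g r := by
  induction m generalizing a r with
  | zero => simp [nest]
  | succ m ih =>
    rw [nest_succ, nest_succ, nest_succ, zero_add, add_assoc]
    rw [← invLap_add (continuous_nest m _ continuous_const) (continuous_nest m _ hg)]
    simp_rw [← ih]

theorem nest_zero_zero (m : ℕ) (r : ℝ) : nest N m (fun _ => 0) (fun _ => 0) r = 0 := by
  have := nest_eq_add (N := N) m (fun _ => 0) (g := fun _ => 0) continuous_const r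
  linarith

theorem invLap_sq (r : ℝ) :
    invLap N (fun t => t ^ 2) r = r ^ 4 / (4 * ((N - 1 : ℕ) + 3)) := by
  have h : ∀ s, av N (fun t => t ^ 2) s = 1 / ((N - 1 : ℕ) + 3) * s ^ 2 := by
    intro s
    unfold av
    have : ∀ τ : ℝ, τ ^ (N - 1) * (τ * s) ^ 2 = τ ^ (N - 1 + 2) * s ^ 2 := fun τ => by ring
    simp_rw [this]
    rw [intervalIntegral.integral_mul_const, integral_pow]
    push_cast
    simp
    ring_nf
    simp
  have h2 : ∫ q in (0 : ℝ)..r ^ 2, av N (fun t => t ^ 2) √q =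
      ∫ q in (0 : ℝ)..r ^ 2, 1 / ((N - 1 : ℕ) + 3) * q := by
    refine intervalIntegral.integral_congr fun q hq => ?_
    rw [Set.uIcc_of_le (sq_nonneg r)] at hq
    simp only [h, Real.sq_sqrt hq.1]
  unfold invLap
  rw [h2, intervalIntegral.integral_const_mul, integral_id]
  field_simp
  ring

/-- A very negative leading term dominates the polyharmonic polynomial. Inductively the Laplacian is
forced below a steep quadratic, and inverting once more costs only the additive `1`. -/
theorem exists_nest_const_le (hN : 0 < N) (n : ℕ) (a : ℕ → ℝ) (B : ℝ) :
    ∃ b : ℝ, ∀ r, nest N (n + 1) a (fun _ => -b) r ≤ a 0 + 1 - B * r ^ 2 := by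
  induction n generalizing a B with
  | zero =>
    refine ⟨2 * N * B, fun r => ?_⟩
    have hN' : (N : ℝ) ≠ 0 := by positivity
    rw [nest_succ]
    simp only [nest]
    rw [invLap_const hN]
    have : -(2 * N * B) / (2 * N) * r ^ 2 = - (B * r ^ 2) := by field_simp
    linarith
  | succ n ih =>
    -- After inversion the bound is `(c - B) r² - c² r⁴ / 4`, and `c r² - c² r⁴ / 4 ≤ 1` because `(1
    -- - c r² / 2)² ≥ 0`. The factor `d = N + 2` comes from `invLap_sq`.
    set c : ℝ := (a 1 + 1) / (2 * N) + B
    set d : ℝ := (N - 1 : ℕ) + 3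
    have hd : 0 < d := by positivity
    obtain ⟨b, hb⟩ := ih (fun k => a (k + 1)) (d * c ^ 2)
    refine ⟨b, fun r => ?_⟩
    rw [nest_succ]
    have h1 := invLap_mono (N := N) (continuous_nest (n + 1) (fun k => a (k + 1))
      (continuous_const (y := -b))) (g := fun r => (a 1 + 1) + (-(d * c ^ 2)) * r ^ 2)
      (by fun_prop) (fun t => by have := hb t; simp only [zero_add] at this; linarith) r
    rw [invLap_add continuous_const (by fun_prop), invLap_const hN,
      invLap_const_mul _ (fun t => t ^ 2), invLap_sq] at h1
    have h2 : -(d * c ^ 2) * (r ^ 4 / (4 * d)) = - (c ^ 2 * r ^ 4 / 4) := by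
      field_simp
    rw [h2] at h1
    have h3 : (a 1 + 1) / (2 * N) = c - B := by simp [c]
    rw [h3] at h1
    nlinarith [sq_nonneg (1 - c * r ^ 2 / 2)]

/-- For `N ≥ 5`, `τ^{N-1} ≤ τ⁴` bounds the average of `(1 + t²)⁻²` by its endpoint value; in the
variable `q = r²` the latter has integral at most `1`. -/
theorem invLap_inv_sq_le (hN : 5 ≤ N) (r : ℝ) :
    invLap N (fun t => ((1 + t ^ 2) ^ 2)⁻¹) r ≤ 1 / 2 := by
  have hc : Continuous fun t : ℝ => ((1 + t ^ 2) ^ 2)⁻¹ :=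
    Continuous.inv₀ (by fun_prop) fun t => by positivity
  have hc' : Continuous fun t : ℝ => ((1 + |t|) ^ 2)⁻¹ :=
    Continuous.inv₀ (by fun_prop) fun t => by positivity
  have h1 : ∀ s, av N (fun t => ((1 + t ^ 2) ^ 2)⁻¹) s ≤ ((1 + s ^ 2) ^ 2)⁻¹ := by
    intro s
    have h2 : ∫ τ in (0 : ℝ)..1, τ ^ (N - 1) * ((1 + (τ * s) ^ 2) ^ 2)⁻¹ ≤
        ∫ _ in (0 : ℝ)..1, ((1 + s ^ 2) ^ 2)⁻¹ := by
      refine intervalIntegral.integral_mono_on zero_le_one (av_integrable hc s 0 1)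
        intervalIntegrable_const fun τ hτ => ?_
      have h4 : τ ^ (N - 1) ≤ (τ ^ 2) ^ 2 := by
        rw [← pow_mul]
        exact pow_le_pow_of_le_one hτ.1 hτ.2 (by omega)
      have h5 : τ ^ 2 * (1 + s ^ 2) ≤ 1 + (τ * s) ^ 2 := by
        nlinarith [pow_le_one₀ (n := 2) hτ.1 hτ.2]
      rw [← div_eq_mul_inv, div_le_iff₀ (by positivity), inv_mul_eq_div,
        le_div_iff₀ (by positivity)]
      calc τ ^ (N - 1) * (1 + s ^ 2) ^ 2 ≤ (τ ^ 2) ^ 2 * (1 + s ^ 2) ^ 2 := by gcongr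
        _ = (τ ^ 2 * (1 + s ^ 2)) ^ 2 := by ring
        _ ≤ _ := by gcongr
    unfold av
    simpa using h2
  have h2 : ∫ q in (0 : ℝ)..r ^ 2, av N (fun t => ((1 + t ^ 2) ^ 2)⁻¹) √q ≤
      ∫ q in (0 : ℝ)..r ^ 2, ((1 + |q|) ^ 2)⁻¹ := by
    refine intervalIntegral.integral_mono_on (sq_nonneg r) (av_sqrt_integrable hc _ _)
      (hc'.intervalIntegrable _ _) fun q hq => ?_
    refine (h1 _).trans_eq ?_
    rw [Real.sq_sqrt hq.1, abs_of_nonneg hq.1]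
  have h3 : ∫ q in (0 : ℝ)..r ^ 2, ((1 + |q|) ^ 2)⁻¹ = -(1 + r ^ 2)⁻¹ - -(1 + 0)⁻¹ := by
    refine intervalIntegral.integral_eq_sub_of_hasDerivAt (f := fun q : ℝ => -(1 + q)⁻¹)
      (fun q hq => ?_) (hc'.intervalIntegrable _ _)
    rw [Set.uIcc_of_le (sq_nonneg r)] at hq
    have h4 : HasDerivAt (fun q : ℝ => 1 + q) 1 q := (hasDerivAt_id q).const_add 1
    have h5 := (h4.fun_inv (by linarith [hq.1])).fun_neg
    rw [abs_of_nonneg hq.1]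
    convert h5 using 1
    field_simp
  unfold invLap
  have h4 : 0 < (1 + r ^ 2)⁻¹ := by positivity
  rw [h3] at h2
  norm_num at h2
  linarith

/-- `U = 1 - 2 log (1 + r²)` is a supersolution: `e^U = e (1 + r²)⁻²` has inverse Laplacian at most
`e / 2`, so lowering the top datum by `e` pays for it. -/
theorem exists_isProfile_of_data (hN : 5 ≤ N) (n : ℕ) (a : ℕ → ℝ) (ha : a 0 = 0) :
    ∃ β, ∃ f, IsProfile N (n + 2) (Function.update a (n + 1) β) f := by
  -- The slope `2` yields `1 - 2 r²`, which lies below `U` because `log (1 + r²) ≤ r²`.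
  obtain ⟨b, hb⟩ := exists_nest_const_le (N := N) (by omega) n a 2
  refine ⟨-b - Real.exp 1, ?_⟩
  set β := -b - Real.exp 1
  have hU : Continuous fun r : ℝ => 1 - 2 * Real.log (1 + r ^ 2) := by
    have : Continuous fun r : ℝ => Real.log (1 + r ^ 2) :=
      Continuous.log (by fun_prop) fun r => by positivity
    fun_prop
  refine exists_isProfile_of_supersolution (by omega) (by omega) _ hU fun r => ?_
  have hexp : ∀ t : ℝ, Real.exp (1 - 2 * Real.log (1 + t ^ 2)) =
      Real.exp 1 * ((1 + t ^ 2) ^ 2)⁻¹ := by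
    intro t
    rw [sub_eq_add_neg, Real.exp_add, ← neg_mul, mul_comm (-2), Real.exp_mul,
      Real.exp_log (by positivity), Real.rpow_neg (by positivity)]
    norm_cast
  simp_rw [hexp]
  have hc : Continuous fun t : ℝ => ((1 + t ^ 2) ^ 2)⁻¹ :=
    Continuous.inv₀ (by fun_prop) fun t => by positivity
  rw [nest_succ_right, Function.update_self]
  have h1 : nest N (n + 1) (Function.update a (n + 1) β)
      (fun r => β + invLap N (fun t => Real.exp 1 * ((1 + t ^ 2) ^ 2)⁻¹) r) r ≤
      nest N (n + 1) a (fun _ => -b) r := by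
    refine nest_mono _ (fun k hk => ?_) (continuous_const.add (continuous_invLap (by fun_prop)))
      continuous_const (fun t => ?_) r
    · rw [Function.update_of_ne (by omega)]
    · change β + invLap N (fun t => Real.exp 1 * ((1 + t ^ 2) ^ 2)⁻¹) t ≤ -b
      rw [invLap_const_mul (Real.exp 1) (fun t => ((1 + t ^ 2) ^ 2)⁻¹)]
      have := mul_le_mul_of_nonneg_left (invLap_inv_sq_le hN t) (Real.exp_pos 1).le
      have := Real.exp_pos 1
      simp only [β]
      linarith
  have h2 : Real.log (1 + r ^ 2) ≤ r ^ 2 := by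
    have := Real.log_le_sub_one_of_pos (by positivity : 0 < 1 + r ^ 2)
    linarith
  have := hb r
  linarith

/-! ### Blow-up and uniform local bounds. -/

/-- If `φ R` were large, steps of geometrically decreasing length inside `[R, 2R]` would make `φ`
unbounded there: the loss `h^{2m}` is only geometric, while the gain `e^φ` is exponential in a value
growing linearly with the step number. -/
theorem blowup_bound {m : ℕ} (hm : 0 < m) {κ : ℝ} (hκ : 0 < κ) : ∃ B : ℝ, ∀ R : ℝ, 1 ≤ R →
    ∀ φ : ℝ → ℝ, Continuous φ → (∀ s h, R ≤ s → 0 < h → s + m * h ≤ 2 * R →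
      κ * h ^ (2 * m) * Real.exp (φ s) ≤ φ (s + m * h)) → φ R < B := by
  have hm' : (0 : ℝ) < m := by exact_mod_cast hm
  set c : ℝ := κ * (1 / (2 * m)) ^ (2 * m) with hc
  have hc0 : 0 < c := by positivity
  -- Halving `h` multiplies `h^{2m}` by `e^{-L}`. Growth of `φ` by `L + 1` per step outweighs this,
  -- and `B` is chosen so that the first step already gains `L + 1`.
  set L : ℝ := (2 * m : ℕ) * Real.log 2 with hL
  have hL0 : 0 ≤ L := mul_nonneg (by positivity) (Real.log_nonneg (by norm_num))
  set B : ℝ := 1 + 2 * (1 + (L + 1)) / c with hB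
  have hB1 : 1 ≤ B := by
    have : 0 ≤ 2 * (1 + (L + 1)) / c := by positivity
    linarith
  have hBc : B + (L + 1) ≤ c * Real.exp B := by
    have h1 := Real.quadratic_le_exp_of_nonneg (by linarith : 0 ≤ B)
    have h2 : 2 * (1 + (L + 1)) ≤ c * B := by
      have : c * B = c + 2 * (1 + (L + 1)) := by rw [hB]; field_simp
      linarith
    have h3 : c * (B ^ 2 / 2) ≤ c * Real.exp B := mul_le_mul_of_nonneg_left (by linarith) hc0.le
    nlinarith
  refine ⟨B, fun R hR φ hφ hstep => ?_⟩
  by_contra hcon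
  rw [not_lt] at hcon
  have claim : ∀ k : ℕ, B + (L + 1) * k ≤ φ (2 * R - R / 2 ^ k) := by
    intro k
    induction k with
    | zero =>
      have : 2 * R - R / 2 ^ 0 = R := by ring
      rw [this]; simpa using hcon
    | succ k ih =>
      have h2k : (1 : ℝ) ≤ 2 ^ k := one_le_pow₀ (by norm_num)
      set h : ℝ := R / 2 ^ k / (2 * m) with hh
      have hh0 : 0 < h := by positivity
      have e1 : 2 * R - R / 2 ^ k + m * h = 2 * R - R / 2 ^ (k + 1) := by
        rw [hh, pow_succ]
        field_simp
        ring
      have hle : R / 2 ^ k ≤ R := div_le_self (by linarith) h2k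
      have h1 := hstep (2 * R - R / 2 ^ k) h (by linarith) hh0 (by
        rw [e1]
        have : 0 ≤ R / 2 ^ (k + 1) := by positivity
        linarith)
      rw [e1] at h1
      refine le_trans ?_ h1
      have e2 : Real.exp (-(L * k)) = (1 / 2 ^ k) ^ (2 * m) := by
        rw [hL, Real.exp_neg, mul_right_comm, mul_comm, Real.exp_mul,
          Real.exp_log (by norm_num), one_div, inv_pow, ← pow_mul, mul_comm k]
        norm_cast
      have h3 : c * Real.exp (-(L * k)) ≤ κ * h ^ (2 * m) := by
        rw [e2, hc, mul_assoc, ← mul_pow]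
        refine mul_le_mul_of_nonneg_left (pow_le_pow_left₀ (by positivity) ?_ _) hκ.le
        rw [hh, div_mul_div_comm, one_mul, div_div, mul_comm (2 * (m : ℝ))]
        gcongr
      have h4 : (B + (L + 1)) * (k + 1) ≤ c * Real.exp (-(L * k)) * Real.exp (B + (L + 1) * k) := by
        have e3 : c * Real.exp (-(L * k)) * Real.exp (B + (L + 1) * k) =
            c * Real.exp B * Real.exp k := by
          have : Real.exp (-(L * k)) * Real.exp (B + (L + 1) * k) = Real.exp B * Real.exp k := by
            rw [← Real.exp_add, ← Real.exp_add]
            congr 1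
            ring
          linear_combination c * this
        rw [e3]
        exact mul_le_mul hBc (Real.add_one_le_exp _) (by positivity) (by positivity)
      calc B + (L + 1) * ((k + 1 : ℕ) : ℝ) ≤ (B + (L + 1)) * (k + 1) := by
            push_cast
            nlinarith [(Nat.cast_nonneg k : (0 : ℝ) ≤ k)]
        _ ≤ _ := h4
        _ ≤ _ := mul_le_mul h3 (Real.exp_le_exp.2 ih) (Real.exp_pos _).le (by positivity)
  obtain ⟨C, hC⟩ := (isCompact_Icc (a := R) (b := 2 * R)).exists_bound_of_continuousOn
    hφ.continuousOn
  obtain ⟨k, hk⟩ := exists_nat_gt C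
  have h2k : (1 : ℝ) ≤ 2 ^ k := one_le_pow₀ (by norm_num)
  have hle : R / 2 ^ k ≤ R := div_le_self (by linarith) h2k
  have hpos : 0 ≤ R / 2 ^ k := by positivity
  have h1 := (abs_le.1 (hC (2 * R - R / 2 ^ k) ⟨by linarith, by linarith⟩)).2
  have h2 := claim k
  nlinarith [(Nat.cast_nonneg k : (0 : ℝ) ≤ k)]

theorem monotoneOn_invLap {f : ℝ → ℝ} (hf : Continuous f) {R : ℝ} (hR : 0 ≤ R)
    (h : ∀ s, R ≤ s → 0 ≤ av N f s) : MonotoneOn (invLap N f) (Set.Ici R) := by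
  refine monotoneOn_of_deriv_nonneg (convex_Ici R) (continuous_invLap hf).continuousOn
    (fun r _ => (hasDerivAt_invLap hf r).differentiableAt.differentiableWithinAt) fun r hr => ?_
  rw [interior_Ici] at hr
  have hr' : R < r := hr
  rw [(hasDerivAt_invLap hf r).deriv, abs_of_nonneg (hR.trans hr'.le)]
  exact mul_nonneg (hR.trans hr'.le) (h r hr'.le)

theorem av_nonneg {f : ℝ → ℝ} {s : ℝ} (hs : 0 ≤ s)
    (h : ∀ t, 0 ≤ t → 0 ≤ f t) : 0 ≤ av N f s :=
  intervalIntegral.integral_nonneg zero_le_one fun _ hτ =>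
    mul_nonneg (pow_nonneg hτ.1 _) (h _ (mul_nonneg hτ.1 hs))

/-- Beyond `s` the flux `∫ t^{N-1} f` grows at least linearly with slope `s^{N-1} f s`; staying in
`[s, 2s]` bounds the ratio of the weights, hence the power of `1 / 2`. -/
theorem invLap_step (hN : 0 < N) {f : ℝ → ℝ} (hf : Continuous f) {s r : ℝ} (hs : 0 < s)
    (hsr : s ≤ r) (hr : r ≤ 2 * s) (hav : 0 ≤ av N f s) (h0 : 0 ≤ f s)
    (hmono : ∀ t, s ≤ t → f s ≤ f t) :
    invLap N f s + (1 / 2) ^ N * (r - s) ^ 2 * f s ≤ invLap N f r := by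
  have hlow : ∀ σ, s < σ → σ < 2 * s → (1 / 2) ^ (N - 1) * (σ - s) * f s ≤ σ * av N f σ := by
    intro σ hσ hσ2
    have hσ0 : 0 < σ := hs.trans hσ
    have hci : ∀ a b, IntervalIntegrable (fun t => t ^ (N - 1) * f t) volume a b := fun a b =>
      Continuous.intervalIntegrable (by fun_prop) _ _
    have h1 : σ ^ N * av N f σ = s ^ N * av N f s + ∫ t in s..σ, t ^ (N - 1) * f t := by
      rw [pow_mul_av hN, pow_mul_av hN, intervalIntegral.integral_add_adjacent_intervals (hci _ _)
        (hci _ _)]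
    have h2 : ∫ _ in s..σ, s ^ (N - 1) * f s ≤ ∫ t in s..σ, t ^ (N - 1) * f t := by
      refine intervalIntegral.integral_mono_on hσ.le intervalIntegrable_const (hci _ _)
        fun t ht => ?_
      exact mul_le_mul (pow_le_pow_left₀ hs.le ht.1 _) (hmono t ht.1) h0
        (pow_nonneg (hs.le.trans ht.1) _)
    rw [intervalIntegral.integral_const, smul_eq_mul] at h2
    have h3 : 0 ≤ s ^ N * av N f s := by positivity
    have h4 : (σ - s) * (s ^ (N - 1) * f s) ≤ σ ^ (N - 1) * (σ * av N f σ) := by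
      have : σ ^ (N - 1) * (σ * av N f σ) = σ ^ N * av N f σ := by
        rw [← mul_assoc, ← pow_succ]; congr 2; omega
      rw [this]; linarith
    have h5 : σ ^ (N - 1) * ((1 / 2) ^ (N - 1) * (σ - s) * f s) ≤
        (σ - s) * (s ^ (N - 1) * f s) := by
      have h6 : (σ * (1 / 2)) ^ (N - 1) ≤ s ^ (N - 1) :=
        pow_le_pow_left₀ (by positivity) (by linarith) _
      rw [mul_pow] at h6
      have h7 : 0 ≤ (σ - s) * f s := mul_nonneg (by linarith) h0
      nlinarith [mul_le_mul_of_nonneg_right h6 h7]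
    exact le_of_mul_le_mul_left (h5.trans h4) (by positivity)
  have hd : ∀ σ, HasDerivAt (fun σ => invLap N f σ - (1 / 2) ^ N * (σ - s) ^ 2 * f s)
      (σ * av N f |σ| - (1 / 2) ^ N * (2 * (σ - s)) * f s) σ := by
    intro σ
    have h1 : HasDerivAt (fun σ => (σ - s) ^ 2) (2 * (σ - s)) σ := by
      simpa using ((hasDerivAt_id σ).sub_const s).fun_pow 2
    exact (hasDerivAt_invLap hf σ).sub ((h1.const_mul ((1 / 2) ^ N)).mul_const (f s))
  have hm : MonotoneOn (fun σ => invLap N f σ - (1 / 2) ^ N * (σ - s) ^ 2 * f s) (Set.Icc s r) := by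
    refine monotoneOn_of_deriv_nonneg (convex_Icc s r)
      (fun σ _ => (hd σ).continuousAt.continuousWithinAt)
      (fun σ _ => (hd σ).differentiableAt.differentiableWithinAt) fun σ hσ => ?_
    rw [interior_Icc] at hσ
    rw [(hd σ).deriv, abs_of_nonneg (hs.le.trans hσ.1.le)]
    have h1 := hlow σ hσ.1 (hσ.2.trans_le hr)
    have h2 : ((1 : ℝ) / 2) ^ N * 2 = (1 / 2) ^ (N - 1) := by
      obtain ⟨n, rfl⟩ : ∃ n, N = n + 1 := ⟨N - 1, by omega⟩
      rw [pow_succ]; simp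
    have h3 : (1 / 2) ^ N * (2 * (σ - s)) * f s = (1 / 2) ^ (N - 1) * (σ - s) * f s := by
      rw [← h2]; ring
    linarith
  have := hm (Set.left_mem_Icc.2 hsr) (Set.right_mem_Icc.2 hsr) hsr
  simp only [sub_self] at this
  linarith

/-- Each step moves right by `h`, descends one level and gains `(1 / 2) ^ N * h ^ 2`; `m h ≤ s`
keeps every step within the doubling range. This supplies the hypothesis of `blowup_bound`. -/
theorem chain_step (hN : 0 < N) {m : ℕ} {w : ℕ → ℝ → ℝ} {c : ℕ → ℝ} {R : ℝ} (hR : 0 < R)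
    (hcont : ∀ j ≤ m, Continuous (w j))
    (hw : ∀ j < m, ∀ r, w j r = c j + invLap N (w (j + 1)) r)
    (hav : ∀ j < m, ∀ s, R ≤ s → 0 ≤ av N (w (j + 1)) s)
    (hpos : ∀ j ≤ m, ∀ s, R ≤ s → 0 ≤ w j s) (hmono : MonotoneOn (w m) (Set.Ici R))
    {s h : ℝ} (hs : R ≤ s) (hh : 0 ≤ h) (hms : m * h ≤ s) :
    (((1 / 2) ^ N) ^ m * h ^ (2 * m)) * w m s ≤ w 0 (s + m * h) := by
  have key : ∀ i ≤ m, (((1 / 2) ^ N) ^ i * h ^ (2 * i)) * w m s ≤ w (m - i) (s + i * h) := by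
    intro i
    induction i with
    | zero => intro _; simp
    | succ i ih =>
      intro hi
      have h1 := ih (by omega)
      have hih : 0 ≤ i * h := by positivity
      have hsi : R ≤ s + i * h := by linarith
      have hle : h ≤ s := by
        have : (1 : ℝ) ≤ m := by exact_mod_cast (by omega : 1 ≤ m)
        nlinarith
      have e1 : m - (i + 1) + 1 = m - i := by omega
      have hmon : ∀ t, s + i * h ≤ t → w (m - i) (s + i * h) ≤ w (m - i) t := by
        intro t ht
        rcases Nat.eq_zero_or_pos i with rfl | hi0
        · exact hmono hsi (hsi.trans ht) ht
        · rw [hw (m - i) (by omega), hw (m - i) (by omega)]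
          have := monotoneOn_invLap (hcont (m - i + 1) (by omega)) hR.le
            (hav (m - i) (by omega)) (Set.mem_Ici.2 hsi) (Set.mem_Ici.2 (hsi.trans ht)) ht
          linarith
      have h2 := invLap_step hN (hcont (m - i) (by omega)) (s := s + i * h)
        (r := s + i * h + h) (by linarith) (by linarith) (by linarith)
        (by have := hav (m - (i + 1)) (by omega) _ hsi; rwa [e1] at this)
        (hpos _ (by omega) _ hsi) hmon
      have h3 := hpos (m - (i + 1)) (by omega) _ hsi
      rw [hw _ (by omega), e1] at h3
      have e2 : s + ((i + 1 : ℕ) : ℝ) * h = s + i * h + h := by push_cast; ring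
      rw [e2, hw (m - (i + 1)) (by omega), e1]
      have e3 : s + i * h + h - (s + i * h) = h := by ring
      rw [e3] at h2
      have h4 := mul_le_mul_of_nonneg_left h1
        (by positivity : (0 : ℝ) ≤ (1 / 2) ^ N * h ^ 2)
      have e4 : ((1 / 2 : ℝ) ^ N) ^ (i + 1) * h ^ (2 * (i + 1)) * w m s =
          (1 / 2) ^ N * h ^ 2 * (((1 / 2) ^ N) ^ i * h ^ (2 * i) * w m s) := by ring
      rw [e4]
      linarith
  have := key m le_rfl
  rwa [Nat.sub_self] at this

/-- Local upper bound for entire radial solutions, depending only on a bound for the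
polyharmonic polynomial determined by the data. -/
theorem IsProfile.local_bound (hN : 0 < N) {m : ℕ} (hm : 0 < m) {R : ℝ} (hR : 1 ≤ R) (M : ℝ) :
    ∃ B, ∀ (a : ℕ → ℝ) (f : ℝ → ℝ), IsProfile N m a f →
      (∀ t, |t| ≤ 2 * R → |nest N m a (fun _ => 0) t| ≤ M) → ∀ t, |t| ≤ R → f t ≤ B := by
  obtain ⟨B, hB⟩ := blowup_bound hm
    (κ := Real.exp (-M) * ((1 / 2) ^ N) ^ m) (by positivity)
  refine ⟨M + B, fun a f hf hM t ht => ?_⟩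
  have hfc := hf.1
  have hec : Continuous fun t => Real.exp (f t) := by fun_prop
  set v : ℝ → ℝ := nest N m (fun _ => 0) (fun t => Real.exp (f t)) with hv
  have hvc : Continuous v := continuous_nest m _ hec
  have hfv : ∀ r, f r = nest N m a (fun _ => 0) r + v r := fun r => by
    rw [hv, ← nest_eq_add m a hec]; exact hf.2 r
  have hnn : ∀ (j : ℕ) {g : ℝ → ℝ}, Continuous g → (∀ t, 0 ≤ g t) →
      ∀ r, 0 ≤ nest N j (fun _ => 0) g r := fun j g hg h0 r => by
    exact (nest_zero_zero (N := N) j r).ge.trans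
      (nest_mono j (fun _ _ => le_rfl) continuous_const hg h0 r)
  have hnm : ∀ (j : ℕ) {g : ℝ → ℝ}, Continuous g → (∀ t, 0 ≤ g t) → 0 < j →
      MonotoneOn (nest N j (fun _ => 0) g) (Set.Ici 0) := fun j g hg h0 hj => by
    obtain ⟨k, rfl⟩ : ∃ k, j = k + 1 := ⟨j - 1, by omega⟩
    have := monotoneOn_invLap (N := N) (continuous_nest k (fun _ => 0) hg) le_rfl fun s hs =>
      av_nonneg hs fun t _ => hnn k hg h0 t
    intro x hx y hy hxy
    rw [nest_succ, nest_succ]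
    exact add_le_add le_rfl (this hx hy hxy)
  have hvm : MonotoneOn v (Set.Ici 0) := hnm m hec (fun t => (Real.exp_pos _).le) hm
  have hev : Continuous fun t => Real.exp (v t) := by fun_prop
  -- Removing the polynomial part leaves `v ≥ K^m (e^{-M} e^v)` on `[0, 2R]`, with zero data and all
  -- levels nonnegative, so the chain applies from any starting radius.
  have hvR : v R < B := by
    refine hB R hR v hvc fun s h hs hh hsh => ?_
    have h1 := chain_step hN (m := m)
      (w := fun j => nest N (m - j) (fun _ => 0) fun t => Real.exp (v t)) (c := fun _ => 0)
      (R := R) (by linarith) (fun j _ => continuous_nest _ _ hev)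
      (fun j hj r => by
        have e : m - j = m - (j + 1) + 1 := by omega
        rw [e, nest_succ])
      (fun j _ s hs => av_nonneg (by linarith) fun t _ => hnn _ hev (fun t => (Real.exp_pos _).le) t)
      (fun j _ s _ => hnn _ hev (fun t => (Real.exp_pos _).le) s)
      (by
        intro x hx y hy hxy
        simp only [Nat.sub_self]
        have hx' : R ≤ x := hx
        have hy' : R ≤ y := hy
        exact Real.exp_le_exp.2 (hvm (Set.mem_Ici.2 (by linarith))
          (Set.mem_Ici.2 (by linarith)) hxy))
      hs hh.le (by linarith)
    simp only [Nat.sub_zero, Nat.sub_self] at h1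
    have hs2 : |s + m * h| ≤ 2 * R := by
      have : 0 ≤ m * h := by positivity
      rw [abs_of_nonneg (by linarith)]; exact hsh
    have h2 : nest N m (fun _ => 0) (fun t => Real.exp (-M) * Real.exp (v t)) (s + m * h) ≤
        v (s + m * h) := by
      refine nest_mono_on m (fun _ _ => le_rfl) (by fun_prop) hec (R := 2 * R) (fun t ht => ?_) _ hs2
      rw [← Real.exp_add, hfv]
      have := (abs_le.1 (hM t ht)).1
      exact Real.exp_le_exp.2 (by linarith)
    have h3 : ∀ (j : ℕ) (r : ℝ), nest N j (fun _ => 0)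
        (fun t => Real.exp (-M) * Real.exp (v t)) r =
        Real.exp (-M) * nest N j (fun _ => 0) (fun t => Real.exp (v t)) r := by
      intro j
      induction j with
      | zero => intro r; rfl
      | succ j ih =>
        intro r
        rw [nest_succ, nest_succ, zero_add, zero_add, ← invLap_const_mul]
        congr 1
        exact funext ih
    rw [h3] at h2
    refine le_trans ?_ h2
    rw [mul_assoc, mul_assoc]
    refine mul_le_mul_of_nonneg_left ?_ (Real.exp_pos _).le
    rw [← mul_assoc]
    exact h1
  have hvt : v t ≤ v R := by
    have e : v t = v |t| := by
      obtain ⟨k, rfl⟩ : ∃ k, m = k + 1 := ⟨m - 1, by omega⟩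
      rw [hv, nest_succ, nest_succ, invLap_abs]
    rw [e]
    exact hvm (Set.mem_Ici.2 (abs_nonneg t)) (Set.mem_Ici.2 (by linarith)) ht
  have := (abs_le.1 (hM t (by linarith))).2
  rw [hfv]
  linarith

/-! ### The sign of the top Laplacian. -/

/-- The part of the average taken where `f` may be below `c` carries weight at most `|R| / s`, so
its contribution vanishes as `s` grows; half of the limit `c / N` is kept. -/
theorem av_eventually_ge (hN : 2 ≤ N) {f : ℝ → ℝ} (hf : Continuous f) {c R : ℝ} (hc : 0 < c)
    (hfc : ∀ r, R ≤ r → c ≤ f r) : ∃ R', 1 ≤ R' ∧ ∀ s, R' ≤ s → c / (2 * N) ≤ av N f s := by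
  obtain ⟨M, hM⟩ := (isCompact_Icc (a := 0) (b := |R|)).exists_bound_of_continuousOn
    hf.continuousOn
  have hM0 : 0 ≤ M := (norm_nonneg _).trans (hM 0 ⟨le_rfl, abs_nonneg R⟩)
  have hN0 : (0 : ℝ) < N := by exact_mod_cast (by omega : 0 < N)
  set D : ℝ := (M + c) * |R| with hD
  refine ⟨1 + 2 * N * D / c, by
    have : 0 ≤ 2 * N * D / c := by positivity
    linarith, fun s hs => ?_⟩
  have hD0 : 0 ≤ D := by positivity
  have hs1 : 1 ≤ s := by
    have : 0 ≤ 2 * N * D / c := by positivity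
    linarith
  have hs0 : 0 < s := by linarith
  have h1 : ∫ τ in (0 : ℝ)..1, (τ ^ (N - 1) * c - D / s) ≤ av N f s := by
    refine intervalIntegral.integral_mono_on zero_le_one
      (Continuous.intervalIntegrable (by fun_prop) _ _) (av_integrable hf s 0 1) fun τ hτ => ?_
    have hp : 0 ≤ τ ^ (N - 1) := pow_nonneg hτ.1 _
    by_cases hle : |R| ≤ τ * s
    · have := mul_le_mul_of_nonneg_left (hfc _ ((le_abs_self R).trans hle)) hp
      have : 0 ≤ D / s := by positivity
      linarith
    · rw [not_le] at hle
      have h2 := (abs_le.1 (hM (τ * s) ⟨mul_nonneg hτ.1 hs0.le, hle.le⟩)).1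
      have h3 : τ ^ (N - 1) ≤ |R| / s := by
        refine (pow_le_of_le_one hτ.1 hτ.2 (by omega)).trans ?_
        rw [le_div_iff₀ hs0]
        exact hle.le
      have h4 : τ ^ (N - 1) * (M + c) ≤ D / s := by
        rw [hD, mul_comm, mul_div_assoc]
        exact mul_le_mul_of_nonneg_left h3 (by linarith)
      nlinarith [mul_le_mul_of_nonneg_left h2 hp]
  rw [intervalIntegral.integral_sub (Continuous.intervalIntegrable (by fun_prop) _ _)
    intervalIntegrable_const] at h1
  have h2 := av_const (N := N) (by omega) c s
  unfold av at h2
  rw [h2] at h1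
  simp only [intervalIntegral.integral_const, sub_zero, smul_eq_mul, one_mul] at h1
  have h3 : D / s ≤ c / (2 * N) := by
    rw [div_le_div_iff₀ hs0 (by positivity)]
    have h4 : 2 * N * D / c ≤ s := by linarith
    rw [div_le_iff₀ hc] at h4
    linarith
  have h4 : c / N = c / (2 * N) + c / (2 * N) := by field_simp; ring
  linarith

theorem tendsto_invLap_atTop (hN : 2 ≤ N) {f : ℝ → ℝ} (hf : Continuous f) {c R : ℝ} (hc : 0 < c)
    (hfc : ∀ r, R ≤ r → c ≤ f r) : Filter.Tendsto (invLap N f) Filter.atTop Filter.atTop := by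
  obtain ⟨R', hR', h⟩ := av_eventually_ge hN hf hc hfc
  have hN0 : (0 : ℝ) < N := by exact_mod_cast (by omega : 0 < N)
  set d := c / (2 * N)
  have hd : 0 < d := by positivity
  have hder : ∀ r, HasDerivAt (fun r => invLap N f r - d * r) (r * av N f |r| - d * 1) r :=
    fun r => (hasDerivAt_invLap hf r).sub ((hasDerivAt_id r).const_mul d)
  have hm : MonotoneOn (fun r => invLap N f r - d * r) (Set.Ici R') := by
    refine monotoneOn_of_deriv_nonneg (convex_Ici R')
      (fun σ _ => (hder σ).continuousAt.continuousWithinAt)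
      (fun σ _ => (hder σ).differentiableAt.differentiableWithinAt) fun σ hσ => ?_
    rw [interior_Ici] at hσ
    have hσ' : R' < σ := hσ
    rw [(hder σ).deriv, abs_of_nonneg (by linarith)]
    have := h σ hσ'.le
    nlinarith
  refine Filter.tendsto_atTop_mono' (f₁ := fun r => invLap N f R' - d * R' + d * r) _ ?_ ?_
  · filter_upwards [Filter.eventually_ge_atTop R'] with r hr
    have := hm (Set.mem_Ici.2 le_rfl) (Set.mem_Ici.2 hr) hr
    simp only at this
    linarith
  · exact Filter.tendsto_atTop_add_const_left _ _ (Filter.tendsto_id.const_mul_atTop hd)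

/-- Along an entire radial solution, `Δ^{m-1} u` stays non-positive. -/
theorem IsProfile.top_nonpos (hN : 2 ≤ N) {n : ℕ} {a : ℕ → ℝ} {f : ℝ → ℝ}
    (hf : IsProfile N (n + 2) a f) (r : ℝ) :
    a (n + 1) + invLap N (fun t => Real.exp (f t)) r ≤ 0 := by
  by_contra hcon
  rw [not_le, ← invLap_abs] at hcon
  have hfc := hf.1
  have hec : Continuous fun t => Real.exp (f t) := by fun_prop
  set m := n + 2 with hm
  set w : ℕ → ℝ → ℝ := fun j => nest N (m - j) (fun k => a (k + j)) fun t => Real.exp (f t) with hwdef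
  have hcont : ∀ j, Continuous (w j) := fun j => continuous_nest _ _ hec
  have hw : ∀ j < m, ∀ r, w j r = a j + invLap N (w (j + 1)) r := by
    intro j hj r
    have e : m - j = m - (j + 1) + 1 := by omega
    simp only [hwdef]
    rw [e, nest_succ, zero_add]
    simp only [add_assoc, add_comm 1 j]
  have hwm : w m = fun t => Real.exp (f t) := by simp [hwdef, nest]
  have hw0 : w 0 = f := by
    ext r; simp only [hwdef, Nat.sub_zero, add_zero]; exact (hf.2 r).symm
  -- The top level increases with the radius because `e^f > 0`, so one positive value persists.
  have htop : ∃ c R, 0 < c ∧ ∀ r, R ≤ r → c ≤ w (n + 1) r := by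
    refine ⟨_, |r|, hcon, fun s hs => ?_⟩
    rw [hw (n + 1) (by omega), hwm]
    have := monotoneOn_invLap (N := N) hec le_rfl
      (fun s hs => av_nonneg hs fun t _ => (Real.exp_pos _).le)
      (Set.mem_Ici.2 (abs_nonneg r)) (Set.mem_Ici.2 ((abs_nonneg r).trans hs)) hs
    linarith
  have hpos : ∀ i ≤ n + 1, ∃ c R, 0 < c ∧ ∀ r, R ≤ r → c ≤ w (n + 1 - i) r := by
    intro i
    induction i with
    | zero => exact fun _ => htop
    | succ i ih =>
      intro hi
      obtain ⟨c, R, hc, h⟩ := ih (by omega)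
      have h1 := Filter.tendsto_atTop_add_const_left _ (a (n + 1 - (i + 1)))
        (tendsto_invLap_atTop hN (hcont _) hc h)
      obtain ⟨R', hR'⟩ := Filter.eventually_atTop.1 (h1.eventually_ge_atTop 1)
      refine ⟨1, R', one_pos, fun r hr => ?_⟩
      rw [hw _ (by omega)]
      have e : n + 1 - (i + 1) + 1 = n + 1 - i := by omega
      rw [e]
      exact hR' r hr
  have hall : ∀ j ≤ m, ∃ R, ∀ s, R ≤ s → 0 ≤ w j s ∧ 0 ≤ av N (w j) s := by
    intro j hj
    rcases hj.eq_or_lt with rfl | hj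
    · refine ⟨0, fun s hs => ?_⟩
      rw [hwm]
      exact ⟨(Real.exp_pos _).le, av_nonneg hs fun t _ => (Real.exp_pos _).le⟩
    · obtain ⟨c, R, hc, h⟩ := hpos (n + 1 - j) (by omega)
      have e : n + 1 - (n + 1 - j) = j := by omega
      rw [e] at h
      obtain ⟨R', hR', h'⟩ := av_eventually_ge hN (hcont j) hc h
      refine ⟨max R R', fun s hs => ⟨hc.le.trans (h s ((le_max_left _ _).trans hs)), ?_⟩⟩
      exact le_trans (by positivity) (h' s ((le_max_right _ _).trans hs))
  choose! ρ hρ using hall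
  -- A common radius beyond which all levels and their averages are nonnegative, as `chain_step`
  -- requires.
  obtain ⟨R, hR1, hR⟩ : ∃ R, 1 ≤ R ∧ ∀ j ≤ m, ρ j ≤ R := by
    refine ⟨1 + ∑ j ∈ Finset.range (m + 1), |ρ j|, ?_, fun j hj => ?_⟩
    · have := Finset.sum_nonneg fun j (_ : j ∈ Finset.range (m + 1)) => abs_nonneg (ρ j)
      linarith
    · have := Finset.single_le_sum (f := fun j => |ρ j|) (fun j _ => abs_nonneg (ρ j))
        (Finset.mem_range.2 (by omega : j < m + 1))
      have := le_abs_self (ρ j)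
      linarith
  have hfmono : MonotoneOn f (Set.Ici R) := by
    intro x hx y hy hxy
    rw [← hw0, hw 0 (by omega), hw 0 (by omega)]
    have := monotoneOn_invLap (hcont 1) (by linarith)
      (fun s hs => (hρ 1 (by omega) s ((hR 1 (by omega)).trans hs)).2) hx hy hxy
    simp only [zero_add]
    linarith
  obtain ⟨B, hB⟩ := blowup_bound (m := m) (by omega) (κ := ((1 / 2) ^ N) ^ m) (by positivity)
  have hlt : ∀ S, R ≤ S → f S < B := by
    intro S hS
    refine hB S (hR1.trans hS) f hfc fun s h hs hh hsh => ?_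
    have h1 := chain_step (by omega) (m := m) (w := w) (c := a) (R := R) (by linarith)
      (fun j _ => hcont j) hw
      (fun j hj s hs => (hρ (j + 1) (by omega) s ((hR (j + 1) (by omega)).trans hs)).2)
      (fun j hj s hs => (hρ j hj s ((hR j hj).trans hs)).1)
      (by
        rw [hwm]
        exact fun x hx y hy hxy => Real.exp_le_exp.2 (hfmono hx hy hxy))
      (hS.trans hs) hh.le (by linarith)
    rwa [hwm, hw0] at h1
  -- Level `1` is eventually bounded below by a positive constant, so `f` tends to infinity, against
  -- the bound `B` valid at all large radii.
  obtain ⟨c, R₁, hc, h⟩ := hpos n (by omega)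
  have e : n + 1 - n = 1 := by omega
  rw [e] at h
  have h1 := Filter.tendsto_atTop_add_const_left _ (a 0) (tendsto_invLap_atTop hN (hcont 1) hc h)
  obtain ⟨S, hS1, hS2⟩ := ((h1.eventually_ge_atTop B).and (Filter.eventually_ge_atTop R)).exists
  have h2 := hlt S hS2
  rw [← hw0, hw 0 (by omega)] at h2
  simp only [zero_add] at h2
  linarith

theorem IsProfile.top_neg (hN : 2 ≤ N) {n : ℕ} {a : ℕ → ℝ} {f : ℝ → ℝ}
    (hf : IsProfile N (n + 2) a f) : a (n + 1) < 0 := by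
  have hfc := hf.1
  have hN0 : (0 : ℝ) < N := by exact_mod_cast (by omega : 0 < N)
  obtain ⟨C, hC⟩ := (isCompact_Icc (a := (-1 : ℝ)) (b := 1)).exists_bound_of_continuousOn
    hfc.continuousOn
  have h1 := invLap_mono_on (N := N) (continuous_const (y := Real.exp (-C)))
    (g := fun t => Real.exp (f t)) (by fun_prop) (R := 1)
    (fun t ht => Real.exp_le_exp.2 (abs_le.1 (hC t (abs_le.1 ht))).1) (r := 1) (by simp)
  rw [invLap_const (by omega)] at h1
  have h2 := hf.top_nonpos hN 1
  have h3 : 0 < Real.exp (-C) / (2 * N) * 1 ^ 2 := by positivity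
  linarith

/-! ### The threshold function. -/

/-- The data `0, a 0, …, a (n-1), β, β, …` as a sequence. -/
def dataSeq {n : ℕ} (a : Fin n → ℝ) (β : ℝ) (k : ℕ) : ℝ :=
  if k = 0 then 0 else if h : k - 1 < n then a ⟨k - 1, h⟩ else β

theorem dataSeq_zero {n : ℕ} (a : Fin n → ℝ) (β : ℝ) : dataSeq a β 0 = 0 := rfl

theorem dataSeq_succ {n : ℕ} (a : Fin n → ℝ) (β : ℝ) (i : Fin n) :
    dataSeq a β ((i : ℕ) + 1) = a i := by
  simp [dataSeq]

theorem dataSeq_top {n : ℕ} (a : Fin n → ℝ) (β : ℝ) : dataSeq a β (n + 1) = β := by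
  simp [dataSeq]

theorem dataSeq_mono {n : ℕ} (a : Fin n → ℝ) {β γ : ℝ} (h : β ≤ γ) (k : ℕ) :
    dataSeq a β k ≤ dataSeq a γ k := by
  unfold dataSeq
  split_ifs <;> first | exact le_rfl | exact h

theorem continuous_dataSeq {n : ℕ} (a : Fin n → ℝ) (k : ℕ) :
    Continuous fun β => dataSeq a β k := by
  unfold dataSeq
  split_ifs <;> fun_prop

theorem IsProfile.congr {m : ℕ} {a b : ℕ → ℝ} {f : ℝ → ℝ} (hf : IsProfile N m a f)
    (h : ∀ k < m, a k = b k) : IsProfile N m b f :=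
  ⟨hf.1, fun r => by rw [← nest_congr m h]; exact hf.2 r⟩

theorem IsProfile.isGlobalRadialSolution (hN : 0 < N) {n : ℕ} (hev : Even (n + 2))
    {a : Fin n → ℝ} {β : ℝ} {f : ℝ → ℝ} (hf : IsProfile N (n + 2) (dataSeq a β) f) :
    IsGlobalRadialSolution (N := N) (n + 2) a β (fun x => f ‖x‖) := by
  refine ⟨hf.isEntireSolution (by omega) hev hN, ⟨f, fun x => by rw [sub_zero]⟩, ?_, ?_, ?_⟩
  · exact hf.iterLap_at_zero hN (k := 0) (by omega)
  · intro i
    rw [hf.iterLap_at_zero hN (by have : (i : ℕ) < n := i.2; omega)]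
    exact dataSeq_succ a β i
  · have : n + 2 - 1 = n + 1 := by omega
    rw [this, hf.iterLap_at_zero hN (by omega), dataSeq_top]

theorem exists_isGlobalRadialSolution_iff (hN : 2 ≤ N) {n : ℕ} (hev : Even (n + 2))
    (a : Fin n → ℝ) (β : ℝ) :
    (∃ u : Space N → ℝ, IsGlobalRadialSolution (n + 2) a β u) ↔
      ∃ f, IsProfile N (n + 2) (dataSeq a β) f := by
  constructor
  · rintro ⟨u, hu, hr, h0, ha, hβ⟩
    obtain ⟨f, hf, -⟩ := exists_isProfile hN (by omega) hev hu hr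
    refine ⟨f, hf.congr fun k hk => ?_⟩
    rcases Nat.eq_zero_or_pos k with rfl | hk0
    · exact h0
    · obtain ⟨j, rfl⟩ : ∃ j, k = j + 1 := ⟨k - 1, by omega⟩
      by_cases hj : j < n
      · exact (ha ⟨j, hj⟩).trans (dataSeq_succ a β ⟨j, hj⟩).symm
      · obtain rfl : j = n := by omega
        rw [dataSeq_top]
        exact hβ
  · rintro ⟨f, hf⟩
    exact ⟨_, hf.isGlobalRadialSolution (by omega) hev⟩

/-- The set of admissible values of `Δ^{m-1} u(0)`, for `m = n + 2`. -/
def admissible (N : ℕ) {n : ℕ} (a : Fin n → ℝ) : Set ℝ :=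
  {β | ∃ f, IsProfile N (n + 2) (dataSeq a β) f}

theorem admissible_nonempty (hN : 5 ≤ N) {n : ℕ} (a : Fin n → ℝ) : (admissible N a).Nonempty := by
  obtain ⟨β, f, hf⟩ := exists_isProfile_of_data hN n (dataSeq a 0) (dataSeq_zero a 0)
  refine ⟨β, f, hf.congr fun k hk => ?_⟩
  by_cases h : k = n + 1
  · rw [h, Function.update_self, dataSeq_top]
  · rw [Function.update_of_ne h]
    unfold dataSeq
    split_ifs with h1 h2
    · rfl
    · rfl
    · omega

theorem neg_of_mem_admissible (hN : 2 ≤ N) {n : ℕ} {a : Fin n → ℝ} {β : ℝ}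
    (h : β ∈ admissible N a) : β < 0 := by
  obtain ⟨f, hf⟩ := h
  have := hf.top_neg hN
  rwa [dataSeq_top] at this

theorem admissible_of_le (hN : 0 < N) {n : ℕ} {a : Fin n → ℝ} {β γ : ℝ}
    (h : γ ∈ admissible N a) (hle : β ≤ γ) : β ∈ admissible N a := by
  obtain ⟨f, hf⟩ := h
  exact hf.exists_of_le hN (by omega) fun k _ => dataSeq_mono a hle k

/-- Picard iterates at `γ < β` lie below the corresponding profiles, which are locally bounded
uniformly in `γ`; continuity in `γ` carries the bound to `β`. -/
theorem admissible_of_forall_lt (hN : 0 < N) {n : ℕ} {a : Fin n → ℝ} {β : ℝ}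
    (h : ∀ γ < β, γ ∈ admissible N a) : β ∈ admissible N a := by
  refine exists_isProfile_of_bdd hN (by omega) _ fun R => ?_
  obtain ⟨S, hRS, hS⟩ : ∃ S, R ≤ S ∧ 1 ≤ S := ⟨max R 1, le_max_left _ _, le_max_right _ _⟩
  obtain ⟨M₁, hM₁⟩ := (isCompact_Icc (a := -(2 * S)) (b := 2 * S)).exists_bound_of_continuousOn
    (continuous_nest (N := N) (n + 2) (dataSeq a β) (continuous_const (y := 0))).continuousOn
  obtain ⟨M₂, hM₂⟩ := (isCompact_Icc (a := -(2 * S)) (b := 2 * S)).exists_bound_of_continuousOn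
    (continuous_nest (N := N) (n + 2) (dataSeq a (β - 1)) (continuous_const (y := 0))).continuousOn
  obtain ⟨B, hB⟩ := IsProfile.local_bound hN (m := n + 2) (by omega) hS (max M₁ M₂)
  refine ⟨B, fun j t ht => ?_⟩
  have hcont : Continuous fun γ => picard N (n + 2) (dataSeq a γ) j t :=
    (continuous_picard_param (N := N) (n + 2) (continuous_dataSeq a) j).comp
      (f := fun γ : ℝ => (γ, t)) (by fun_prop)
  have hlim : Filter.Tendsto (fun γ => picard N (n + 2) (dataSeq a γ) j t)
      (nhdsWithin β (Set.Iio β)) (nhds (picard N (n + 2) (dataSeq a β) j t)) :=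
    hcont.continuousWithinAt
  refine le_of_tendsto hlim ?_
  -- For `γ` in `(β - 1, β)` the polynomial parts are sandwiched between those of `β - 1` and `β`,
  -- which gives the common bound `max M₁ M₂`.
  have hmem : ∀ᶠ γ in nhdsWithin β (Set.Iio β), β - 1 < γ :=
    nhdsWithin_le_nhds (lt_mem_nhds (by linarith))
  filter_upwards [hmem, self_mem_nhdsWithin] with γ hγ1 hγ2
  have hγ2' : γ < β := hγ2
  obtain ⟨f, hf⟩ := h γ hγ2'
  have hfc := hf.1
  have h1 := picard_le_supersolution (N := N) (n + 2) (dataSeq a γ) hf.1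
    (fun r => (hf.2 r).ge) j t
  refine h1.trans (hB _ f hf (fun s hs => abs_le.2 ⟨?_, ?_⟩) t (ht.trans hRS))
  · have h2 := nest_mono (N := N) (n + 2) (fun k _ => dataSeq_mono a hγ1.le k)
      (continuous_const (y := 0)) (continuous_const (y := 0)) (fun _ => le_rfl) s
    have h3 := (abs_le.1 (hM₂ s (abs_le.1 hs))).1
    have h4 := le_max_right M₁ M₂
    linarith
  · have h2 := nest_mono (N := N) (n + 2) (fun k _ => dataSeq_mono a hγ2'.le k)
      (continuous_const (y := 0)) (continuous_const (y := 0)) (fun _ => le_rfl) s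
    have h3 := (abs_le.1 (hM₁ s (abs_le.1 hs))).2
    have h4 := le_max_left M₁ M₂
    linarith

/-- The threshold value for global existence. -/
def threshold (N : ℕ) {n : ℕ} (a : Fin n → ℝ) : ℝ := sSup (admissible N a)

theorem mem_admissible_iff (hN : 5 ≤ N) {n : ℕ} (a : Fin n → ℝ) (β : ℝ) :
    β ∈ admissible N a ↔ β ≤ threshold N a := by
  have hb : BddAbove (admissible N a) :=
    ⟨0, fun γ hγ => (neg_of_mem_admissible (by omega) hγ).le⟩
  refine ⟨fun h => le_csSup hb h, fun h => ?_⟩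
  refine admissible_of_forall_lt (by omega) fun γ hγ => ?_
  obtain ⟨δ, hδ, hlt⟩ := exists_lt_of_lt_csSup (admissible_nonempty hN a) (hγ.trans_le h)
  exact admissible_of_le (by omega) hδ hlt.le

theorem isExistenceThreshold_threshold (hN : 5 ≤ N) {n : ℕ} (hev : Even (n + 2)) :
    IsExistenceThreshold N (n + 2) (fun a : Fin n → ℝ => threshold N a) := by
  refine ⟨fun a => neg_of_mem_admissible (N := N) (by omega)
    ((mem_admissible_iff hN a _).2 le_rfl), fun a β => ?_⟩
  exact (exists_isGlobalRadialSolution_iff (by omega) hev a β).trans (mem_admissible_iff hN a β)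

/-! ### A stable solution at the threshold. -/

/-- By `top_nonpos` the innermost level may be replaced by `0`; with only `a_1` nonzero, what
remains is a quadratic. -/
theorem IsProfile.le_quadratic (hN : 2 ≤ N) {n : ℕ} {A β : ℝ} {f : ℝ → ℝ}
    (hf : IsProfile N (n + 3) (dataSeq (fun i : Fin (n + 1) => if (i : ℕ) = 0 then -A else 0) β) f)
    (r : ℝ) : f r ≤ -A / (2 * N) * r ^ 2 := by
  have hfc := hf.1
  set a := dataSeq (fun i : Fin (n + 1) => if (i : ℕ) = 0 then -A else 0) β with ha
  have h1 : f r ≤ nest N (n + 2) a (fun _ => 0) r := by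
    rw [hf.2 r, nest_succ_right]
    exact nest_mono _ (fun _ _ => le_rfl)
      (continuous_const.add (continuous_invLap (by fun_prop))) continuous_const
      (fun t => hf.top_nonpos (n := n + 1) hN t) r
  refine h1.trans_eq ?_
  have a1 : a 1 = -A := by
    have := dataSeq_succ (fun i : Fin (n + 1) => if (i : ℕ) = 0 then -A else 0) β 0
    exact this.trans (if_pos rfl)
  have a2 : ∀ k < n, a (k + 1 + 1) = 0 := fun k hk => by
    have := dataSeq_succ (fun i : Fin (n + 1) => if (i : ℕ) = 0 then -A else 0) β
      ⟨k + 1, by omega⟩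
    exact this.trans (if_neg (Nat.succ_ne_zero k))
  have h2 : nest N (n + 1) (fun k => a (k + 1)) (fun _ => 0) = fun _ => -A := by
    ext s
    rw [nest_succ, nest_congr n a2]
    have : nest N n (fun _ => 0) (fun _ => 0) = fun _ => (0 : ℝ) := funext (nest_zero_zero n)
    rw [this, invLap_const (by omega), zero_add, a1]
    simp
  rw [nest_succ, h2, invLap_const (by omega), ha, dataSeq_zero, zero_add]

/-- One term of the exponential series at `1 + ‖x‖² / t` gives `(1 + y)^m ≤ m! e e^y`. -/
theorem exp_neg_div_le_mul_wt (m : ℕ) {t : ℝ} (ht : 0 < t) (x : Space N) :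
    Real.exp (-‖x‖ ^ 2 / t) ≤ t ^ m * (m.factorial * Real.exp 1) * wt t m x := by
  unfold wt
  have hp : 0 < t + ‖x‖ ^ 2 := by positivity
  rw [← div_eq_mul_inv, le_div_iff₀ (pow_pos hp m), neg_div]
  set y := ‖x‖ ^ 2 / t with hy
  have hy0 : 0 ≤ y := by positivity
  have e1 : t + ‖x‖ ^ 2 = t * (1 + y) := by rw [hy]; field_simp
  have h1 := Real.pow_div_factorial_le_exp (1 + y) (by positivity) m
  rw [div_le_iff₀ (by positivity), Real.exp_add] at h1
  have h3 : Real.exp (-y) * Real.exp y = 1 := by rw [← Real.exp_add]; simp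
  rw [e1, mul_pow]
  calc Real.exp (-y) * (t ^ m * (1 + y) ^ m)
      ≤ Real.exp (-y) * (t ^ m * (Real.exp 1 * Real.exp y * m.factorial)) := by gcongr
    _ = (Real.exp (-y) * Real.exp y) * (t ^ m * (m.factorial * Real.exp 1)) := by ring
    _ = _ := by rw [h3, one_mul]

theorem exp_neg_div_le_wt (m : ℕ) {c t : ℝ} (ht : 0 < t) (ht1 : t ≤ 1) (hm : 0 < m)
    (htc : t * (m.factorial * Real.exp 1) ≤ c) (x : Space N) :
    Real.exp (-‖x‖ ^ 2 / t) ≤ c * wt t m x := by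
  refine (exp_neg_div_le_mul_wt m ht x).trans
    (mul_le_mul_of_nonneg_right (le_trans ?_ htc) (wt_pos ht m x).le)
  exact mul_le_mul_of_nonneg_right (pow_le_of_le_one ht.le ht1 hm.ne') (by positivity)

theorem exists_small (m : ℕ) {c : ℝ} (hc : 0 < c) :
    ∃ t : ℝ, 0 < t ∧ t ≤ 1 ∧ t * (m.factorial * Real.exp 1) ≤ c := by
  have h : 0 < (m.factorial : ℝ) * Real.exp 1 := by positivity
  refine ⟨min 1 (c / (m.factorial * Real.exp 1)), by positivity, min_le_left _ _, ?_⟩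
  rw [← le_div_iff₀ h]
  exact min_le_right _ _

theorem exists_threshold_stable (m : ℕ) (hm : 3 ≤ m) (hN : 2 * m < N) (hev : Even m) :
    ∃ Φ : (Fin (m - 2) → ℝ) → ℝ, IsExistenceThreshold N m Φ ∧
      ∃ (a : Fin (m - 2) → ℝ) (u : Space N → ℝ),
        IsGlobalRadialSolution m a (Φ a) u ∧ IsStable m u := by
  obtain ⟨n, rfl⟩ : ∃ n, m = n + 3 := ⟨m - 3, by omega⟩
  refine ⟨fun a => threshold N a, isExistenceThreshold_threshold (n := n + 1) (by omega) hev, ?_⟩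
  obtain ⟨c, hc, hst⟩ := exists_isStable_of_le_wt (N := N) (n + 3) hN
  obtain ⟨t, ht, ht1, htc⟩ := exists_small (n + 3) hc
  have hN0 : (0 : ℝ) < N := by exact_mod_cast (by omega : 0 < N)
  -- This `a_1` makes the bounding quadratic exactly `-r² / t`, whose exponential fits under the
  -- Hardy weight with `ε = t`.
  let a : Fin (n + 1) → ℝ := fun i => if (i : ℕ) = 0 then -(2 * N / t) else 0
  obtain ⟨f, hf⟩ := (mem_admissible_iff (N := N) (by omega) a _).2 le_rfl
  refine ⟨a, _, hf.isGlobalRadialSolution (by omega) hev, hst t _ ht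
    (hf.1.comp continuous_norm) fun x => ?_⟩
  refine le_trans (Real.exp_le_exp.2 ?_) (exp_neg_div_le_wt (n + 3) ht ht1 (by omega) htc x)
  refine (hf.le_quadratic (by omega) ‖x‖).trans_eq ?_
  field_simp

/-! ### Convolution exponentials of measures. -/

/-- The exponential moment `∫ e^{|ξ|} dμ`. -/
def expMoment (μ : Measure (Space N)) : ℝ≥0∞ := ∫⁻ ξ, ENNReal.ofReal (Real.exp ‖ξ‖) ∂μ

theorem measurable_expWeight : Measurable fun ξ : Space N => ENNReal.ofReal (Real.exp ‖ξ‖) := by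
  fun_prop

theorem expWeight_add_le (ξ η : Space N) : ENNReal.ofReal (Real.exp ‖ξ + η‖) ≤
    ENNReal.ofReal (Real.exp ‖ξ‖) * ENNReal.ofReal (Real.exp ‖η‖) := by
  rw [← ENNReal.ofReal_mul (Real.exp_pos _).le, ← Real.exp_add]
  exact ENNReal.ofReal_le_ofReal (Real.exp_le_exp.2 (norm_add_le ξ η))

theorem measure_univ_le_expMoment (μ : Measure (Space N)) : μ Set.univ ≤ expMoment μ := by
  rw [← lintegral_one]
  refine lintegral_mono fun ξ => ?_
  rw [← ENNReal.ofReal_one]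
  exact ENNReal.ofReal_le_ofReal (Real.one_le_exp (norm_nonneg _))

theorem isFiniteMeasure_of_expMoment {μ : Measure (Space N)} (h : expMoment μ ≠ ∞) :
    IsFiniteMeasure μ :=
  ⟨(measure_univ_le_expMoment μ).trans_lt h.lt_top⟩

/-- The weight `e^{|ξ|}` is submultiplicative, so the exponential moment behaves like a Banach
algebra norm for convolution. -/
theorem expMoment_conv_le (μ ρ : Measure (Space N)) [SFinite ρ] :
    expMoment (μ.conv ρ) ≤ expMoment μ * expMoment ρ := by
  unfold expMoment
  rw [Measure.lintegral_conv measurable_expWeight]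
  calc ∫⁻ ξ, ∫⁻ η, ENNReal.ofReal (Real.exp ‖ξ + η‖) ∂ρ ∂μ
      ≤ ∫⁻ ξ, ENNReal.ofReal (Real.exp ‖ξ‖) * (∫⁻ η, ENNReal.ofReal (Real.exp ‖η‖) ∂ρ) ∂μ := by
        refine lintegral_mono fun ξ => ?_
        rw [← lintegral_const_mul _ measurable_expWeight]
        exact lintegral_mono fun η => expWeight_add_le ξ η
    _ = _ := lintegral_mul_const _ measurable_expWeight

theorem conv_mono {μ μ' ρ : Measure (Space N)} [SFinite ρ] (h : μ ≤ μ') :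
    μ.conv ρ ≤ μ'.conv ρ := by
  rw [Measure.le_iff]
  intro s hs
  rw [← lintegral_indicator_one hs, ← lintegral_indicator_one hs,
    Measure.lintegral_conv (measurable_one.indicator hs),
    Measure.lintegral_conv (measurable_one.indicator hs)]
  exact lintegral_mono' h le_rfl

theorem conv_mono_right {μ ρ ρ' : Measure (Space N)} [SFinite ρ] [SFinite ρ'] (h : ρ ≤ ρ') :
    μ.conv ρ ≤ μ.conv ρ' := by
  rw [Measure.le_iff]
  intro s hs
  rw [← lintegral_indicator_one hs, ← lintegral_indicator_one hs,
    Measure.lintegral_conv (measurable_one.indicator hs),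
    Measure.lintegral_conv (measurable_one.indicator hs)]
  exact lintegral_mono fun ξ => lintegral_mono' h le_rfl

/-- Convolution powers of a measure. -/
def convPow (μ : Measure (Space N)) : ℕ → Measure (Space N)
  | 0 => Measure.dirac 0
  | n + 1 => μ.conv (convPow μ n)

instance isFiniteMeasure_convPow (μ : Measure (Space N)) [IsFiniteMeasure μ] (n : ℕ) :
    IsFiniteMeasure (convPow μ n) := by
  induction n with
  | zero => exact inferInstanceAs (IsFiniteMeasure (Measure.dirac (0 : Space N)))
  | succ n ih => exact inferInstanceAs (IsFiniteMeasure (μ.conv (convPow μ n)))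

theorem expMoment_convPow_le (μ : Measure (Space N)) [IsFiniteMeasure μ] (n : ℕ) :
    expMoment (convPow μ n) ≤ expMoment μ ^ n := by
  induction n with
  | zero => simp [convPow, expMoment]
  | succ n ih =>
    rw [pow_succ']
    exact (expMoment_conv_le μ (convPow μ n)).trans (by gcongr)

theorem convPow_mono {μ μ' : Measure (Space N)} [IsFiniteMeasure μ] [IsFiniteMeasure μ']
    (h : μ ≤ μ') (n : ℕ) : convPow μ n ≤ convPow μ' n := by
  induction n with
  | zero => exact le_rfl
  | succ n ih => exact (conv_mono h).trans (conv_mono_right ih)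

theorem charFun_convPow (μ : Measure (Space N)) [IsFiniteMeasure μ] (n : ℕ) (x : Space N) :
    charFun (convPow μ n) x = charFun μ x ^ n := by
  induction n with
  | zero => simp [convPow, charFun_dirac]
  | succ n ih =>
    rw [pow_succ', ← ih]
    exact charFun_conv x

/-- The convolution exponential of a measure. -/
def convExp (μ : Measure (Space N)) : Measure (Space N) :=
  Measure.sum fun n => (n.factorial : ℝ≥0∞)⁻¹ • convPow μ n

theorem tsum_inv_factorial_ne_top : ∑' n : ℕ, (n.factorial : ℝ≥0∞)⁻¹ ≠ ∞ := by
  have h : ∀ n : ℕ, (n.factorial : ℝ≥0∞)⁻¹ = ((n.factorial : NNReal)⁻¹ : NNReal) := fun n => by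
    rw [ENNReal.coe_inv (by exact_mod_cast n.factorial_ne_zero)]
    norm_cast
  simp_rw [h]
  rw [ENNReal.tsum_coe_ne_top_iff_summable, ← NNReal.summable_coe]
  simpa using Real.summable_pow_div_factorial 1

theorem expMoment_convExp_le (μ : Measure (Space N)) [IsFiniteMeasure μ] (h : expMoment μ ≤ 1) :
    expMoment (convExp μ) ≤ ∑' n : ℕ, (n.factorial : ℝ≥0∞)⁻¹ := by
  unfold expMoment convExp
  rw [lintegral_sum_measure]
  refine ENNReal.tsum_le_tsum fun n => ?_
  rw [lintegral_smul_measure, smul_eq_mul]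
  refine mul_le_of_le_one_right' ?_
  exact (expMoment_convPow_le μ n).trans (pow_le_one' h n)

theorem convExp_mono {μ μ' : Measure (Space N)} [IsFiniteMeasure μ] [IsFiniteMeasure μ']
    (h : μ ≤ μ') : convExp μ ≤ convExp μ' := by
  rw [Measure.le_iff]
  intro s hs
  unfold convExp
  rw [Measure.sum_apply _ hs, Measure.sum_apply _ hs]
  refine ENNReal.tsum_le_tsum fun n => ?_
  simp only [Measure.smul_apply, smul_eq_mul]
  gcongr
  exact convPow_mono h n

theorem integrable_cexp_inner (μ : Measure (Space N)) [IsFiniteMeasure μ] (x : Space N) :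
    Integrable (fun ξ => Complex.exp (inner ℝ ξ x * Complex.I)) μ :=
  (integrable_const (1 : ℝ)).mono (by fun_prop) (by simp)

theorem charFun_convExp (μ : Measure (Space N)) [IsFiniteMeasure μ] (h : expMoment μ ≤ 1)
    (x : Space N) : charFun (convExp μ) x = Complex.exp (charFun μ x) := by
  have : IsFiniteMeasure (convExp μ) := isFiniteMeasure_of_expMoment
    (ne_top_of_le_ne_top tsum_inv_factorial_ne_top (expMoment_convExp_le μ h))
  have h1 := hasSum_integral_measure (integrable_cexp_inner (convExp μ) x)
  have h2 : ∀ n : ℕ, ∫ ξ, Complex.exp (inner ℝ ξ x * Complex.I)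
      ∂((n.factorial : ℝ≥0∞)⁻¹ • convPow μ n) = charFun μ x ^ n / n.factorial := by
    intro n
    rw [integral_smul_measure, ← charFun_apply, charFun_convPow]
    simp [ENNReal.toReal_inv]
    field_simp
  simp_rw [h2] at h1
  exact (h1.unique (NormedSpace.expSeries_div_hasSum_exp (charFun μ x))).trans
    (congrFun Complex.exp_eq_exp_ℂ _).symm

/-! ### The fixed point on the Fourier side. -/

/-- The symbol `|ξ|^{-2m}` of the inverse of `(-Δ)^m`. -/
def symb (m : ℕ) (ξ : Space N) : ℝ≥0∞ := (‖ξ‖ₑ ^ (2 * m))⁻¹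

theorem measurable_symb (m : ℕ) : Measurable (symb m : Space N → ℝ≥0∞) := by
  unfold symb; fun_prop

/-- One step of the fixed point iteration on the Fourier side. -/
def fourierStep (m : ℕ) (δ : ℝ≥0∞) (γ μ : Measure (Space N)) : Measure (Space N) :=
  ((convExp μ).conv γ).withDensity fun ξ => δ * symb m ξ

/-- Submultiplicativity separates the two weights, leaving an integral of the shifted symbol against
`γ` that is bounded uniformly in the shift. -/
theorem expMoment_fourierStep_le (m : ℕ) (δ : ℝ≥0∞) (γ μ : Measure (Space N)) [IsFiniteMeasure γ]
    {C : ℝ≥0∞}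
    (hC : ∀ η, ∫⁻ ξ, ENNReal.ofReal (Real.exp ‖ξ‖) * symb m (η + ξ) ∂γ ≤ C) :
    expMoment (fourierStep m δ γ μ) ≤ δ * (C * expMoment (convExp μ)) := by
  unfold expMoment fourierStep
  have hm := measurable_symb (N := N) m
  have hw := measurable_expWeight (N := N)
  rw [lintegral_withDensity_eq_lintegral_mul _ (hm.const_mul δ) hw]
  simp only [Pi.mul_apply, mul_assoc]
  have hmw : Measurable fun ξ : Space N => symb m ξ * ENNReal.ofReal (Real.exp ‖ξ‖) := hm.mul hw
  rw [lintegral_const_mul _ hmw, Measure.lintegral_conv hmw]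
  gcongr
  rw [← lintegral_const_mul _ hw]
  refine lintegral_mono fun η => ?_
  calc ∫⁻ ξ, symb m (η + ξ) * ENNReal.ofReal (Real.exp ‖η + ξ‖) ∂γ
      ≤ ∫⁻ ξ, ENNReal.ofReal (Real.exp ‖η‖) *
          (ENNReal.ofReal (Real.exp ‖ξ‖) * symb m (η + ξ)) ∂γ := by
        refine lintegral_mono fun ξ => ?_
        calc symb m (η + ξ) * ENNReal.ofReal (Real.exp ‖η + ξ‖)
            ≤ symb m (η + ξ) * (ENNReal.ofReal (Real.exp ‖η‖) *
              ENNReal.ofReal (Real.exp ‖ξ‖)) := by gcongr; exact expWeight_add_le η ξ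
          _ = _ := by ring
    _ = ENNReal.ofReal (Real.exp ‖η‖) *
          ∫⁻ ξ, ENNReal.ofReal (Real.exp ‖ξ‖) * symb m (η + ξ) ∂γ :=
        lintegral_const_mul _ (hw.mul (hm.comp (measurable_const_add η)))
    _ ≤ C * ENNReal.ofReal (Real.exp ‖η‖) := by
        rw [mul_comm C]; gcongr; exact hC η

theorem fourierStep_mono (m : ℕ) (δ : ℝ≥0∞) (γ : Measure (Space N)) [IsFiniteMeasure γ]
    {μ μ' : Measure (Space N)} [IsFiniteMeasure μ] [IsFiniteMeasure μ'] (h : μ ≤ μ') :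
    fourierStep m δ γ μ ≤ fourierStep m δ γ μ' := by
  rw [Measure.le_iff]
  intro s hs
  unfold fourierStep
  rw [withDensity_apply _ hs, withDensity_apply _ hs]
  exact lintegral_mono' (Measure.restrict_mono le_rfl (conv_mono (convExp_mono h))) le_rfl

/-- A real characteristic function is invariant under `x ↦ -x`, and the characteristic function
determines the measure. -/
theorem measure_eq_map_neg {ρ : Measure (Space N)} [IsFiniteMeasure ρ]
    (h : ∀ x, (charFun ρ x).im = 0) : ρ.map (fun ξ => -ξ) = ρ := by
  have : IsFiniteMeasure (ρ.map (fun ξ => -ξ)) := Measure.isFiniteMeasure_map ρ _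
  refine Measure.ext_of_charFun (funext fun x => ?_)
  have h1 : charFun (ρ.map (fun ξ => -ξ)) x = charFun ρ (-x) := by
    rw [charFun_apply, charFun_apply, integral_map (by fun_prop) (by fun_prop)]
    simp
  rw [h1, charFun_neg]
  exact Complex.conj_eq_iff_im.2 (h x)

theorem ae_symb_lt_top {m : ℕ} {δ : ℝ≥0∞} {ρ : Measure (Space N)}
    (h : ∫⁻ ξ, δ * symb m ξ ∂ρ ≠ ∞) : ∀ᵐ ξ ∂ρ, δ * symb m ξ < ∞ :=
  ae_lt_top ((measurable_symb m).const_mul δ) h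

theorem lintegral_symb_le (m : ℕ) (δ : ℝ≥0∞) (γ μ : Measure (Space N)) :
    ∫⁻ ξ, δ * symb m ξ ∂((convExp μ).conv γ) ≤ expMoment (fourierStep m δ γ μ) := by
  refine le_trans ?_ (measure_univ_le_expMoment _)
  unfold fourierStep
  rw [withDensity_apply _ MeasurableSet.univ, Measure.restrict_univ]

/-- The convolution is symmetric and the symbol is even. Reality is needed so that the transform of
the limit can serve as `v`. -/
theorem charFun_fourierStep_im (m : ℕ) (δ : ℝ≥0∞) (γ μ : Measure (Space N)) [IsFiniteMeasure γ]
    [IsFiniteMeasure μ] (hμ : expMoment μ ≤ 1) (hT : expMoment (fourierStep m δ γ μ) ≠ ∞)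
    (hγ : ∀ x, (charFun γ x).im = 0) (him : ∀ x, (charFun μ x).im = 0) (x : Space N) :
    (charFun (fourierStep m δ γ μ) x).im = 0 := by
  have : IsFiniteMeasure (convExp μ) := isFiniteMeasure_of_expMoment
    (ne_top_of_le_ne_top tsum_inv_factorial_ne_top (expMoment_convExp_le μ hμ))
  have hsym : ((convExp μ).conv γ).map (fun ξ => -ξ) = (convExp μ).conv γ := by
    refine measure_eq_map_neg fun y => ?_
    rw [charFun_conv, charFun_convExp μ hμ]
    have h1 : charFun μ y = ((charFun μ y).re : ℂ) := Complex.ext rfl (him y)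
    have h2 : charFun γ y = ((charFun γ y).re : ℂ) := Complex.ext rfl (hγ y)
    rw [h1, h2, ← Complex.ofReal_exp, ← Complex.ofReal_mul, Complex.ofReal_im]
  have hae := ae_symb_lt_top (ne_top_of_le_ne_top hT (lintegral_symb_le m δ γ μ))
  rw [← Complex.conj_eq_iff_im, ← charFun_neg, charFun_apply, charFun_apply]
  unfold fourierStep
  rw [integral_withDensity_eq_integral_toReal_smul ((measurable_symb m).const_mul δ) hae,
    integral_withDensity_eq_integral_toReal_smul ((measurable_symb m).const_mul δ) hae]
  conv_rhs => rw [← hsym]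
  rw [integral_map (by fun_prop)]
  · simp [symb]
  · exact ((((measurable_symb m).const_mul δ).ennreal_toReal).smul
      (by fun_prop)).aestronglyMeasurable

/-- Multiplication by `|ξ|^{2m}` cancels the symbol outside the null set where it is infinite; the
transform then turns convolution into product and `convExp` into `exp`. -/
theorem integral_pow_fourierStep (m : ℕ) {δ : ℝ≥0∞} (hδ0 : δ ≠ 0)
    (γ μ : Measure (Space N)) [IsFiniteMeasure γ]
    [IsFiniteMeasure μ] (hμ : expMoment μ ≤ 1) (hT : expMoment (fourierStep m δ γ μ) ≠ ∞)
    (x : Space N) :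
    ∫ ξ, ((‖ξ‖ ^ (2 * m) : ℝ) : ℂ) * Complex.exp (inner ℝ ξ x * Complex.I)
      ∂(fourierStep m δ γ μ) = δ.toReal * (Complex.exp (charFun μ x) * charFun γ x) := by
  have : IsFiniteMeasure (convExp μ) := isFiniteMeasure_of_expMoment
    (ne_top_of_le_ne_top tsum_inv_factorial_ne_top (expMoment_convExp_le μ hμ))
  have hae := ae_symb_lt_top (ne_top_of_le_ne_top hT (lintegral_symb_le m δ γ μ))
  unfold fourierStep
  rw [integral_withDensity_eq_integral_toReal_smul ((measurable_symb m).const_mul δ) hae,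
    ← charFun_convExp μ hμ, ← charFun_conv, charFun_apply, ← integral_const_mul]
  refine integral_congr_ae ?_
  filter_upwards [hae] with ξ hξ
  have hs : symb m ξ ≠ ∞ := by
    intro h
    rw [h, ENNReal.mul_top hδ0] at hξ
    exact lt_irrefl _ hξ
  have hne : ‖ξ‖ ^ (2 * m) ≠ 0 := by
    intro h
    apply hs
    unfold symb
    rw [ENNReal.inv_eq_top, ← ofReal_norm, ← ENNReal.ofReal_pow (norm_nonneg _), h,
      ENNReal.ofReal_zero]
  have e : (symb m ξ).toReal = (‖ξ‖ ^ (2 * m))⁻¹ := by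
    unfold symb
    rw [ENNReal.toReal_inv, ENNReal.toReal_pow, toReal_enorm]
  rw [ENNReal.toReal_mul, e, Complex.real_smul, ← mul_assoc, ← Complex.ofReal_mul]
  congr 2
  field_simp

theorem integrable_pow_norm {μ : Measure (Space N)} (h : expMoment μ ≠ ∞) (k : ℕ) :
    Integrable (fun ξ => ‖ξ‖ ^ k) μ := by
  have h1 : Integrable (fun ξ : Space N => Real.exp ‖ξ‖) μ := by
    refine ⟨by fun_prop, ?_⟩
    rw [hasFiniteIntegral_iff_ofReal (Filter.Eventually.of_forall fun ξ => (Real.exp_pos _).le)]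
    exact h.lt_top
  refine (h1.const_mul (k.factorial : ℝ)).mono (by fun_prop) (Filter.Eventually.of_forall fun ξ => ?_)
  have h2 := Real.pow_div_factorial_le_exp ‖ξ‖ (norm_nonneg _) k
  rw [div_le_iff₀ (by positivity)] at h2
  rw [Real.norm_of_nonneg (by positivity), Real.norm_of_nonneg (by positivity)]
  linarith

theorem integrable_pow_mul_cexp {μ : Measure (Space N)} (h : expMoment μ ≠ ∞) (k : ℕ)
    (x : Space N) :
    Integrable (fun ξ => ((‖ξ‖ ^ k : ℝ) : ℂ) * Complex.exp (inner ℝ ξ x * Complex.I)) μ :=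
  (integrable_pow_norm h k).mono (by fun_prop)
    (Filter.Eventually.of_forall fun ξ => by simp)

/-- The iterates of `fourierStep` starting from `0`. -/
def fourierSeq (m : ℕ) (δ : ℝ≥0∞) (γ : Measure (Space N)) : ℕ → Measure (Space N)
  | 0 => 0
  | n + 1 => fourierStep m δ γ (fourierSeq m δ γ n)

/-- The step preserves order and the bound `expMoment ≤ 1`, so the iterates from `0` increase to a
measure with the same bound. No contraction estimate is needed. -/
theorem exists_fourier_fixed_point (m : ℕ) {δ : ℝ≥0∞} (hδ0 : δ ≠ 0) (γ : Measure (Space N))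
    [IsFiniteMeasure γ] {C : ℝ≥0∞}
    (hC : ∀ η, ∫⁻ ξ, ENNReal.ofReal (Real.exp ‖ξ‖) * symb m (η + ξ) ∂γ ≤ C)
    (hγ : ∀ x, (charFun γ x).im = 0)
    (hδ : δ * (C * ∑' n : ℕ, (n.factorial : ℝ≥0∞)⁻¹) ≤ 1) :
    ∃ ν : Measure (Space N), expMoment ν ≤ 1 ∧ (∀ x, (charFun ν x).im = 0) ∧
      ∀ x, ∫ ξ, ((‖ξ‖ ^ (2 * m) : ℝ) : ℂ) * Complex.exp (inner ℝ ξ x * Complex.I) ∂ν =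
        δ.toReal * (Complex.exp (charFun ν x) * charFun γ x) := by
  set s := fourierSeq m δ γ with hs
  have hfin : ∀ {μ : Measure (Space N)}, expMoment μ ≤ 1 → IsFiniteMeasure μ := fun h =>
    isFiniteMeasure_of_expMoment (ne_top_of_le_ne_top ENNReal.one_ne_top h)
  have hs1 : ∀ n, expMoment (s n) ≤ 1 := by
    intro n
    induction n with
    | zero => simp [hs, fourierSeq, expMoment]
    | succ n ih =>
      have := hfin ih
      refine (expMoment_fourierStep_le m δ γ (s n) hC).trans (le_trans ?_ hδ)
      gcongr
      exact expMoment_convExp_le _ ih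
  have hsf : ∀ n, IsFiniteMeasure (s n) := fun n => hfin (hs1 n)
  have htop : ∀ n, expMoment (s n) ≠ ∞ := fun n => ne_top_of_le_ne_top ENNReal.one_ne_top (hs1 n)
  have hmono : ∀ n, s n ≤ s (n + 1) := by
    intro n
    induction n with
    | zero => exact Measure.zero_le _
    | succ n ih => exact fourierStep_mono m δ γ ih
  have him : ∀ n x, (charFun (s n) x).im = 0 := by
    intro n
    induction n with
    | zero => intro x; simp [hs, fourierSeq]
    | succ n ih => exact charFun_fourierStep_im m δ γ (s n) (hs1 n) (htop (n + 1)) hγ ih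
  have heq : ∀ n x, ∫ ξ, ((‖ξ‖ ^ (2 * m) : ℝ) : ℂ) * Complex.exp (inner ℝ ξ x * Complex.I)
      ∂(s (n + 1)) = δ.toReal * (Complex.exp (charFun (s n) x) * charFun γ x) := fun n x =>
    integral_pow_fourierStep m hδ0 γ (s n) (hs1 n) (htop (n + 1)) x
  set σ : ℕ → Measure (Space N) := fun n => s (n + 1) - s n with hσ
  have hσs : ∀ n, s (n + 1) = s n + σ n := fun n => by
    change s (n + 1) = s n + (s (n + 1) - s n)
    rw [add_comm (s n)]
    exact (Measure.sub_add_cancel_of_le (hmono n)).symm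
  have hlin : ∀ (g : Space N → ℝ≥0∞) n,
      ∑ i ∈ Finset.range n, ∫⁻ ξ, g ξ ∂(σ i) = ∫⁻ ξ, g ξ ∂(s n) := by
    intro g n
    induction n with
    | zero => simp [hs, fourierSeq]
    | succ n ih => rw [Finset.sum_range_succ, ih, hσs, lintegral_add_measure]
  have hν1 : expMoment (Measure.sum σ) ≤ 1 := by
    unfold expMoment
    rw [lintegral_sum_measure]
    exact ENNReal.tsum_le_of_sum_range_le fun n => by rw [hlin]; exact hs1 n
  have hνtop : expMoment (Measure.sum σ) ≠ ∞ := ne_top_of_le_ne_top ENNReal.one_ne_top hν1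
  have hνf := hfin hν1
  have hlim : ∀ g : Space N → ℂ, Integrable g (Measure.sum σ) →
      Filter.Tendsto (fun n => ∫ ξ, g ξ ∂(s n)) Filter.atTop
        (nhds (∫ ξ, g ξ ∂(Measure.sum σ))) := by
    intro g hg
    have hgσ : ∀ n, Integrable g (σ n) := fun n => hg.mono_measure (Measure.le_sum σ n)
    have hgs : ∀ n, Integrable g (s n) ∧
        ∑ i ∈ Finset.range n, ∫ ξ, g ξ ∂(σ i) = ∫ ξ, g ξ ∂(s n) := by
      intro n
      induction n with
      | zero => simp [hs, fourierSeq]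
      | succ n ih =>
        rw [hσs]
        exact ⟨ih.1.add_measure (hgσ n), by
          rw [Finset.sum_range_succ, ih.2, integral_add_measure ih.1 (hgσ n)]⟩
    have := (hasSum_integral_measure hg).tendsto_sum_nat
    simpa only [(hgs _).2] using this
  have hcf : ∀ x, Filter.Tendsto (fun n => charFun (s n) x) Filter.atTop
      (nhds (charFun (Measure.sum σ) x)) := fun x => by
    simp_rw [charFun_apply]
    exact hlim _ (integrable_cexp_inner _ x)
  refine ⟨Measure.sum σ, hν1, fun x => ?_, fun x => ?_⟩
  · have h1 := (Complex.continuous_im.tendsto _).comp (hcf x)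
    simp only [Function.comp_def, him] at h1
    exact tendsto_nhds_unique h1 tendsto_const_nhds
  · have h1 := (hlim _ (integrable_pow_mul_cexp hνtop (2 * m) x)).comp
      (Filter.tendsto_add_atTop_nat 1)
    simp only [Function.comp_def, heq] at h1
    have h2 : Filter.Tendsto
        (fun n => (δ.toReal : ℂ) * (Complex.exp (charFun (s n) x) * charFun γ x)) Filter.atTop
        (nhds (δ.toReal * (Complex.exp (charFun (Measure.sum σ) x) * charFun γ x))) :=
      (((Complex.continuous_exp.tendsto _).comp (hcf x)).mul_const _).const_mul _
    exact tendsto_nhds_unique h1 h2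

/-! ### The Gaussian source measure. -/

/-- The measure with density `exp (-∑ b i ξ_i²)`. -/
def gaussMeasure (b : Fin N → ℝ) : Measure (Space N) :=
  volume.withDensity fun ξ => ENNReal.ofReal (Real.exp (-∑ i, b i * ξ i ^ 2))

theorem continuous_gaussDensity (b : Fin N → ℝ) :
    Continuous fun ξ : Space N => Real.exp (-∑ i, b i * ξ i ^ 2) := by fun_prop

theorem gaussDensity_le {b : Fin N → ℝ} (hb : ∀ i, 1 ≤ b i) (ξ : Space N) :
    Real.exp (-∑ i, b i * ξ i ^ 2) ≤ Real.exp (-‖ξ‖ ^ 2) := by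
  refine Real.exp_le_exp.2 ?_
  rw [EuclideanSpace.norm_sq_eq, neg_le_neg_iff]
  refine Finset.sum_le_sum fun i _ => ?_
  rw [Real.norm_eq_abs, sq_abs]
  nlinarith [hb i, sq_nonneg (ξ i)]

theorem integrable_exp_neg_half_sq :
    Integrable (fun ξ : Space N => Real.exp (-(1 / 2) * ‖ξ‖ ^ 2)) := by
  have h := (GaussianFourier.integrable_cexp_neg_mul_sq_norm_add (V := Space N)
    (b := (1 / 2 : ℂ)) (by norm_num) 0 0).norm
  refine h.congr (Filter.Eventually.of_forall fun ξ => ?_)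
  simp only [zero_mul, add_zero]
  have : (-(1 / 2) * (‖ξ‖ : ℂ) ^ 2) = ((-(1 / 2) * ‖ξ‖ ^ 2 : ℝ) : ℂ) := by push_cast; ring
  rw [this, ← Complex.ofReal_exp, Complex.norm_real, Real.norm_of_nonneg (Real.exp_pos _).le]

theorem lintegral_symb_ball_ne_top (m : ℕ) (hN : 2 * m < N) :
    ∫⁻ ξ, (Metric.ball (0 : Space N) 1).indicator (symb m) ξ ≠ ∞ := by
  rw [lintegral_indicator measurableSet_ball]
  have hm : Measurable fun ξ : Space N => (‖ξ‖ ^ (2 * m))⁻¹ := by fun_prop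
  have h1 : IntegrableOn (fun ξ : Space N => (‖ξ‖ ^ (2 * m))⁻¹) (Metric.ball 0 1) volume := by
    refine integrableOn_ball_of_norm_le_rpow (C := 1) (α := (2 * m : ℕ)) ?_ ?_ ?_
      hm.aestronglyMeasurable
    · rw [finrank_euclideanSpace_fin]; omega
    · rw [finrank_euclideanSpace_fin]; exact_mod_cast hN
    · refine Filter.Eventually.of_forall fun ξ => ?_
      rw [Real.norm_of_nonneg (by positivity), one_mul, Real.rpow_neg (norm_nonneg _),
        Real.rpow_natCast]
  have h2 := h1.2
  rw [hasFiniteIntegral_iff_ofReal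
    (Filter.Eventually.of_forall fun ξ => by positivity)] at h2
  refine ne_of_lt (lt_of_le_of_lt (le_of_eq ?_) h2)
  have : Nontrivial (Space N) := Module.nontrivial_of_finrank_pos (R := ℝ) (by
    rw [finrank_euclideanSpace_fin]; omega)
  refine lintegral_congr_ae ?_
  have hne : ∀ᵐ ξ : Space N ∂(volume.restrict (Metric.ball 0 1)), ξ ≠ 0 :=
    ae_restrict_of_ae (by simp [ae_iff])
  filter_upwards [hne] with ξ hξ
  have hp : 0 < ‖ξ‖ := norm_pos_iff.2 hξ
  unfold symb
  rw [ENNReal.ofReal_inv_of_pos (by positivity), ENNReal.ofReal_pow hp.le, ofReal_norm]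

theorem symb_le_indicator_add_one (m : ℕ) (ξ : Space N) :
    symb m ξ ≤ (Metric.ball (0 : Space N) 1).indicator (symb m) ξ + 1 := by
  by_cases h : ξ ∈ Metric.ball (0 : Space N) 1
  · rw [Set.indicator_of_mem h]; exact le_self_add
  · rw [Set.indicator_of_notMem h, zero_add]
    have h1 : 1 ≤ ‖ξ‖ := by simpa using h
    unfold symb
    rw [ENNReal.inv_le_one, ← ofReal_norm]
    exact one_le_pow₀ (ENNReal.one_le_ofReal.2 h1)

/-- Split the symbol into its part on the unit ball, integrable since `2 * m < N`, and a remainder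
at most `1`. The weighted Gaussian density is bounded, so translation invariance handles the first
part uniformly in `η`; integrability handles the second. -/
theorem gaussMeasure_kernel_bound {b : Fin N → ℝ} (hb : ∀ i, 1 ≤ b i) (m : ℕ) (hN : 2 * m < N) :
    ∃ C : ℝ≥0∞, C ≠ ∞ ∧ ∀ η : Space N,
      ∫⁻ ξ, ENNReal.ofReal (Real.exp ‖ξ‖) * symb m (η + ξ) ∂(gaussMeasure b) ≤ C := by
  set ι : Space N → ℝ≥0∞ := (Metric.ball (0 : Space N) 1).indicator (symb m) with hι
  have hιm : Measurable ι := (measurable_symb m).indicator measurableSet_ball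
  set K : ℝ≥0∞ := ∫⁻ ξ : Space N, ENNReal.ofReal (Real.exp 1 * Real.exp (-(1 / 2) * ‖ξ‖ ^ 2))
  have hK : K ≠ ∞ := by
    have h1 := ((integrable_exp_neg_half_sq (N := N)).const_mul (Real.exp 1)).2
    rw [hasFiniteIntegral_iff_ofReal
      (Filter.Eventually.of_forall fun ξ => by positivity)] at h1
    exact h1.ne
  refine ⟨ENNReal.ofReal (Real.exp 1) * (∫⁻ ξ, ι ξ) + K, ?_, fun η => ?_⟩
  · exact ENNReal.add_ne_top.2 ⟨ENNReal.mul_ne_top ENNReal.ofReal_ne_top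
      (lintegral_symb_ball_ne_top m hN), hK⟩
  · unfold gaussMeasure
    have hd : Measurable fun ξ : Space N => ENNReal.ofReal (Real.exp (-∑ i, b i * ξ i ^ 2)) :=
      (continuous_gaussDensity b).measurable.ennreal_ofReal
    have hg : Measurable fun ξ : Space N =>
        ENNReal.ofReal (Real.exp ‖ξ‖) * symb m (η + ξ) :=
      measurable_expWeight.mul ((measurable_symb m).comp (measurable_const_add η))
    rw [lintegral_withDensity_eq_lintegral_mul _ hd hg]
    have hshift : Measurable fun ξ : Space N => ι (η + ξ) := hιm.comp (measurable_const_add η)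
    have hpt : ∀ ξ : Space N, ENNReal.ofReal (Real.exp (-∑ i, b i * ξ i ^ 2)) *
          (ENNReal.ofReal (Real.exp ‖ξ‖) * symb m (η + ξ)) ≤
        ENNReal.ofReal (Real.exp 1) * ι (η + ξ) +
          ENNReal.ofReal (Real.exp 1 * Real.exp (-(1 / 2) * ‖ξ‖ ^ 2)) := by
      intro ξ
      have h1 : Real.exp (-∑ i, b i * ξ i ^ 2) * Real.exp ‖ξ‖ ≤
          Real.exp 1 * Real.exp (-(1 / 2) * ‖ξ‖ ^ 2) := by
        refine (mul_le_mul_of_nonneg_right (gaussDensity_le hb ξ) (Real.exp_pos _).le).trans ?_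
        rw [← Real.exp_add, ← Real.exp_add]
        exact Real.exp_le_exp.2 (by nlinarith [sq_nonneg (‖ξ‖ - 1)])
      have h2 : Real.exp 1 * Real.exp (-(1 / 2) * ‖ξ‖ ^ 2) ≤ Real.exp 1 :=
        mul_le_of_le_one_right (Real.exp_pos _).le
          (Real.exp_le_one_iff.2 (by nlinarith [sq_nonneg ‖ξ‖]))
      rw [← mul_assoc, ← ENNReal.ofReal_mul (Real.exp_pos _).le]
      calc _ ≤ ENNReal.ofReal (Real.exp 1 * Real.exp (-(1 / 2) * ‖ξ‖ ^ 2)) * (ι (η + ξ) + 1) :=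
            mul_le_mul' (ENNReal.ofReal_le_ofReal h1) (symb_le_indicator_add_one m _)
        _ = ENNReal.ofReal (Real.exp 1 * Real.exp (-(1 / 2) * ‖ξ‖ ^ 2)) * ι (η + ξ) +
            ENNReal.ofReal (Real.exp 1 * Real.exp (-(1 / 2) * ‖ξ‖ ^ 2)) := by
          rw [mul_add, mul_one]
        _ ≤ _ := by gcongr
    refine (lintegral_mono hpt).trans ?_
    rw [lintegral_add_left (hshift.const_mul _), lintegral_const_mul _ hshift,
      lintegral_add_left_eq_self ι η]

theorem charFun_gaussMeasure {b : Fin N → ℝ} (hb : ∀ i, 0 < b i) :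
    ∃ κ : ℝ, 0 < κ ∧ ∀ x : Space N,
      charFun (gaussMeasure b) x = ((κ * Real.exp (-∑ i, x i ^ 2 / (4 * b i)) : ℝ) : ℂ) := by
  refine ⟨∏ i, (Real.pi / b i) ^ (1 / 2 : ℝ), Finset.prod_pos fun i _ => by
    have := hb i; positivity, fun x => ?_⟩
  have hd : Measurable fun ξ : Space N => (Real.exp (-∑ i, b i * ξ i ^ 2)).toNNReal :=
    (continuous_gaussDensity b).measurable.real_toNNReal
  have h1 : charFun (gaussMeasure b) x = ∫ ξ : Space N,
      Complex.exp (-∑ i, (b i : ℂ) * (ξ i : ℂ) ^ 2 + ∑ i, (x i * Complex.I) * (ξ i : ℂ)) := by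
    rw [charFun_apply]
    unfold gaussMeasure
    simp only [ENNReal.ofReal]
    rw [integral_withDensity_eq_integral_smul hd]
    refine integral_congr_ae (Filter.Eventually.of_forall fun ξ => ?_)
    simp only [NNReal.smul_def, Real.coe_toNNReal _ (Real.exp_pos _).le, Complex.real_smul]
    rw [Complex.exp_add, Complex.ofReal_exp]
    congr 2
    · push_cast; rfl
    · simp only [PiLp.inner_apply, RCLike.inner_apply, conj_trivial]
      push_cast
      rw [Finset.sum_mul]
      exact Finset.sum_congr rfl fun i _ => by ring
  rw [h1, ← (PiLp.volume_preserving_toLp (Fin N)).integral_comp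
    (MeasurableEquiv.toLp 2 _).measurableEmbedding]
  have h2 := GaussianFourier.integral_cexp_neg_sum_mul_add (ι := Fin N) (b := fun i => (b i : ℂ))
    (by simpa using hb) (fun i => x i * Complex.I)
  refine Eq.trans ?_ (h2.trans ?_)
  · rfl
  · rw [← Finset.sum_neg_distrib, Real.exp_sum, ← Finset.prod_mul_distrib, Complex.ofReal_prod]
    refine Finset.prod_congr rfl fun i _ => ?_
    rw [← Complex.ofReal_div, Complex.ofReal_mul, Complex.ofReal_exp,
      Complex.ofReal_cpow (by have := hb i; positivity), mul_pow, Complex.I_sq]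
    push_cast
    congr 2
    ring

theorem isFiniteMeasure_gaussMeasure {b : Fin N → ℝ} (hb : ∀ i, 1 ≤ b i) :
    IsFiniteMeasure (gaussMeasure b) := by
  have h : Integrable fun ξ : Space N => Real.exp (-∑ i, b i * ξ i ^ 2) := by
    refine (integrable_exp_neg_half_sq (N := N)).mono
      (continuous_gaussDensity b).aestronglyMeasurable (Filter.Eventually.of_forall fun ξ => ?_)
    rw [Real.norm_of_nonneg (Real.exp_pos _).le, Real.norm_of_nonneg (Real.exp_pos _).le]
    refine (gaussDensity_le hb ξ).trans (Real.exp_le_exp.2 ?_)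
    nlinarith [sq_nonneg ‖ξ‖]
  exact isFiniteMeasure_withDensity_ofReal h.2

/-! ### Iterated Laplacians of characteristic functions. -/

theorem memLp_id_of_integrable_pow {μ : Measure (Space N)}
    (h : ∀ k : ℕ, Integrable (fun ξ => ‖ξ‖ ^ k) μ) (k : ℕ) :
    MemLp (id : Space N → Space N) k μ := by
  rcases Nat.eq_zero_or_pos k with rfl | hk
  · simp only [Nat.cast_zero]
    exact memLp_zero_iff_aestronglyMeasurable.2 aestronglyMeasurable_id
  · refine (integrable_norm_rpow_iff aestronglyMeasurable_id (by positivity)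
      (ENNReal.natCast_ne_top k)).1 ?_
    simpa using h k

theorem isFiniteMeasure_of_integrable_pow {μ : Measure (Space N)}
    (h : ∀ k : ℕ, Integrable (fun ξ => ‖ξ‖ ^ k) μ) : IsFiniteMeasure μ := by
  have := h 0
  simp only [pow_zero] at this
  exact (integrable_const_iff_isFiniteMeasure one_ne_zero).1 this

/-- The measure with density `‖ξ‖²` with respect to `μ`. -/
def sqDensity (μ : Measure (Space N)) : Measure (Space N) :=
  μ.withDensity fun ξ => ((‖ξ‖₊ ^ 2 : NNReal) : ℝ≥0∞)

theorem integrable_sqDensity {μ : Measure (Space N)}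
    (h : ∀ k : ℕ, Integrable (fun ξ => ‖ξ‖ ^ k) μ) (k : ℕ) :
    Integrable (fun ξ => ‖ξ‖ ^ k) (sqDensity μ) := by
  unfold sqDensity
  rw [integrable_withDensity_iff_integrable_smul (by fun_prop)]
  refine (h (2 + k)).congr (Filter.Eventually.of_forall fun ξ => ?_)
  simp [NNReal.smul_def, pow_add]

theorem integral_sqDensity (μ : Measure (Space N)) (g : Space N → ℂ) :
    ∫ ξ, g ξ ∂(sqDensity μ) = ∫ ξ, ((‖ξ‖ ^ 2 : ℝ) : ℂ) * g ξ ∂μ := by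
  unfold sqDensity
  rw [integral_withDensity_eq_integral_smul (by fun_prop)]
  refine integral_congr_ae (Filter.Eventually.of_forall fun ξ => ?_)
  simp [NNReal.smul_def]

theorem contDiff_charFun_top {μ : Measure (Space N)}
    (h : ∀ k : ℕ, Integrable (fun ξ => ‖ξ‖ ^ k) μ) :
    ContDiff ℝ ((⊤ : ℕ∞) : WithTop ℕ∞) (charFun μ) := by
  have := isFiniteMeasure_of_integrable_pow h
  exact contDiff_charFun' (memLp_id_of_integrable_pow h)

theorem laplacian_charFun {μ : Measure (Space N)}
    (h : ∀ k : ℕ, Integrable (fun ξ => ‖ξ‖ ^ k) μ) (x : Space N) :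
    Laplacian.laplacian (charFun μ) x = -charFun (sqDensity μ) x := by
  have := isFiniteMeasure_of_integrable_pow h
  rw [InnerProductSpace.laplacian_eq_iteratedFDeriv_orthonormalBasis _
    (EuclideanSpace.basisFun (Fin N) ℝ)]
  have h2 : MemLp (id : Space N → Space N) (2 : ℕ) μ := memLp_id_of_integrable_pow h 2
  simp only [iteratedFDeriv_charFun h2]
  rw [← Finset.mul_sum, Complex.I_sq, neg_one_mul, charFun_apply, integral_sqDensity]
  rw [← integral_finsetSum]
  · congr 1
    refine integral_congr_ae (Filter.Eventually.of_forall fun ξ => ?_)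
    simp only [← Finset.sum_mul]
    congr 1
    rw [EuclideanSpace.norm_sq_eq]
    simp [Fin.prod_univ_two, sq, EuclideanSpace.inner_single_right]
  · intro i _
    refine (h 2).mono (by fun_prop) (Filter.Eventually.of_forall fun ξ => ?_)
    have hi : |ξ i| ≤ ‖ξ‖ := by simpa using PiLp.norm_apply_le ξ i
    simp only [Fin.prod_univ_two]
    simp [EuclideanSpace.inner_single_right]
    rw [← abs_mul_abs_self]
    nlinarith [abs_nonneg (ξ i)]

/-- Each Laplacian multiplies the measure by `-|ξ|²`; the induction runs over the measure and the
constant, which absorbs the sign. -/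
theorem iterLap_re_charFun (k : ℕ) {μ : Measure (Space N)}
    (h : ∀ k : ℕ, Integrable (fun ξ => ‖ξ‖ ^ k) μ) (c : ℝ) (x : Space N) :
    iterLap k (fun x => c * (charFun μ x).re) x = (-1) ^ k * c *
      (∫ ξ, ((‖ξ‖ ^ (2 * k) : ℝ) : ℂ) * Complex.exp (inner ℝ ξ x * Complex.I) ∂μ).re := by
  induction k generalizing μ c with
  | zero => simp [iterLap_zero, charFun_apply]
  | succ k ih =>
    have h1 : Laplacian.laplacian (fun x => c * (charFun μ x).re) =
        fun x => (-c) * (charFun (sqDensity μ) x).re := by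
      funext y
      have := ((contDiff_charFun_top h).contDiffAt.of_le
        (WithTop.coe_le_coe.2 le_top) : ContDiffAt ℝ 2 (charFun μ) y).laplacian_CLM_comp_left
          (l := c • Complex.reCLM)
      rw [Function.comp_apply, laplacian_charFun h] at this
      refine Eq.trans ?_ (this.trans ?_)
      · rfl
      · simp
    rw [iterLap_succ, h1, ih (integrable_sqDensity h), integral_sqDensity]
    have h2 : ∀ ξ : Space N, ((‖ξ‖ ^ 2 : ℝ) : ℂ) * (((‖ξ‖ ^ (2 * k) : ℝ) : ℂ) *
        Complex.exp (inner ℝ ξ x * Complex.I)) =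
        ((‖ξ‖ ^ (2 * (k + 1)) : ℝ) : ℂ) * Complex.exp (inner ℝ ξ x * Complex.I) := fun ξ => by
      push_cast; ring
    simp only [h2]
    ring

/-! ### The stable nonradial solution. -/

theorem iterLap_add (k : ℕ) {f g : Space N → ℝ}
    (hf : ContDiff ℝ ((⊤ : ℕ∞) : WithTop ℕ∞) f) (hg : ContDiff ℝ ((⊤ : ℕ∞) : WithTop ℕ∞) g) :
    iterLap k (fun x => f x + g x) = fun x => iterLap k f x + iterLap k g x := by
  induction k with
  | zero => rfl
  | succ k ih =>
    funext x
    rw [iterLap_succ', ih, iterLap_succ', iterLap_succ']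
    exact ((contDiff_iterLap hf k).contDiffAt.of_le (WithTop.coe_le_coe.2 le_top)).laplacian_add
      ((contDiff_iterLap hg k).contDiffAt.of_le (WithTop.coe_le_coe.2 le_top))

theorem contDiff_const_add_sum_sq (c : ℝ) (w : Fin N → ℝ) {n : WithTop ℕ∞} :
    ContDiff ℝ n fun x : Space N => c + ∑ i, w i * x i ^ 2 := by fun_prop

theorem laplacian_const_add_sum_sq (c : ℝ) (w : Fin N → ℝ) :
    (Laplacian.laplacian (fun x : Space N => c + ∑ i, w i * x i ^ 2) : Space N → ℝ) =
      fun _ => ∑ i, 2 * w i := by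
  have hp : ∀ (i : Fin N) (x : Space N),
      HasFDerivAt (fun x : Space N => x i) (EuclideanSpace.proj i : Space N →L[ℝ] ℝ) x :=
    fun i x => (EuclideanSpace.proj i : Space N →L[ℝ] ℝ).hasFDerivAt
  have h1 : ∀ i, pd i (fun x : Space N => c + ∑ i, w i * x i ^ 2) =
      fun x => 2 * w i * x i := by
    intro i
    ext x
    have h := (HasFDerivAt.fun_sum (u := Finset.univ) fun j _ =>
      ((hp j x).pow 2).const_mul (w j)).const_add c
    unfold pd
    rw [h.fderiv]
    simp
    ring
  rw [laplacian_eq_sum_pd (contDiff_const_add_sum_sq c w)]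
  ext x
  refine Finset.sum_congr rfl fun i _ => ?_
  rw [h1]
  unfold pd
  rw [((hp i x).const_mul (2 * w i)).fderiv]
  simp

theorem iterLap_const_add_sum_sq {m : ℕ} (hm : 2 ≤ m) (c : ℝ) (w : Fin N → ℝ) (x : Space N) :
    iterLap m (fun x : Space N => c + ∑ i, w i * x i ^ 2) x = 0 := by
  obtain ⟨k, rfl⟩ := Nat.exists_eq_add_of_le' hm
  rw [iterLap_succ, laplacian_const_add_sum_sq, iterLap_succ,
    InnerProductSpace.laplacian_const]
  induction k with
  | zero => rfl
  | succ k ih =>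
    have h0 : (0 : Space N → ℝ) = fun _ => 0 := rfl
    rw [iterLap_succ]
    nth_rewrite 1 [h0]
    rw [InnerProductSpace.laplacian_const]
    exact ih (by omega)

theorem sum_sq_add_single (w : Fin N → ℝ) (x : Space N) (j : Fin N) (t : ℝ) :
    ∑ i, w i * (x + EuclideanSpace.single j t) i ^ 2 +
      ∑ i, w i * (x - EuclideanSpace.single j t) i ^ 2 =
      2 * ∑ i, w i * x i ^ 2 + 2 * t ^ 2 * w j := by
  have h : 2 * t ^ 2 * w j = ∑ i, if i = j then 2 * t ^ 2 * w i else 0 := by simp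
  rw [h, Finset.mul_sum, ← Finset.sum_add_distrib, ← Finset.sum_add_distrib]
  refine Finset.sum_congr rfl fun i _ => ?_
  by_cases hij : i = j
  · subst hij; simp; ring
  · simp [hij]; ring

/-- A bounded perturbation of a quadratic form with sufficiently different coefficients is not
radial. -/
theorem not_isRadialAbout_of_bounded {v : Space N → ℝ} (hv : ∀ x, |v x| ≤ 1) (c : ℝ)
    (w : Fin N → ℝ) {i j : Fin N} (hij : w i + 1 / 8 ≤ w j) (x₀ : Space N) :
    ¬ IsRadialAbout x₀ fun x => v x + (c + ∑ i, w i * x i ^ 2) := by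
  rintro ⟨f, hf⟩
  -- On the sphere of radius `5` about `x₀`, adding antipodal values cancels the linear terms.
  -- Changing the direction then alters the quadratic part by at least `50 / 8`, more than the `4`
  -- that `v` can compensate.
  have h : ∀ k : Fin N, v (x₀ + EuclideanSpace.single k 5) + v (x₀ - EuclideanSpace.single k 5) +
      2 * c + (2 * ∑ i, w i * x₀ i ^ 2 + 2 * 5 ^ 2 * w k) = 2 * f 5 := by
    intro k
    have h1 := hf (x₀ + EuclideanSpace.single k 5)
    have h2 := hf (x₀ - EuclideanSpace.single k 5)
    have e1 : ‖x₀ + EuclideanSpace.single k (5 : ℝ) - x₀‖ = 5 := by simp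
    have e2 : ‖x₀ - EuclideanSpace.single k (5 : ℝ) - x₀‖ = 5 := by
      rw [sub_sub_cancel_left, norm_neg]; simp
    rw [e1] at h1
    rw [e2] at h2
    rw [← sum_sq_add_single]
    linarith
  have hi := h i
  have hj := h j
  have b := fun x => abs_le.1 (hv x)
  linarith [(b (x₀ + EuclideanSpace.single i 5)).2, (b (x₀ - EuclideanSpace.single i 5)).2,
    (b (x₀ + EuclideanSpace.single j 5)).1, (b (x₀ - EuclideanSpace.single j 5)).1]

theorem exists_stable_nonradial {m : ℕ} (hm : 2 ≤ m) (hN : 2 * m < N) :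
    ∃ u : Space N → ℝ, IsEntireSolution m u ∧ IsStable m u ∧ ∀ x₀, ¬ IsRadialAbout x₀ u := by
  set i₀ : Fin N := ⟨0, by omega⟩
  set i₁ : Fin N := ⟨1, by omega⟩
  -- One exponent differs from the rest: the coefficients `-1 / (4 b_i)` are `-1 / 8` and `-1 / 4`,
  -- which gives the gap `1 / 8` and decay at least `e^{-|x|² / 8}`.
  set b : Fin N → ℝ := fun i => if i = i₀ then 2 else 1 with hbdef
  have hb0 : b i₀ = 2 := if_pos rfl
  have hb1 : b i₁ = 1 := if_neg (by simp [i₀, i₁])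
  have hb : ∀ i, 1 ≤ b i := fun i => by simp only [hbdef]; split_ifs <;> norm_num
  have hb2 : ∀ i, b i ≤ 2 := fun i => by simp only [hbdef]; split_ifs <;> norm_num
  set w : Fin N → ℝ := fun i => -(1 / (4 * b i)) with hwdef
  obtain ⟨c, hc, hst⟩ := exists_isStable_of_le_wt (N := N) m hN
  obtain ⟨C, hC, hCb⟩ := gaussMeasure_kernel_bound hb m hN
  obtain ⟨κ, hκ, hch⟩ := charFun_gaussMeasure fun i => zero_lt_one.trans_le (hb i)
  have := isFiniteMeasure_gaussMeasure hb
  set M : ℝ≥0∞ := C * ∑' n : ℕ, (n.factorial : ℝ≥0∞)⁻¹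
  have hM : M ≠ ∞ := ENNReal.mul_ne_top hC tsum_inv_factorial_ne_top
  set A : ℝ := κ * Real.exp 1 * (8 ^ m * (m.factorial * Real.exp 1)) with hA
  have hA0 : 0 < A := by positivity
  -- The first bound puts `e^u` under the Hardy weight with `ε = 8`, where `A` collects all
  -- constants; the second keeps the iteration in exponential moment at most one.
  set δ : ℝ := min (c / A) (M.toReal + 1)⁻¹ with hδdef
  have hM0 : 0 < M.toReal + 1 := by positivity
  have hδ : 0 < δ := lt_min (by positivity) (by positivity)
  have hδA : δ * A ≤ c := (le_div_iff₀ hA0).1 (min_le_left _ _)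
  have hδM : ENNReal.ofReal δ * M ≤ 1 := by
    rw [← ENNReal.ofReal_toReal hM, ← ENNReal.ofReal_mul hδ.le, ENNReal.ofReal_le_one]
    have : δ * (M.toReal + 1) ≤ 1 := (le_mul_inv_iff₀ hM0).1 (by rw [one_mul]; exact min_le_right _ _)
    linarith
  obtain ⟨ν, hν1, him, hfix⟩ := exists_fourier_fixed_point m (ENNReal.ofReal_pos.2 hδ).ne'
    (gaussMeasure b) hCb (fun x => by rw [hch]; exact Complex.ofReal_im _) hδM
  have hνtop : expMoment ν ≠ ∞ := ne_top_of_le_ne_top ENNReal.one_ne_top hν1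
  have hint := integrable_pow_norm hνtop
  have hνf := isFiniteMeasure_of_expMoment hνtop
  have hre : ∀ x, charFun ν x = ((charFun ν x).re : ℂ) := fun x =>
    Complex.ext rfl (by rw [him, Complex.ofReal_im])
  have hv : ∀ x, |(charFun ν x).re| ≤ 1 := fun x => by
    refine (Complex.abs_re_le_norm _).trans ((norm_charFun_le x).trans ?_)
    refine ENNReal.toReal_le_of_le_ofReal zero_le_one ?_
    rw [ENNReal.ofReal_one]
    exact (measure_univ_le_expMoment ν).trans hν1
  set u : Space N → ℝ := fun x =>
    (charFun ν x).re + (Real.log (δ * κ) + ∑ i, w i * x i ^ 2) with hu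
  have hvs : ContDiff ℝ ((⊤ : ℕ∞) : WithTop ℕ∞) fun x => (charFun ν x).re :=
    Complex.reCLM.contDiff.comp (contDiff_charFun_top hint)
  have hus : ContDiff ℝ ((⊤ : ℕ∞) : WithTop ℕ∞) u := hvs.add (contDiff_const_add_sum_sq _ w)
  have hexp : ∀ x, Real.exp (u x) =
      δ * κ * Real.exp (charFun ν x).re * Real.exp (∑ i, w i * x i ^ 2) := fun x => by
    rw [hu]
    simp only [Real.exp_add, Real.exp_log (mul_pos hδ hκ)]
    ring
  have hw : ∀ x : Space N, -∑ i, x i ^ 2 / (4 * b i) = ∑ i, w i * x i ^ 2 := fun x => by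
    rw [← Finset.sum_neg_distrib]
    exact Finset.sum_congr rfl fun i _ => by rw [hwdef]; ring
  refine ⟨u, ⟨hus, fun x => ?_⟩, ?_, ?_⟩
  · rw [hu, iterLap_add m hvs (contDiff_const_add_sum_sq _ w)]
    simp only [iterLap_const_add_sum_sq hm, add_zero]
    have h1 := iterLap_re_charFun m hint 1 x
    simp only [one_mul, mul_one] at h1
    have h2 : (δ : ℂ) * (Complex.exp (charFun ν x) * charFun (gaussMeasure b) x) =
        ((δ * κ * Real.exp (charFun ν x).re * Real.exp (∑ i, w i * x i ^ 2) : ℝ) : ℂ) := by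
      have h3 : Complex.exp (charFun ν x) = ((Real.exp (charFun ν x).re : ℝ) : ℂ) := by
        rw [Complex.ofReal_exp, ← hre x]
      rw [hch, hw, h3]
      push_cast
      ring
    rw [h1, hfix, ENNReal.toReal_ofReal hδ.le, h2, Complex.ofReal_re, ← hexp, ← mul_assoc,
      ← mul_pow]
    simp [hu]
  · refine hst 8 u (by norm_num) hus.continuous fun x => ?_
    have h1 : Real.exp (charFun ν x).re ≤ Real.exp 1 := Real.exp_le_exp.2 (abs_le.1 (hv x)).2
    have h2 : Real.exp (∑ i, w i * x i ^ 2) ≤ Real.exp (-‖x‖ ^ 2 / 8) := by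
      refine Real.exp_le_exp.2 ?_
      rw [EuclideanSpace.norm_sq_eq, neg_div, Finset.sum_div, ← Finset.sum_neg_distrib]
      refine Finset.sum_le_sum fun i _ => ?_
      rw [Real.norm_eq_abs, sq_abs, hwdef]
      have h3 : (1 : ℝ) / 8 ≤ 1 / (4 * b i) :=
        one_div_le_one_div_of_le (by linarith [hb i]) (by linarith [hb2 i])
      nlinarith [sq_nonneg (x i)]
    rw [hexp]
    calc _ ≤ δ * κ * Real.exp 1 *
          (8 ^ m * (m.factorial * Real.exp 1) * wt 8 m x) := by
          gcongr
          exact h2.trans (exp_neg_div_le_mul_wt m (by norm_num) x)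
      _ = δ * A * wt 8 m x := by rw [hA]; ring
      _ ≤ c * wt 8 m x := mul_le_mul_of_nonneg_right hδA (wt_pos (by norm_num) m x).le
  · refine not_isRadialAbout_of_bounded hv _ w (i := i₁) (j := i₀) ?_
    simp only [hwdef, hb0, hb1]
    norm_num

end Polyharmonic

end

theorem corollary3p4 (m N : ℕ) (hm : 3 ≤ m) (hN : 2 * m < N) :
    (∃ u : Polyharmonic.Space N → ℝ,
      Polyharmonic.IsEntireSolution m u ∧ Polyharmonic.IsStable m u ∧
        ∀ x₀, ¬ Polyharmonic.IsRadialAbout x₀ u) ∧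
    (Even m →
      ∃ Φ : (Fin (m - 2) → ℝ) → ℝ, Polyharmonic.IsExistenceThreshold N m Φ ∧
        ∃ (a : Fin (m - 2) → ℝ) (u : Polyharmonic.Space N → ℝ),
          Polyharmonic.IsGlobalRadialSolution m a (Φ a) u ∧ Polyharmonic.IsStable m u) :=
  ⟨Polyharmonic.exists_stable_nonradial (by omega) hN,
    fun hev => Polyharmonic.exists_threshold_stable m hm hN hev⟩
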